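/- **Model.** Fix $p,d_0,h\ge 0$ and $\beta=(\beta_0,\beta_w^\top,\beta_f^\top)^\top\in\mathbb R^{1+p+d_0}$. Let $y_{t+h}=1$ if $\beta^\top z_t-\epsilon_{t+h}\ge 0$ and $y_{t+h}=0$ otherwise, where $z_t=(1,w_t^\top,f_t^\top)^\top$ with $w_t\in\mathbb R^p$ observed and $f_t\in\mathbb R^{d_0}$ unobserved, and let $x_{it}=\lambda_i^\top f_t+e_{it}$ for $i\le N$, $t\le T$. Let $X=(x_{it})$ be the $T\times N$ data matrix and let $\Phi_\epsilon,\phi_\epsilon$ be the distribution function and density of $\epsilon_t$. Put $u_t=\beta^\top z_t$ and $l_t(x)=y_{t+h}\log\Phi_\epsilon(x)+(1-y_{t+h})\log(1-\Phi_\epsilon(x))$. **Estimators.** $\tilde F=(\tilde f_1,\dots,\tilde f_T)^\top$ satisfies $\frac1{NT}XX^\top\tilde F=\tilde FV_{NT}$ and $\frac1T\tilde F^\top\tilde F=I_{d_0}$, where $V_{NT}$ is diagonal with the $d_0$ largest eigenvalues of $\frac1{NT}XX^\top$ in descending order; $\tilde z_t=(1,w_t^\top,\tilde f_t^\top)^\top$;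 and $\widehat\beta$ maximizes $b\mapsto\sum_{t=1}^{T-h}l_t(b^\top\tilde z_t)$ over $\mathbb R^{1+p+d_0}$ whenever a maximizer exists. **Mixing coefficients.** The coefficient of two $\sigma$-algebras is $\sup|P(A\cap B)-P(A)P(B)|$. $\alpha_{ij}(n)$ is the supremum of the coefficients of $\sigma(e_{is}:s\in I)$ and $\sigma(e_{jt}:t\in J)$ over time intervals $I,J$ with $|s-t|\ge n$ for all $s\in I,t\in J$ (so $\alpha_{ij}(0)$ compares the whole series); $\alpha(n)$ is the same quantity for the single process $(w_t,f_t,\epsilon_t)$. **Assumption 1.** For some $\delta>0$: (1) $(w_t,f_t,\epsilon_t)$ is strictly stationary, $\sum_{n\ge 0}\alpha(n)^{\delta/(4+\delta)}<\infty$ and $\mathbb E\|f_t\|^{4+\delta}<\infty$; (2) $\sup_i\mathbb E\|\lambda_i\|^{4+\delta}<\infty$ and $\frac1N\sum_{i\le N}\lambda_i\lambda_i^\top=\Sigma_\lambda+O_P(1/\sqrt N)$ with $\Sigma_\lambda$ positive definite; (3) each $(e_{it})_t$ is strictly stationary, $\mathbb E e_{it}=0$, $\sup_{i,t}\mathbb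 E|e_{it}|^{4+\delta}<\infty$, $\sum_{i,j\le N}\sum_{n\ge0}\alpha_{ij}(n)^{\delta/(4+\delta)}=O(N)$ and $\sup_i\sum_{n\ge1}\alpha_{ii}(n)^{\delta/(4+\delta)}<\infty$; (4) $\{w_t,\lambda_i,f_t\}$, $\{e_{it}\}$ and $\{\epsilon_t\}$ are mutually independent. **Assumption 2.** All $\epsilon_t$ have density $\phi_\epsilon$. There are intervals $\Xi_T=[\Xi_T^l,\Xi_T^u]$ and constants $c,B>0$, $b_U>b_L>0$, not depending on $T$, such that: $P(u_t\in\Xi_T\text{ for all }t\le T)\to1$; $|\phi_\epsilon|\ge c$ on $\Xi_T$ and $0<\Phi_\epsilon(\Xi_T^l)<\Phi_\epsilon(\Xi_T^u)<1$; $\phi_\epsilon$ is twice continuously differentiable on $\Xi_T$ with first and second derivatives bounded by $B$; $0<\Phi_\epsilon<1$ on $\mathbb R$, and for both values $0,1$ of $y_{t+h}$ the function $l_t$ is three times continuously differentiable on $\mathbb R$, with $|l_t''|,|l_t'''|\le B$ on $\mathbb R$, and $|l_t'|\le B$ and $b_L\le-l_t''\le b_U$ on $\Xi_T$. **Assumption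 3.** $\Sigma_\beta=\mathbb E[-l_t''(u_t)z_tz_t^\top]$ exists and is positive definite, and $\Omega_\beta=\lim_{T\to\infty}\frac1T\sum_{s,t=1}^{T-h}\mathbb E[\xi_t\xi_s^\top]$ exists and is positive definite, where $\xi_t=\frac{(y_{t+h}-\Phi_\epsilon(u_t))\phi_\epsilon(u_t)}{(1-\Phi_\epsilon(u_t))\Phi_\epsilon(u_t)}z_t$. **Theorem.** Under Assumptions 1–3, as $N,T\to\infty$ jointly (without any restriction on their relative rates), for every deterministic choice of the period $t=t_{N,T}\in\{1,\dots,T\}$ (in particular for every fixed $t$, and for $t=T$), $$\Phi_\epsilon(\widehat\beta^\top\tilde z_t)-\Phi_\epsilon(\beta^\top z_t)=O_P\!\left(\frac1{\sqrt N\wedge\sqrt T}\right).$$ -/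

import Mathlib

open MeasureTheory ProbabilityTheory Filter Topology
open scoped NNReal ENNReal Matrix

noncomputable section

/-! ### Stochastic orders, stationarity and strong mixing -/

/-- `X n = O_P(r n)` along the filter `l`. (For sets that are not measurable, `P` is the outer
measure.) -/
def IsBigOP {Ω ι : Type*} [MeasurableSpace Ω] (P : Measure Ω) (l : Filter ι)
    (X : ι → Ω → ℝ) (r : ι → ℝ) : Prop :=
  ∀ η : ℝ, 0 < η → ∃ K : ℝ, 0 < K ∧
    ∀ᶠ n in l, P {ω | K * r n < |X n ω|} ≤ ENNReal.ofReal η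

/-- Strict stationarity of a process: its law on path space is invariant under time shifts. -/
def StrictlyStationary {Ω S : Type*} [MeasurableSpace Ω] [MeasurableSpace S] (P : Measure Ω)
    (X : ℕ → Ω → S) : Prop :=
  ∀ k : ℕ, P.map (fun ω => fun t : ℕ => X (t + k) ω) = P.map (fun ω => fun t : ℕ => X t ω)

/-- The strong mixing coefficient `sup |P(A ∩ B) - P(A) P(B)|` between two σ-algebras. -/
def alphaCoeff {Ω : Type*} [MeasurableSpace Ω] (P : Measure Ω) (m₁ m₂ : MeasurableSpace Ω) : ℝ :=
  sSup {x : ℝ | ∃ A B : Set Ω, MeasurableSet[m₁] A ∧ MeasurableSet[m₂] B ∧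
    x = |P.real (A ∩ B) - P.real A * P.real B|}

/-- The σ-algebra generated by the variables `X t`, `t ∈ I`. -/
@[reducible] def sigmaOf {Ω S ι : Type*} [mS : MeasurableSpace S] (X : ι → Ω → S) (I : Set ι) :
    MeasurableSpace Ω :=
  ⨆ t ∈ I, mS.comap (X t)

/-- The strong mixing coefficient at lag `n` between two series `X` and `Y`: the supremum of the
coefficients between `X` on a time interval `I` and `Y` on a time interval `J`, where any time in
`I` and any time in `J` are at least `n` apart. For `n ≥ 1` one interval precedes the other, and
`n = 0` measures the dependence between the whole series. -/
def crossMixing {Ω S : Type*} [MeasurableSpace Ω] [MeasurableSpace S] (P : Measure Ω)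
    (X Y : ℕ → Ω → S) (n : ℕ) : ℝ :=
  sSup {x : ℝ | ∃ I J : Set ℕ, I.OrdConnected ∧ J.OrdConnected ∧
    (∀ s ∈ I, ∀ t ∈ J, n ≤ Nat.dist s t) ∧ x = alphaCoeff P (sigmaOf X I) (sigmaOf Y J)}

/-- The strong mixing coefficients of a single process. -/
def mixing {Ω S : Type*} [MeasurableSpace Ω] [MeasurableSpace S] (P : Measure Ω)
    (X : ℕ → Ω → S) (n : ℕ) : ℝ :=
  crossMixing P X X n

/-! ### The model -/

/-- Index set of the coefficients: intercept, `p` observed regressors, `d` factors. -/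
abbrev Coef (p d : ℕ) : Type := Unit ⊕ Fin p ⊕ Fin d

/-- The vector `(1, wᵀ, fᵀ)ᵀ`. -/
def regressor {p d : ℕ} (w : EuclideanSpace ℝ (Fin p)) (f : EuclideanSpace ℝ (Fin d)) :
    Coef p d → ℝ :=
  Sum.elim (fun _ => 1) (Sum.elim (fun j => w j) (fun j => f j))

/-- The primitive objects of the binary response factor-augmented model. Time and the
cross-section are indexed from `0`: the sample periods are `0, …, T - 1`, the units
`0, …, N - 1`. -/
structure FactorBinaryModel (Ω : Type*) (p d : ℕ) where
  /-- forecast horizon -/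
  h : ℕ
  /-- true coefficients `(β₀, β_w, β_f)` -/
  β : Coef p d → ℝ
  /-- observed regressors `w t` -/
  w : ℕ → Ω → EuclideanSpace ℝ (Fin p)
  /-- unobserved factors `f t` -/
  f : ℕ → Ω → EuclideanSpace ℝ (Fin d)
  /-- errors `ε t` of the binary equation -/
  ε : ℕ → Ω → ℝ
  /-- loadings `lam i` -/
  lam : ℕ → Ω → EuclideanSpace ℝ (Fin d)
  /-- idiosyncratic errors `e i t` of the factor model -/
  e : ℕ → ℕ → Ω → ℝ
  /-- density of the errors `ε t` -/
  φ : ℝ → ℝ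

/-- `y log Φ(x) + (1 - y) log (1 - Φ(x))`. -/
def logLikTerm (Φ : ℝ → ℝ) (y x : ℝ) : ℝ :=
  y * Real.log (Φ x) + (1 - y) * Real.log (1 - Φ x)

namespace FactorBinaryModel

variable {Ω : Type*} {p d : ℕ}

/-- `z_t = (1, w_tᵀ, f_tᵀ)ᵀ`. -/
def z (M : FactorBinaryModel Ω p d) (t : ℕ) (ω : Ω) : Coef p d → ℝ :=
  regressor (M.w t ω) (M.f t ω)

/-- `u_t = βᵀ z_t`. -/
def u (M : FactorBinaryModel Ω p d) (t : ℕ) (ω : Ω) : ℝ := M.β ⬝ᵥ M.z t ω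

open Classical in
/-- The binary response `y_{t+h}`. -/
def yLead (M : FactorBinaryModel Ω p d) (t : ℕ) (ω : Ω) : ℝ :=
  if 0 ≤ M.u t ω - M.ε (t + M.h) ω then 1 else 0

/-- The predictors `x_{it} = λ_iᵀ f_t + e_{it}`. -/
def x (M : FactorBinaryModel Ω p d) (i t : ℕ) (ω : Ω) : ℝ :=
  inner ℝ (M.lam i ω) (M.f t ω) + M.e i t ω

/-- The distribution function `Φ_ε` of the errors of the binary equation. -/
def Phi [MeasurableSpace Ω] (M : FactorBinaryModel Ω p d) (P : Measure Ω) (x : ℝ) : ℝ :=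
  cdf (P.map (M.ε 0)) x

/-- The `T × N` data matrix. -/
def dataMatrix (M : FactorBinaryModel Ω p d) (N T : ℕ) (ω : Ω) : Matrix (Fin T) (Fin N) ℝ :=
  Matrix.of fun t i => M.x i t ω

/-- `X Xᵀ / (N T)`. -/
def gram (M : FactorBinaryModel Ω p d) (N T : ℕ) (ω : Ω) : Matrix (Fin T) (Fin T) ℝ :=
  ((N : ℝ) * T)⁻¹ • (M.dataMatrix N T ω * (M.dataMatrix N T ω)ᵀ)

theorem gram_isHermitian (M : FactorBinaryModel Ω p d) (N T : ℕ) (ω : Ω) :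
    (M.gram N T ω).IsHermitian := by
  unfold gram Matrix.IsHermitian
  simp [Matrix.conjTranspose_eq_transpose_of_trivial]

/-- `g 0, …, g (T - 1)` are principal component estimates of the factors: the matrix `F` with
rows `g t` satisfies `(X Xᵀ / (N T)) F = F V` and `Fᵀ F / T = I`, where `V` is diagonal with the
`d` largest eigenvalues of `X Xᵀ / (N T)` in descending order (`eigenvalues₀` is antitone). -/
def IsPCA (M : FactorBinaryModel Ω p d) (N T : ℕ) (ω : Ω)
    (g : ℕ → EuclideanSpace ℝ (Fin d)) : Prop :=
  ∃ hd : d ≤ Fintype.card (Fin T),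
    let F : Matrix (Fin T) (Fin d) ℝ := Matrix.of fun t k => g t k
    M.gram N T ω * F =
        F * Matrix.diagonal
          (fun k : Fin d => (M.gram_isHermitian N T ω).eigenvalues₀ (Fin.castLE hd k)) ∧
      (T : ℝ)⁻¹ • (Fᵀ * F) = 1

/-- The factor-augmented log-likelihood of `b`, computed from factor estimates `g`. The sum runs
over the sample periods `t` for which `t + h` is a sample period too. -/
def logLik [MeasurableSpace Ω] (M : FactorBinaryModel Ω p d) (P : Measure Ω) (T : ℕ) (ω : Ω)
    (g : ℕ → EuclideanSpace ℝ (Fin d)) (b : Coef p d → ℝ) : ℝ :=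
  ∑ t ∈ (Finset.range T).filter (fun t => t + M.h < T),
    logLikTerm (M.Phi P) (M.yLead t ω) (b ⬝ᵥ regressor (M.w t ω) (g t))

/-- The score contribution
`ξ_t = (y_{t+h} - Φ(u_t)) φ(u_t) / ((1 - Φ(u_t)) Φ(u_t)) z_t`. -/
def score [MeasurableSpace Ω] (M : FactorBinaryModel Ω p d) (P : Measure Ω) (t : ℕ) (ω : Ω) :
    Coef p d → ℝ :=
  ((M.yLead t ω - M.Phi P (M.u t ω)) * M.φ (M.u t ω) /
    ((1 - M.Phi P (M.u t ω)) * M.Phi P (M.u t ω))) • M.z t ω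

/-- Integrand of minus the expected Hessian, `-l_t''(u_t) z_t z_tᵀ`. -/
def negHessian [MeasurableSpace Ω] (M : FactorBinaryModel Ω p d) (P : Measure Ω) (t : ℕ) (ω : Ω) :
    Matrix (Coef p d) (Coef p d) ℝ :=
  Matrix.of fun a b =>
    -iteratedDeriv 2 (logLikTerm (M.Phi P) (M.yLead t ω)) (M.u t ω) * M.z t ω a * M.z t ω b

/-- Conditions on dependence and moments. -/
structure SamplingAssumptions [MeasurableSpace Ω] (M : FactorBinaryModel Ω p d) (P : Measure Ω)
    (δ : ℝ) (Slam : Matrix (Fin d) (Fin d) ℝ) : Prop where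
  δ_pos : 0 < δ
  measurable_w : ∀ t, Measurable (M.w t)
  measurable_f : ∀ t, Measurable (M.f t)
  measurable_ε : ∀ t, Measurable (M.ε t)
  measurable_lam : ∀ i, Measurable (M.lam i)
  measurable_e : ∀ i t, Measurable (M.e i t)
  /-- `(w_t, f_t, ε_t)` is strictly stationary. -/
  stationary : StrictlyStationary P (fun t ω => (M.w t ω, M.f t ω, M.ε t ω))
  /-- `(w_t, f_t, ε_t)` is strongly mixing with summable powers of its coefficients. -/
  summable_mixing : Summable fun n =>
    mixing P (fun t ω => (M.w t ω, M.f t ω, M.ε t ω)) n ^ (δ / (4 + δ))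
  moment_f : ∃ C : ℝ≥0, ∀ t, ∫⁻ ω, ‖M.f t ω‖ₑ ^ (4 + δ) ∂P ≤ C
  moment_lam : ∃ C : ℝ≥0, ∀ i, ∫⁻ ω, ‖M.lam i ω‖ₑ ^ (4 + δ) ∂P ≤ C
  posDef_Slam : Slam.PosDef
  /-- `Λᵀ Λ / N = Σ_λ + O_P(1 / √N)`. -/
  loadings : ∀ a b : Fin d, IsBigOP P atTop
    (fun (N : ℕ) ω => (N : ℝ)⁻¹ * ∑ i ∈ Finset.range N, M.lam i ω a * M.lam i ω b - Slam a b)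
    (fun N : ℕ => 1 / √(N : ℝ))
  stationary_e : ∀ i, StrictlyStationary P (M.e i)
  summable_mixing_e : ∀ i j, Summable fun n => crossMixing P (M.e i) (M.e j) n ^ (δ / (4 + δ))
  sum_mixing_e : ∃ C : ℝ, ∀ N : ℕ, ∑ i ∈ Finset.range N, ∑ j ∈ Finset.range N,
    ∑' n, crossMixing P (M.e i) (M.e j) n ^ (δ / (4 + δ)) ≤ C * N
  max_mixing_e : ∃ C : ℝ, ∀ i, ∑' n, mixing P (M.e i) (n + 1) ^ (δ / (4 + δ)) ≤ C
  moment_e : ∃ C : ℝ≥0, ∀ i t, ∫⁻ ω, ‖M.e i t ω‖ₑ ^ (4 + δ) ∂P ≤ C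
  mean_e : ∀ i t, ∫ ω, M.e i t ω ∂P = 0
  /-- `{w_t, λ_i, f_t}`, `{e_it}` and `{ε_t}` are mutually independent. -/
  indep : iIndep ![sigmaOf M.w Set.univ ⊔ sigmaOf M.lam Set.univ ⊔ sigmaOf M.f Set.univ,
    sigmaOf (fun q : ℕ × ℕ => M.e q.1 q.2) Set.univ, sigmaOf M.ε Set.univ] P

/-- Conditions on the error distribution and on the individual log-likelihood. The interval
`Ξ_T` is `[Ξl T, Ξu T]`. -/
structure LikelihoodAssumptions [MeasurableSpace Ω] (M : FactorBinaryModel Ω p d) (P : Measure Ω)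
    (Ξl Ξu : ℕ → ℝ) (c B bL bU : ℝ) : Prop where
  measurable_φ : Measurable M.φ
  φ_nonneg : ∀ x, 0 ≤ M.φ x
  /-- All `ε_t` have density `φ`. -/
  density : ∀ t, P.map (M.ε t) = volume.withDensity (fun x => ENNReal.ofReal (M.φ x))
  /-- All `βᵀ z_t`, `t < T`, lie in `Ξ_T` with probability tending to one. -/
  support : Tendsto (fun T : ℕ => P {ω | ∀ t < T, M.u t ω ∈ Set.Icc (Ξl T) (Ξu T)}) atTop (𝓝 1)
  c_pos : 0 < c
  φ_lower : ∀ T, ∀ x ∈ Set.Icc (Ξl T) (Ξu T), c ≤ |M.φ x|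
  Phi_left : ∀ T, 0 < M.Phi P (Ξl T)
  Phi_lt : ∀ T, M.Phi P (Ξl T) < M.Phi P (Ξu T)
  Phi_right : ∀ T, M.Phi P (Ξu T) < 1
  φ_smooth : ∀ T, ContDiffOn ℝ 2 M.φ (Set.Icc (Ξl T) (Ξu T))
  φ_deriv_bound : ∀ T, ∀ k ∈ ({1, 2} : Set ℕ), ∀ x ∈ Set.Icc (Ξl T) (Ξu T),
    |iteratedDerivWithin k M.φ (Set.Icc (Ξl T) (Ξu T)) x| ≤ B
  /-- The log-likelihood contribution is finite everywhere. -/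
  Phi_mem : ∀ x, M.Phi P x ∈ Set.Ioo (0 : ℝ) 1
  l_smooth : ∀ y ∈ ({0, 1} : Set ℝ), ContDiff ℝ 3 (logLikTerm (M.Phi P) y)
  l_deriv_one : ∀ y ∈ ({0, 1} : Set ℝ), ∀ T, ∀ x ∈ Set.Icc (Ξl T) (Ξu T),
    |deriv (logLikTerm (M.Phi P) y) x| ≤ B
  l_deriv_two_three : ∀ y ∈ ({0, 1} : Set ℝ), ∀ k ∈ ({2, 3} : Set ℕ), ∀ x,
    |iteratedDeriv k (logLikTerm (M.Phi P) y) x| ≤ B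
  bL_pos : 0 < bL
  bL_lt_bU : bL < bU
  l_concave : ∀ y ∈ ({0, 1} : Set ℝ), ∀ T, ∀ x ∈ Set.Icc (Ξl T) (Ξu T),
    -iteratedDeriv 2 (logLikTerm (M.Phi P) y) x ∈ Set.Icc bL bU

/-- Existence and positive definiteness of the two matrices that determine the asymptotic
covariance; `Ωβ` is the long-run variance of the score. -/
structure CovarianceAssumptions [MeasurableSpace Ω] (M : FactorBinaryModel Ω p d) (P : Measure Ω)
    (Ωβ : Matrix (Coef p d) (Coef p d) ℝ) : Prop where
  integrable_hessian : ∀ t a b, Integrable (fun ω => M.negHessian P t ω a b) P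
  posDef_hessian : ∀ t, (Matrix.of fun a b => ∫ ω, M.negHessian P t ω a b ∂P).PosDef
  integrable_score : ∀ s t a b, Integrable (fun ω => M.score P t ω a * M.score P s ω b) P
  tendsto_score : ∀ a b, Tendsto (fun T : ℕ => (T : ℝ)⁻¹ *
    ∑ s ∈ (Finset.range T).filter (fun s => s + M.h < T),
      ∑ t ∈ (Finset.range T).filter (fun t => t + M.h < T),
        ∫ ω, M.score P t ω a * M.score P s ω b ∂P) atTop (𝓝 (Ωβ a b))
  posDef_Ωβ : Ωβ.PosDef

end FactorBinaryModel

end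

/-!
The prediction depends on the estimated coefficients and the estimated factors only through the
index `b ⬝ᵥ z̃_t`, which does not change when the factors are rotated and their coefficients are
rotated back. So the factors need to be recovered only up to an invertible linear map, and the
coefficients only in rotated form (`reparam`). Let `τ² = 1 / N + 1 / T`; the claim is that the
error is of the order `τ`.

**Factors.** The vectors `(⟪f_t, a⟫)_t` form a test space of dimension `d` on which the quadratic
form of `X Xᵀ / (N T)` is large, since the loadings span all directions. By the min-max principle
its `d` leading eigenvalues are bounded below, and the eigenvalue equation then writes the estimate
as `f̃_t = H (f_t + ρ_t)` with `‖ρ_t‖²` at most a multiple of `crossError`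
(`IsPCA.exists_rotation`). The normalization of `f̃` makes `H` invertible. The mean of `crossError`
is `O(τ²)` in every period (`integral_crossError_le`), by Davydov's covariance inequality for mixing
series (`abs_cov_le_rpow`).

**Coefficients.** In rotated coefficients, estimation is maximum likelihood with regressors that are
observed with error `ρ_t`. A sample is compared with the truth in three regimes
(`exists_loglik_lt`):
* near the truth there is a quadratic upper bound, as the log-likelihood is strongly concave on
  `Ξ_T` and the observations that leave its neighbourhood are few;
* at moderate distances the loss is at least the Hellinger loss, which unlike the log-likelihood is
  bounded and globally Lipschitz in the index;
* far away a fixed share of the observations contradicts the predictions.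

The bounds needed hold uniformly over compact sets of parameters, by a law of large numbers
(`exists_uniform_lower_bound`), and the score at the truth is `O_P(√T)` because its long-run
variance exists (`exists_score_bound`). Outside a ball of radius `O(τ)` around the truth the
likelihood is thus smaller than at the truth, so that a maximizer exists and lies in the ball.

**Prediction.** Since the second derivatives of the log-likelihood are bounded, so is the Fisher
information (`fisher_information_le`), and `Φ` is globally Lipschitz (`Phi_lipschitz`). On an event
of high probability the prediction error is therefore `O(τ)` (`exists_prediction_bound`), and
`τ² ≤ 2 / min N T`.
-/

noncomputable section

set_option linter.unusedSectionVars false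

/-! ### Covariance inequalities under strong mixing -/

section Covariance

variable {Ω : Type*} {m m₁ m₂ : MeasurableSpace Ω} [mΩ : MeasurableSpace Ω] {P : Measure Ω}
  [IsProbabilityMeasure P]

theorem alphaCoeff_nonneg : 0 ≤ alphaCoeff P m₁ m₂ := by
  apply Real.sSup_nonneg
  rintro x ⟨A, B, -, -, rfl⟩
  exact abs_nonneg _

theorem abs_measureReal_inter_sub_mul_le_one (A B : Set Ω) :
    |P.real (A ∩ B) - P.real A * P.real B| ≤ 1 := by
  have h1 : P.real (A ∩ B) ≤ 1 := measureReal_le_one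
  have h2 : P.real A ≤ 1 := measureReal_le_one
  have h3 : P.real B ≤ 1 := measureReal_le_one
  have h1' : 0 ≤ P.real (A ∩ B) := measureReal_nonneg
  have h2' : 0 ≤ P.real A := measureReal_nonneg
  have h3' : 0 ≤ P.real B := measureReal_nonneg
  rw [abs_le]
  constructor <;> nlinarith

theorem alphaCoeff_le_one : alphaCoeff P m₁ m₂ ≤ 1 := by
  apply Real.sSup_le _ zero_le_one
  rintro x ⟨A, B, -, -, rfl⟩
  exact abs_measureReal_inter_sub_mul_le_one A B

theorem abs_measureReal_inter_sub_mul_le {A B : Set Ω}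
    (hA : MeasurableSet[m₁] A) (hB : MeasurableSet[m₂] B) :
    |P.real (A ∩ B) - P.real A * P.real B| ≤ alphaCoeff P m₁ m₂ := by
  refine le_csSup ⟨1, ?_⟩ ⟨A, B, hA, hB, rfl⟩
  rintro x ⟨A, B, -, -, rfl⟩
  exact abs_measureReal_inter_sub_mul_le_one A B

/-- A covariance bound that is known for the indicators of an algebra `m` extends to bounded
`m`-measurable variables: the worst case is the sign of the conditional mean of `Y`. -/
theorem abs_integral_mul_sub_le_of_setIntegral (hm : m ≤ mΩ)
    {X Y : Ω → ℝ} {K C : ℝ} (hY : Integrable Y P)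
    (hK : ∀ A, MeasurableSet[m] A → |∫ ω in A, Y ω ∂P - P.real A * ∫ ω, Y ω ∂P| ≤ K)
    (hX : StronglyMeasurable[m] X) (hXC : ∀ ω, |X ω| ≤ C) :
    |∫ ω, X ω * Y ω ∂P - (∫ ω, X ω ∂P) * ∫ ω, Y ω ∂P| ≤ 2 * K * C := by
  obtain ⟨ω₀⟩ : Nonempty Ω := nonempty_of_isProbabilityMeasure P
  have hC : 0 ≤ C := (abs_nonneg _).trans (hXC ω₀)
  set c := ∫ ω, Y ω ∂P with hc
  set Z : Ω → ℝ := fun ω => (P[Y|m]) ω - c with hZ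
  have hZi : Integrable Z P := integrable_condExp.sub (integrable_const _)
  have hXm : StronglyMeasurable X := hX.mono hm
  have hXi : Integrable X P :=
    Integrable.of_bound hXm.aestronglyMeasurable C (Eventually.of_forall hXC)
  have hXY : Integrable (fun ω => X ω * Y ω) P :=
    hY.bdd_mul hXm.aestronglyMeasurable (Eventually.of_forall hXC)
  have hXE : Integrable (fun ω => X ω * (P[Y|m]) ω) P :=
    integrable_condExp.bdd_mul hXm.aestronglyMeasurable (Eventually.of_forall hXC)
  have h1 : ∫ ω, X ω * Y ω ∂P = ∫ ω, X ω * (P[Y|m]) ω ∂P := by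
    have := condExp_mul_of_stronglyMeasurable_left (μ := P) (m := m) (f := X) (g := Y) hX hXY hY
    rw [← integral_condExp hm (f := fun ω => X ω * Y ω)]
    exact integral_congr_ae this
  have h2 : ∫ ω, X ω * Y ω ∂P - (∫ ω, X ω ∂P) * c = ∫ ω, X ω * Z ω ∂P := by
    rw [h1, ← integral_mul_const, ← integral_sub hXE (hXi.mul_const _)]
    congr 1; ext ω; simp [hZ]; ring
  -- on `A` the conditional mean of `Y` is at least its mean; `|Z|` integrates to the sum of the
  -- deviations over `A` and over its complement
  set A : Set Ω := {ω | 0 ≤ Z ω} with hA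
  have hAm : MeasurableSet[m] A := by
    have : Measurable[m] Z := (stronglyMeasurable_condExp.sub stronglyMeasurable_const).measurable
    exact measurableSet_le measurable_const this
  have hset : ∀ S, MeasurableSet[m] S → ∫ ω in S, Z ω ∂P = ∫ ω in S, Y ω ∂P - P.real S * c := by
    intro S hS
    rw [hZ, integral_sub integrable_condExp.integrableOn (integrable_const _).integrableOn,
      setIntegral_condExp hm hY hS]
    simp
  have h3 : ∫ ω, |Z ω| ∂P ≤ 2 * K := by
    rw [← integral_add_compl (hm _ hAm) hZi.abs]
    have e1 : ∫ ω in A, |Z ω| ∂P = ∫ ω in A, Z ω ∂P :=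
      setIntegral_congr_fun (hm _ hAm) fun ω hω => abs_of_nonneg hω
    have e2 : ∫ ω in Aᶜ, |Z ω| ∂P = - ∫ ω in Aᶜ, Z ω ∂P := by
      rw [← integral_neg]
      exact setIntegral_congr_fun (hm _ hAm).compl fun ω hω => abs_of_neg (not_le.1 hω)
    rw [e1, e2, hset A hAm, hset _ hAm.compl]
    have := hK A hAm
    have h' := hK _ hAm.compl
    linarith [le_abs_self (∫ ω in A, Y ω ∂P - P.real A * c),
      neg_abs_le (∫ ω in Aᶜ, Y ω ∂P - P.real Aᶜ * c)]
  rw [h2]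
  calc |∫ ω, X ω * Z ω ∂P| ≤ ∫ ω, |X ω * Z ω| ∂P := abs_integral_le_integral_abs
    _ ≤ ∫ ω, C * |Z ω| ∂P := by
        refine integral_mono_of_nonneg (Eventually.of_forall fun ω => abs_nonneg _)
          (hZi.abs.const_mul C) (Eventually.of_forall fun ω => ?_)
        simp only [abs_mul]
        exact mul_le_mul_of_nonneg_right (hXC ω) (abs_nonneg _)
    _ = C * ∫ ω, |Z ω| ∂P := integral_const_mul _ _
    _ ≤ C * (2 * K) := mul_le_mul_of_nonneg_left h3 hC
    _ = 2 * K * C := by ring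

/-- The covariance inequality for bounded variables. -/
theorem abs_cov_le_of_bounded (h₁ : m₁ ≤ mΩ) (h₂ : m₂ ≤ mΩ)
    {X Y : Ω → ℝ} {C D : ℝ} (hX : StronglyMeasurable[m₁] X) (hY : StronglyMeasurable[m₂] Y)
    (hXC : ∀ ω, |X ω| ≤ C) (hYD : ∀ ω, |Y ω| ≤ D) :
    |∫ ω, X ω * Y ω ∂P - (∫ ω, X ω ∂P) * ∫ ω, Y ω ∂P| ≤ 4 * alphaCoeff P m₁ m₂ * C * D := by
  have hYi : Integrable Y P :=
    Integrable.of_bound (hY.mono h₂).aestronglyMeasurable D (Eventually.of_forall hYD)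
  refine (abs_integral_mul_sub_le_of_setIntegral (K := 2 * alphaCoeff P m₁ m₂ * D)
    h₁ hYi ?_ hX hXC).trans (by apply le_of_eq; ring)
  intro A hA
  have hA' := h₁ _ hA
  have := abs_integral_mul_sub_le_of_setIntegral (P := P) (X := Y)
    (Y := A.indicator fun _ => (1 : ℝ))
    (K := alphaCoeff P m₁ m₂) h₂ ((integrable_const _).indicator hA') ?_ hY hYD
  · convert this using 2
    rw [integral_indicator hA', ← integral_indicator hA']
    simp only [integral_const, MeasurableSet.univ, measureReal_restrict_apply, Set.univ_inter,
      smul_eq_mul, mul_one]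
    rw [mul_comm (∫ ω, Y ω ∂P)]
    congr 2
    ext ω
    by_cases h : ω ∈ A <;> simp [h]
  · intro B hB
    have hB' := h₂ _ hB
    rw [setIntegral_indicator hA', integral_indicator hA']
    simp only [integral_const, MeasurableSet.univ, measureReal_restrict_apply, Set.univ_inter,
      smul_eq_mul, mul_one]
    rw [Set.inter_comm, mul_comm]
    exact abs_measureReal_inter_sub_mul_le hA hB

/-- Truncation at the level `L`. -/
def clip (L x : ℝ) : ℝ := max (-L) (min L x)

theorem abs_clip_le {L : ℝ} (hL : 0 ≤ L) (x : ℝ) : |clip L x| ≤ L := by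
  unfold clip
  rw [abs_le]
  exact ⟨le_max_left _ _, max_le (by linarith) (min_le_left _ _)⟩

theorem continuous_clip (L : ℝ) : Continuous (clip L) := by
  unfold clip; fun_prop

theorem abs_sub_clip_le {L : ℝ} (hL : 0 ≤ L) (x : ℝ) : |x - clip L x| ≤ |x| := by
  unfold clip
  rcases le_total L x with h | h
  · rw [min_eq_left h, max_eq_right (by linarith), abs_of_nonneg (by linarith),
      abs_of_nonneg (by linarith)]; linarith
  · rw [min_eq_right h]
    rcases le_total x (-L) with h' | h'
    · rw [max_eq_left h', abs_of_nonpos (by linarith), abs_of_nonpos (by linarith)]; linarith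
    · rw [max_eq_right h']; simp

theorem sub_clip_eq_zero {L x : ℝ} (h : |x| ≤ L) : x - clip L x = 0 := by
  unfold clip
  rw [abs_le] at h
  rw [min_eq_right h.2, max_eq_right h.1, sub_self]

/-- The truncation error is controlled by a higher moment. -/
theorem abs_sub_clip_rpow_le {L r : ℝ} (hL : 0 < L) (k : ℝ) (hk : 0 < k) (hkr : k ≤ r) (x : ℝ) :
    |x - clip L x| ^ k ≤ |x| ^ r * L ^ (k - r) := by
  rcases le_or_gt |x| L with h | h
  · rw [sub_clip_eq_zero h, abs_zero, Real.zero_rpow hk.ne']; positivity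
  · have hx : 0 < |x| := hL.trans h
    calc |x - clip L x| ^ k ≤ |x| ^ k :=
          Real.rpow_le_rpow (abs_nonneg _) (abs_sub_clip_le hL.le x) hk.le
      _ = |x| ^ r * |x| ^ (k - r) := by rw [← Real.rpow_add hx]; congr 1; ring
      _ ≤ |x| ^ r * L ^ (k - r) := by
          gcongr ?_ * ?_
          exact Real.rpow_le_rpow_of_nonpos hL h.le (by linarith)

theorem abs_integral_le_of_abs_le {f g : Ω → ℝ} {K : ℝ} (hg : Integrable g P)
    (h : ∀ ω, |f ω| ≤ g ω) (hK : ∫ ω, g ω ∂P ≤ K) : |∫ ω, f ω ∂P| ≤ K :=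
  (abs_integral_le_integral_abs).trans
    ((integral_mono_of_nonneg (Eventually.of_forall fun _ => abs_nonneg _) hg
      (Eventually.of_forall h)).trans hK)

/-- The covariance of variables with bounded `r`-th moments, with a free truncation level `L`. -/
theorem abs_cov_le_of_truncation (h₁ : m₁ ≤ mΩ) (h₂ : m₂ ≤ mΩ)
    {X Y : Ω → ℝ} {r K L : ℝ} (hr : 2 < r) (hL : 0 < L)
    (hX : StronglyMeasurable[m₁] X) (hY : StronglyMeasurable[m₂] Y)
    (hXi : Integrable (fun ω => |X ω| ^ r) P) (hYi : Integrable (fun ω => |Y ω| ^ r) P)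
    (hXK : ∫ ω, |X ω| ^ r ∂P ≤ K) (hYK : ∫ ω, |Y ω| ^ r ∂P ≤ K) :
    |∫ ω, X ω * Y ω ∂P - (∫ ω, X ω ∂P) * ∫ ω, Y ω ∂P| ≤
      4 * alphaCoeff P m₁ m₂ * L ^ (2 : ℝ) + 6 * K * L ^ (2 - r) := by
  have hXm := hX.mono h₁
  have hYm := hY.mono h₂
  -- the clipped parts are covered by the bounded case; every term with a remainder is at most
  -- a multiple of `K * L ^ (2 - r)`
  set X' : Ω → ℝ := fun ω => clip L (X ω) with hX'
  set Y' : Ω → ℝ := fun ω => clip L (Y ω) with hY'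
  set X'' : Ω → ℝ := fun ω => X ω - clip L (X ω) with hX''
  set Y'' : Ω → ℝ := fun ω => Y ω - clip L (Y ω) with hY''
  have mX' : StronglyMeasurable[m₁] X' := (continuous_clip L).comp_stronglyMeasurable hX
  have mY' : StronglyMeasurable[m₂] Y' := (continuous_clip L).comp_stronglyMeasurable hY
  have aX' := (mX'.mono h₁).aestronglyMeasurable (μ := P)
  have aY' := (mY'.mono h₂).aestronglyMeasurable (μ := P)
  have aX'' : AEStronglyMeasurable X'' P := hXm.aestronglyMeasurable.sub aX'
  have aY'' : AEStronglyMeasurable Y'' P := hYm.aestronglyMeasurable.sub aY'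
  have bX' : ∀ ω, |X' ω| ≤ L := fun ω => abs_clip_le hL.le _
  have bY' : ∀ ω, |Y' ω| ≤ L := fun ω => abs_clip_le hL.le _
  have key1 : ∀ x : ℝ, |x - clip L x| ≤ |x| ^ r * L ^ (1 - r) := fun x => by
    simpa using abs_sub_clip_rpow_le hL 1 one_pos (by linarith) x
  have key2 : ∀ x : ℝ, |x - clip L x| ^ 2 ≤ |x| ^ r * L ^ (2 - r) := fun x => by
    have := abs_sub_clip_rpow_le hL 2 two_pos hr.le x
    rwa [Real.rpow_two] at this
  have hL12 : L ^ (1 - r) * L = L ^ (2 - r) := by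
    rw [← Real.rpow_add_one hL.ne']; congr 1; ring
  have iX'' : Integrable X'' P := (hXi.mul_const (L ^ (1 - r))).mono' aX''
    (Eventually.of_forall fun ω => key1 _)
  have iY'' : Integrable Y'' P := (hYi.mul_const (L ^ (1 - r))).mono' aY''
    (Eventually.of_forall fun ω => key1 _)
  have iX' : Integrable X' P := Integrable.of_bound aX' L (Eventually.of_forall bX')
  have iY' : Integrable Y' P := Integrable.of_bound aY' L (Eventually.of_forall bY')
  have b12 : ∀ ω, |X' ω * Y'' ω| ≤ |Y ω| ^ r * L ^ (2 - r) := fun ω => by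
    rw [abs_mul, ← hL12, ← mul_assoc, mul_comm]
    exact mul_le_mul (key1 _) (bX' ω) (abs_nonneg _) (by positivity)
  have b21 : ∀ ω, |X'' ω * Y' ω| ≤ |X ω| ^ r * L ^ (2 - r) := fun ω => by
    rw [abs_mul, ← hL12, ← mul_assoc]
    exact mul_le_mul (key1 _) (bY' ω) (abs_nonneg _) (by positivity)
  have b22 : ∀ ω, |X'' ω * Y'' ω| ≤ (1/2) * (|X ω| ^ r * L ^ (2 - r)) +
      (1/2) * (|Y ω| ^ r * L ^ (2 - r)) := fun ω => by
    rw [abs_mul]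
    have h1 := key2 (X ω)
    have h2 := key2 (Y ω)
    simp only [hX'', hY'']
    nlinarith [sq_nonneg (|X ω - clip L (X ω)| - |Y ω - clip L (Y ω)|)]
  have gX := hXi.mul_const (L ^ (2 - r))
  have gY := hYi.mul_const (L ^ (2 - r))
  have gXY := (gX.const_mul (1/2)).add (gY.const_mul (1/2))
  have i12 : Integrable (fun ω => X' ω * Y'' ω) P := gY.mono' (aX'.mul aY'')
    (Eventually.of_forall b12)
  have i21 : Integrable (fun ω => X'' ω * Y' ω) P := gX.mono' (aX''.mul aY')
    (Eventually.of_forall b21)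
  have i22 : Integrable (fun ω => X'' ω * Y'' ω) P := gXY.mono' (aX''.mul aY'')
    (Eventually.of_forall b22)
  have i11 : Integrable (fun ω => X' ω * Y' ω) P :=
    Integrable.of_bound (aX'.mul aY') (L * L) (Eventually.of_forall fun ω => by
      rw [Real.norm_eq_abs, abs_mul]
      exact mul_le_mul (bX' ω) (bY' ω) (abs_nonneg _) hL.le)
  have eXY : ∫ ω, X ω * Y ω ∂P = ∫ ω, X' ω * Y' ω ∂P + ∫ ω, X' ω * Y'' ω ∂P +
      (∫ ω, X'' ω * Y' ω ∂P + ∫ ω, X'' ω * Y'' ω ∂P) := by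
    have h := integral_add (i11.add i12) (i21.add i22)
    simp only [Pi.add_apply] at h
    rw [← integral_add i11 i12, ← integral_add i21 i22, ← h]
    congr 1; ext ω; simp only [hX', hX'', hY', hY'']; ring
  have eX : ∫ ω, X ω ∂P = ∫ ω, X' ω ∂P + ∫ ω, X'' ω ∂P := by
    rw [← integral_add iX' iX'']
    congr 1; ext ω; simp [hX', hX'']
  have eY : ∫ ω, Y ω ∂P = ∫ ω, Y' ω ∂P + ∫ ω, Y'' ω ∂P := by
    rw [← integral_add iY' iY'']
    congr 1; ext ω; simp [hY', hY'']
  have c11 := abs_cov_le_of_bounded (P := P) h₁ h₂ mX' mY' bX' bY'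
  set Q := K * L ^ (2 - r) with hQ
  have hLp : 0 < L ^ (2 - r) := Real.rpow_pos_of_pos hL _
  have hgX : ∫ ω, |X ω| ^ r * L ^ (2 - r) ∂P ≤ Q := by
    rw [integral_mul_const]; exact mul_le_mul_of_nonneg_right hXK hLp.le
  have hgY : ∫ ω, |Y ω| ^ r * L ^ (2 - r) ∂P ≤ Q := by
    rw [integral_mul_const]; exact mul_le_mul_of_nonneg_right hYK hLp.le
  have c12 := abs_integral_le_of_abs_le gY b12 hgY
  have c21 := abs_integral_le_of_abs_le gX b21 hgX
  have c22 : |∫ ω, X'' ω * Y'' ω ∂P| ≤ Q := by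
    refine abs_integral_le_of_abs_le gXY b22 ?_
    simp only [Pi.add_apply]
    rw [integral_add (gX.const_mul _) (gY.const_mul _), integral_const_mul, integral_const_mul]
    linarith
  have mX' : |∫ ω, X' ω ∂P| ≤ L := by
    refine abs_integral_le_of_abs_le (integrable_const L) bX' ?_
    simp
  have mY' : |∫ ω, Y' ω ∂P| ≤ L := by
    refine abs_integral_le_of_abs_le (integrable_const L) bY' ?_
    simp
  set q := K * L ^ (1 - r) with hq
  have hqQ : q * L = Q := by rw [hq, hQ, mul_assoc, hL12]
  have mX1 : |∫ ω, X'' ω ∂P| ≤ q := by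
    refine abs_integral_le_of_abs_le (hXi.mul_const (L ^ (1 - r))) (fun ω => key1 _) ?_
    rw [integral_mul_const]; exact mul_le_mul_of_nonneg_right hXK (by positivity)
  have mY1 : |∫ ω, Y'' ω ∂P| ≤ q := by
    refine abs_integral_le_of_abs_le (hYi.mul_const (L ^ (1 - r))) (fun ω => key1 _) ?_
    rw [integral_mul_const]; exact mul_le_mul_of_nonneg_right hYK (by positivity)
  have mX2 : (∫ ω, X'' ω ∂P) ^ 2 ≤ Q := by
    have hX2 : Integrable (fun ω => X'' ω ^ 2) P := gX.mono' (aX''.pow 2)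
      (Eventually.of_forall fun ω => by
        rw [Real.norm_eq_abs, abs_pow]; exact key2 _)
    have h := variance_nonneg X'' P
    rw [variance_eq_sub ((memLp_two_iff_integrable_sq aX'').2 hX2)] at h
    have h2 : ∫ ω, X'' ω ^ 2 ∂P ≤ Q := by
      refine (integral_mono hX2 gX fun ω => ?_).trans hgX
      have := key2 (X ω)
      simpa [hX'', sq_abs] using this
    simp only [Pi.pow_apply] at h
    linarith
  have mY2 : (∫ ω, Y'' ω ∂P) ^ 2 ≤ Q := by
    have hY2 : Integrable (fun ω => Y'' ω ^ 2) P := gY.mono' (aY''.pow 2)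
      (Eventually.of_forall fun ω => by
        rw [Real.norm_eq_abs, abs_pow]; exact key2 _)
    have h := variance_nonneg Y'' P
    rw [variance_eq_sub ((memLp_two_iff_integrable_sq aY'').2 hY2)] at h
    have h2 : ∫ ω, Y'' ω ^ 2 ∂P ≤ Q := by
      refine (integral_mono hY2 gY fun ω => ?_).trans hgY
      have := key2 (Y ω)
      simpa [hY'', sq_abs] using this
    simp only [Pi.pow_apply] at h
    linarith
  have p12 : |(∫ ω, X' ω ∂P) * ∫ ω, Y'' ω ∂P| ≤ Q := by
    rw [abs_mul, ← hqQ, mul_comm q]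
    exact mul_le_mul mX' mY1 (abs_nonneg _) hL.le
  have p21 : |(∫ ω, X'' ω ∂P) * ∫ ω, Y' ω ∂P| ≤ Q := by
    rw [abs_mul, ← hqQ]
    exact mul_le_mul mX1 mY' (abs_nonneg _) ((abs_nonneg _).trans mX1)
  have p22 : |(∫ ω, X'' ω ∂P) * ∫ ω, Y'' ω ∂P| ≤ Q := by
    rw [abs_mul]
    nlinarith [sq_nonneg (|∫ ω, X'' ω ∂P| - |∫ ω, Y'' ω ∂P|), sq_abs (∫ ω, X'' ω ∂P),
      sq_abs (∫ ω, Y'' ω ∂P)]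
  rw [eXY, eX, eY, Real.rpow_two]
  rw [abs_le] at c11 c12 c21 c22 p12 p21 p22 ⊢
  constructor <;> linarith [c11.1, c11.2, c12.1, c12.2, c21.1, c21.2, c22.1, c22.2, p12.1, p12.2,
    p21.1, p21.2, p22.1, p22.2]

/-- **Davydov's inequality**, with a constant that is not optimal. -/
theorem abs_cov_le_rpow (h₁ : m₁ ≤ mΩ) (h₂ : m₂ ≤ mΩ)
    {X Y : Ω → ℝ} {r K : ℝ} (hr : 2 < r)
    (hX : StronglyMeasurable[m₁] X) (hY : StronglyMeasurable[m₂] Y)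
    (hXi : Integrable (fun ω => |X ω| ^ r) P) (hYi : Integrable (fun ω => |Y ω| ^ r) P)
    (hXK : ∫ ω, |X ω| ^ r ∂P ≤ K) (hYK : ∫ ω, |Y ω| ^ r ∂P ≤ K) :
    |∫ ω, X ω * Y ω ∂P - (∫ ω, X ω ∂P) * ∫ ω, Y ω ∂P| ≤
      (4 + 6 * K) * alphaCoeff P m₁ m₂ ^ (1 - 2 / r) := by
  have hr0 : 0 < r := by linarith
  have hexp : 0 < 1 - 2 / r := by rw [sub_pos, div_lt_one hr0]; exact hr
  rcases (alphaCoeff_nonneg (P := P) (m₁ := m₁) (m₂ := m₂)).eq_or_lt with h0 | hpos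
  · rw [← h0, Real.zero_rpow hexp.ne', mul_zero]
    -- under independence the truncation level is free to tend to infinity
    have hlim : Tendsto (fun L : ℝ => 6 * K * L ^ (2 - r)) atTop (𝓝 0) := by
      have := (tendsto_rpow_neg_atTop (y := r - 2) (by linarith)).const_mul (6 * K)
      simpa using this
    refine ge_of_tendsto hlim ((eventually_gt_atTop 0).mono fun L hL => ?_)
    have := abs_cov_le_of_truncation (P := P) h₁ h₂ hr hL hX hY hXi hYi hXK hYK
    rwa [← h0, mul_zero, zero_mul, zero_add] at this
  · set a := alphaCoeff P m₁ m₂ with ha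
    -- the level `a ^ (-1 / r)` balances the two terms of the bound
    have hL : 0 < a ^ (-(1 / r)) := Real.rpow_pos_of_pos hpos _
    refine (abs_cov_le_of_truncation (P := P) h₁ h₂ hr hL hX hY hXi hYi hXK hYK).trans
      (le_of_eq ?_)
    rw [← ha, ← Real.rpow_mul hpos.le, ← Real.rpow_mul hpos.le]
    have e1 : a * a ^ (-(1 / r) * 2) = a ^ (1 - 2 / r) := by
      nth_rewrite 1 [← Real.rpow_one a]
      rw [← Real.rpow_add hpos]; congr 1; ring
    have e2 : -(1 / r) * (2 - r) = 1 - 2 / r := by field_simp; ring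
    rw [e2, mul_assoc 4, e1]; ring

/-! ### Mixing coefficients of time series -/

variable {S : Type*} [mS : MeasurableSpace S]

theorem sigmaOf_le {ι : Type*} {X : ι → Ω → S} (hX : ∀ t, Measurable (X t)) (I : Set ι) :
    sigmaOf X I ≤ mΩ :=
  iSup₂_le fun t _ => (hX t).comap_le

theorem measurable_sigmaOf {ι : Type*} {X : ι → Ω → S} {I : Set ι} {t : ι} (ht : t ∈ I) :
    Measurable[sigmaOf X I] (X t) :=
  Measurable.mono (comap_measurable (X t)) (le_iSup₂_of_le t ht le_rfl) le_rfl

theorem crossMixing_nonneg (X Y : ℕ → Ω → S) (n : ℕ) : 0 ≤ crossMixing P X Y n := by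
  apply Real.sSup_nonneg
  rintro x ⟨I, J, -, -, -, rfl⟩
  exact alphaCoeff_nonneg

theorem crossMixing_le_one (X Y : ℕ → Ω → S) (n : ℕ) : crossMixing P X Y n ≤ 1 := by
  apply Real.sSup_le _ zero_le_one
  rintro x ⟨I, J, -, -, -, rfl⟩
  exact alphaCoeff_le_one

theorem alphaCoeff_le_crossMixing {X Y : ℕ → Ω → S} {n : ℕ} {I J : Set ℕ} (hI : I.OrdConnected)
    (hJ : J.OrdConnected) (h : ∀ s ∈ I, ∀ t ∈ J, n ≤ Nat.dist s t) :
    alphaCoeff P (sigmaOf X I) (sigmaOf Y J) ≤ crossMixing P X Y n := by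
  refine le_csSup ⟨1, ?_⟩ ⟨I, J, hI, hJ, h, rfl⟩
  rintro x ⟨I, J, -, -, -, rfl⟩
  exact alphaCoeff_le_one

end Covariance

/-- A summable weight that depends on the distance of two periods has bounded row sums. -/
theorem sum_dist_le_two_mul_tsum {a : ℕ → ℝ} (ha : ∀ k, 0 ≤ a k) (hs : Summable a) (F : Finset ℕ)
    (t : ℕ) : ∑ s ∈ F, a (Nat.dist s t) ≤ 2 * ∑' k, a k := by
  rw [← Finset.sum_filter_add_sum_filter_not F (fun s => s ≤ t), two_mul]
  refine add_le_add ?_ ?_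
  · rw [← Finset.sum_image (f := a) (g := fun s => Nat.dist s t)]
    · exact hs.sum_le_tsum _ fun k _ => ha k
    · intro x hx y hy hxy
      simp only [Finset.coe_filter, Set.mem_ofPred_eq, Nat.dist] at hx hy hxy
      omega
  · rw [← Finset.sum_image (f := a) (g := fun s => Nat.dist s t)]
    · exact hs.sum_le_tsum _ fun k _ => ha k
    · intro x hx y hy hxy
      simp only [Finset.coe_filter, Set.mem_ofPred_eq, Nat.dist] at hx hy hxy
      omega

/-! ### Moments, sums of squares and independence -/

section Moments

variable {Ω : Type*} {m₁ m₂ : MeasurableSpace Ω} [mΩ : MeasurableSpace Ω] {P : Measure Ω}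
  [IsProbabilityMeasure P]

theorem integrable_rpow_norm_of_lintegral_le {E : Type*} [NormedAddCommGroup E]
    [MeasurableSpace E] [OpensMeasurableSpace E] {X : Ω → E} (hX : Measurable X) {q : ℝ}
    (hq : 0 ≤ q) {C : ℝ≥0} (h : ∫⁻ ω, ‖X ω‖ₑ ^ q ∂P ≤ C) :
    Integrable (fun ω => ‖X ω‖ ^ q) P ∧ ∫ ω, ‖X ω‖ ^ q ∂P ≤ C := by
  have hm : AEStronglyMeasurable (fun ω => ‖X ω‖ ^ q) P :=
    (hX.norm.pow_const q).aestronglyMeasurable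
  have he : ∀ ω, ENNReal.ofReal (‖X ω‖ ^ q) = ‖X ω‖ₑ ^ q := fun ω => by
    rw [← ofReal_norm, ENNReal.ofReal_rpow_of_nonneg (norm_nonneg _) hq]
  have hn : ∀ ω, 0 ≤ ‖X ω‖ ^ q := fun ω => by positivity
  constructor
  · refine ⟨hm, ?_⟩
    rw [hasFiniteIntegral_iff_ofReal (Eventually.of_forall hn)]
    simp_rw [he]
    exact h.trans_lt ENNReal.coe_lt_top
  · rw [integral_eq_lintegral_of_nonneg_ae (Eventually.of_forall hn) hm]
    simp_rw [he]
    exact ENNReal.toReal_le_of_le_ofReal C.2 (by simpa using h)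

theorem rpow_le_one_add_rpow {x k q : ℝ} (hx : 0 ≤ x) (hk : 0 ≤ k) (hkq : k ≤ q) :
    x ^ k ≤ 1 + x ^ q := by
  rcases le_total x 1 with h | h
  · have := Real.rpow_le_one hx h hk
    have : 0 ≤ x ^ q := by positivity
    linarith
  · have := Real.rpow_le_rpow_of_exponent_le h hkq
    linarith

/-- Lower moments are controlled by higher ones. -/
theorem integrable_rpow_of_le {X : Ω → ℝ} (hX : AEStronglyMeasurable X P) (h0 : ∀ ω, 0 ≤ X ω)
    {k q C : ℝ} (hk : 0 ≤ k) (hkq : k ≤ q) (hi : Integrable (fun ω => X ω ^ q) P)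
    (hC : ∫ ω, X ω ^ q ∂P ≤ C) :
    Integrable (fun ω => X ω ^ k) P ∧ ∫ ω, X ω ^ k ∂P ≤ 1 + C := by
  have hg : Integrable (fun ω => 1 + X ω ^ q) P := (integrable_const 1).add hi
  have hle : ∀ ω, X ω ^ k ≤ 1 + X ω ^ q := fun ω => rpow_le_one_add_rpow (h0 ω) hk hkq
  have hint : Integrable (fun ω => X ω ^ k) P :=
    hg.mono' (hX.aemeasurable.pow_const k).aestronglyMeasurable
      (Eventually.of_forall fun ω => by
        rw [Real.norm_eq_abs, abs_of_nonneg (Real.rpow_nonneg (h0 ω) k)]; exact hle ω)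
  refine ⟨hint, (integral_mono hint hg hle).trans ?_⟩
  rw [integral_add (integrable_const 1) hi]
  simpa using hC

theorem abs_mul_four_le (a b c d : ℝ) :
    |a * b * c * d| ≤ (a ^ 4 + b ^ 4 + c ^ 4 + d ^ 4) / 4 := by
  have h1 : |a * b * c * d| = |a * b| * |c * d| := by rw [← abs_mul]; ring_nf
  have h2 : |a * b| * |c * d| ≤ ((a * b) ^ 2 + (c * d) ^ 2) / 2 := by
    nlinarith [sq_nonneg (|a * b| - |c * d|), sq_abs (a * b), sq_abs (c * d)]
  nlinarith [sq_nonneg (a ^ 2 - b ^ 2), sq_nonneg (c ^ 2 - d ^ 2)]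

/-- A product of four variables with bounded fourth moments. -/
theorem integrable_mul_four {X Y Z W : Ω → ℝ} {C : ℝ}
    (mX : AEStronglyMeasurable X P) (mY : AEStronglyMeasurable Y P)
    (mZ : AEStronglyMeasurable Z P) (mW : AEStronglyMeasurable W P)
    (iX : Integrable (fun ω => X ω ^ 4) P) (iY : Integrable (fun ω => Y ω ^ 4) P)
    (iZ : Integrable (fun ω => Z ω ^ 4) P) (iW : Integrable (fun ω => W ω ^ 4) P)
    (cX : ∫ ω, X ω ^ 4 ∂P ≤ C) (cY : ∫ ω, Y ω ^ 4 ∂P ≤ C)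
    (cZ : ∫ ω, Z ω ^ 4 ∂P ≤ C) (cW : ∫ ω, W ω ^ 4 ∂P ≤ C) :
    Integrable (fun ω => X ω * Y ω * Z ω * W ω) P ∧
      ∫ ω, |X ω * Y ω * Z ω * W ω| ∂P ≤ C := by
  have hg := (((iX.add iY).add iZ).add iW).div_const 4
  have hint : Integrable (fun ω => X ω * Y ω * Z ω * W ω) P :=
    hg.mono' (((mX.mul mY).mul mZ).mul mW) (Eventually.of_forall fun ω => abs_mul_four_le _ _ _ _)
  refine ⟨hint, (integral_mono hint.abs hg fun ω => abs_mul_four_le _ _ _ _).trans ?_⟩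
  rw [integral_div, integral_add' ((iX.add iY).add iZ) iW, integral_add' (iX.add iY) iZ,
    integral_add' iX iY]
  linarith

/-- Expanding the second moment of a sum. -/
theorem integrable_sq_sum {ι : Type*} (F : Finset ι) {X : ι → Ω → ℝ} {b : ι → ι → ℝ}
    (hi : ∀ i ∈ F, ∀ j ∈ F, Integrable (fun ω => X i ω * X j ω) P)
    (hb : ∀ i ∈ F, ∀ j ∈ F, ∫ ω, X i ω * X j ω ∂P ≤ b i j) :
    Integrable (fun ω => (∑ i ∈ F, X i ω) ^ 2) P ∧
      ∫ ω, (∑ i ∈ F, X i ω) ^ 2 ∂P ≤ ∑ i ∈ F, ∑ j ∈ F, b i j := by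
  have he : (fun ω => (∑ i ∈ F, X i ω) ^ 2) = fun ω => ∑ i ∈ F, ∑ j ∈ F, X i ω * X j ω := by
    ext ω; rw [sq, Finset.sum_mul_sum]
  rw [he]
  refine ⟨integrable_finsetSum _ fun i hi' => integrable_finsetSum _ fun j hj => hi i hi' j hj, ?_⟩
  rw [integral_finsetSum _ fun i hi' => integrable_finsetSum _ fun j hj => hi i hi' j hj]
  refine Finset.sum_le_sum fun i hi' => ?_
  rw [integral_finsetSum _ fun j hj => hi i hi' j hj]
  exact Finset.sum_le_sum fun j hj => hb i hi' j hj

theorem integral_mul_of_indep (h₁ : m₁ ≤ mΩ) (h₂ : m₂ ≤ mΩ) (h : Indep m₁ m₂ P) {X Y : Ω → ℝ}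
    (hX : Measurable[m₁] X) (hY : Measurable[m₂] Y) :
    ∫ ω, X ω * Y ω ∂P = (∫ ω, X ω ∂P) * ∫ ω, Y ω ∂P ∧
      (Integrable X P → Integrable Y P → Integrable (fun ω => X ω * Y ω) P) := by
  have hXY : IndepFun X Y P := by
    rw [IndepFun_iff_Indep]
    exact indep_of_indep_of_le_left (indep_of_indep_of_le_right h hY.comap_le) hX.comap_le
  exact ⟨hXY.integral_fun_mul_eq_mul_integral (hX.mono h₁ le_rfl).aestronglyMeasurable
    (hY.mono h₂ le_rfl).aestronglyMeasurable, fun iX iY => hXY.integrable_mul iX iY⟩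

/-- Markov's inequality. -/
theorem measure_lt_le_of_integral_le {X : Ω → ℝ} (hX : Integrable X P) (h0 : ∀ ω, 0 ≤ X ω)
    {C K : ℝ} (hC : ∫ ω, X ω ∂P ≤ C) (hK : 0 < K) : P {ω | K < X ω} ≤ ENNReal.ofReal (C / K) := by
  have h1 := mul_meas_ge_le_integral_of_nonneg (Eventually.of_forall h0) hX K
  have h2 : P.real {ω | K < X ω} ≤ P.real {ω | K ≤ X ω} :=
    measureReal_mono fun ω (hω : K < X ω) => hω.le
  rw [← ofReal_measureReal]
  refine ENNReal.ofReal_le_ofReal ?_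
  rw [le_div_iff₀ hK]
  nlinarith

end Moments

/-! ### The idiosyncratic errors -/

namespace FactorBinaryModel

variable {Ω : Type*} {p d : ℕ} [mΩ : MeasurableSpace Ω] {M : FactorBinaryModel Ω p d}
  {P : Measure Ω} [IsProbabilityMeasure P] {δ : ℝ} {Slam : Matrix (Fin d) (Fin d) ℝ}

/-- The average over `s` of the squared sample covariances between the errors of period `t` and
the predictors of period `s`. It bounds the error of the estimated factors in period `t`. -/
def crossError (M : FactorBinaryModel Ω p d) (N T t : ℕ) (ω : Ω) : ℝ :=
  (T : ℝ)⁻¹ * ∑ s ∈ Finset.range T, ((N : ℝ)⁻¹ * ∑ i ∈ Finset.range N, M.e i t ω * M.x i s ω) ^ 2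

/-- The sum over units of the squared sample covariances between errors and factors. -/
def factorError (M : FactorBinaryModel Ω p d) (N T : ℕ) (ω : Ω) : ℝ :=
  ∑ i ∈ Finset.range N, ‖∑ t ∈ Finset.range T, M.e i t ω • M.f t ω‖ ^ 2

namespace SamplingAssumptions

theorem indep_factor_error (h : M.SamplingAssumptions P δ Slam) :
    Indep (sigmaOf M.w Set.univ ⊔ sigmaOf M.lam Set.univ ⊔ sigmaOf M.f Set.univ)
      (sigmaOf (fun q : ℕ × ℕ => M.e q.1 q.2) Set.univ) P :=
  h.indep.indep (show (0 : Fin 3) ≠ 1 by decide)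

theorem indep_factor_noise (h : M.SamplingAssumptions P δ Slam) :
    Indep (sigmaOf M.w Set.univ ⊔ sigmaOf M.lam Set.univ ⊔ sigmaOf M.f Set.univ)
      (sigmaOf M.ε Set.univ) P :=
  h.indep.indep (show (0 : Fin 3) ≠ 2 by decide)

theorem sigma_factor_le (h : M.SamplingAssumptions P δ Slam) :
    sigmaOf M.w Set.univ ⊔ sigmaOf M.lam Set.univ ⊔ sigmaOf M.f Set.univ ≤ mΩ :=
  sup_le (sup_le (sigmaOf_le h.measurable_w _) (sigmaOf_le h.measurable_lam _))
    (sigmaOf_le h.measurable_f _)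

theorem sigma_error_le (h : M.SamplingAssumptions P δ Slam) :
    sigmaOf (fun q : ℕ × ℕ => M.e q.1 q.2) Set.univ ≤ mΩ :=
  sigmaOf_le (X := fun q : ℕ × ℕ => M.e q.1 q.2) (fun q => h.measurable_e q.1 q.2) Set.univ

theorem fourth_moment_error (h : M.SamplingAssumptions P δ Slam) :
    ∃ C : ℝ, 0 ≤ C ∧ ∀ i t, Integrable (fun ω => M.e i t ω ^ 4) P ∧
      ∫ ω, M.e i t ω ^ 4 ∂P ≤ C := by
  obtain ⟨C, hC⟩ := h.moment_e
  refine ⟨1 + C, by positivity, fun i t => ?_⟩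
  have hδ := h.δ_pos
  obtain ⟨h1, h2⟩ := integrable_rpow_norm_of_lintegral_le (h.measurable_e i t)
    (by linarith) (hC i t)
  have := integrable_rpow_of_le (k := 4) (h.measurable_e i t).norm.aestronglyMeasurable
    (fun ω => norm_nonneg _) (by norm_num) (by linarith) h1 h2
  have he : ∀ ω, ‖M.e i t ω‖ ^ (4 : ℝ) = M.e i t ω ^ 4 := fun ω => by
    rw [show (4 : ℝ) = ((4 : ℕ) : ℝ) by norm_num, Real.rpow_natCast, Real.norm_eq_abs,
      Even.pow_abs (by decide)]
  simpa only [he] using this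

theorem fourth_moment_factor (h : M.SamplingAssumptions P δ Slam) :
    ∃ C : ℝ, 0 ≤ C ∧ ∀ t, Integrable (fun ω => ‖M.f t ω‖ ^ 4) P ∧
      ∫ ω, ‖M.f t ω‖ ^ 4 ∂P ≤ C := by
  obtain ⟨C, hC⟩ := h.moment_f
  refine ⟨1 + C, by positivity, fun t => ?_⟩
  have hδ := h.δ_pos
  obtain ⟨h1, h2⟩ := integrable_rpow_norm_of_lintegral_le (h.measurable_f t) (by linarith) (hC t)
  have := integrable_rpow_of_le (k := 4) (h.measurable_f t).norm.aestronglyMeasurable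
    (fun ω => norm_nonneg _) (by norm_num) (by linarith) h1 h2
  have he : ∀ ω, ‖M.f t ω‖ ^ (4 : ℝ) = ‖M.f t ω‖ ^ 4 := fun ω => by
    rw [show (4 : ℝ) = ((4 : ℕ) : ℝ) by norm_num, Real.rpow_natCast]
  simpa only [he] using this

theorem fourth_moment_loading (h : M.SamplingAssumptions P δ Slam) :
    ∃ C : ℝ, 0 ≤ C ∧ ∀ i, Integrable (fun ω => ‖M.lam i ω‖ ^ 4) P ∧
      ∫ ω, ‖M.lam i ω‖ ^ 4 ∂P ≤ C := by
  obtain ⟨C, hC⟩ := h.moment_lam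
  refine ⟨1 + C, by positivity, fun t => ?_⟩
  have hδ := h.δ_pos
  obtain ⟨h1, h2⟩ := integrable_rpow_norm_of_lintegral_le (h.measurable_lam t) (by linarith) (hC t)
  have := integrable_rpow_of_le (k := 4) (h.measurable_lam t).norm.aestronglyMeasurable
    (fun ω => norm_nonneg _) (by norm_num) (by linarith) h1 h2
  have he : ∀ ω, ‖M.lam t ω‖ ^ (4 : ℝ) = ‖M.lam t ω‖ ^ 4 := fun ω => by
    rw [show (4 : ℝ) = ((4 : ℕ) : ℝ) by norm_num, Real.rpow_natCast]
  simpa only [he] using this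

/-- Moments of order `(4 + δ) / 2` of the errors and of their products. -/
theorem half_moment_error (h : M.SamplingAssumptions P δ Slam) :
    ∃ C : ℝ, 0 ≤ C ∧ (∀ i t, Integrable (fun ω => |M.e i t ω| ^ ((4 + δ) / 2)) P ∧
      ∫ ω, |M.e i t ω| ^ ((4 + δ) / 2) ∂P ≤ C) ∧
      ∀ i s t, Integrable (fun ω => |M.e i s ω * M.e i t ω| ^ ((4 + δ) / 2)) P ∧
        ∫ ω, |M.e i s ω * M.e i t ω| ^ ((4 + δ) / 2) ∂P ≤ C := by
  obtain ⟨C, hC⟩ := h.moment_e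
  have hδ := h.δ_pos
  have hm : ∀ i t, Integrable (fun ω => ‖M.e i t ω‖ ^ (4 + δ)) P ∧
      ∫ ω, ‖M.e i t ω‖ ^ (4 + δ) ∂P ≤ C := fun i t =>
    integrable_rpow_norm_of_lintegral_le (h.measurable_e i t) (by linarith) (hC i t)
  refine ⟨1 + C, by positivity, fun i t => ?_, fun i s t => ?_⟩
  · exact integrable_rpow_of_le (X := fun ω => |M.e i t ω|)
      (h.measurable_e i t).norm.aestronglyMeasurable
      (fun ω => abs_nonneg _) (by linarith) (by linarith) (hm i t).1 (hm i t).2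
  · have hle : ∀ ω, |M.e i s ω * M.e i t ω| ^ ((4 + δ) / 2) ≤
        (‖M.e i s ω‖ ^ (4 + δ) + ‖M.e i t ω‖ ^ (4 + δ)) / 2 := fun ω => by
      have e : ∀ x : ℝ, ‖x‖ ^ (4 + δ) = (|x| ^ ((4 + δ) / 2)) ^ 2 := fun x => by
        rw [← Real.rpow_natCast, ← Real.rpow_mul (abs_nonneg _), Real.norm_eq_abs]
        congr 1; push_cast; ring
      rw [abs_mul, Real.mul_rpow (abs_nonneg _) (abs_nonneg _), e, e]
      nlinarith [sq_nonneg (|M.e i s ω| ^ ((4 + δ) / 2) - |M.e i t ω| ^ ((4 + δ) / 2))]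
    have hg := ((hm i s).1.add (hm i t).1).div_const 2
    have hint : Integrable (fun ω => |M.e i s ω * M.e i t ω| ^ ((4 + δ) / 2)) P :=
      hg.mono' ((((h.measurable_e i s).mul (h.measurable_e i t)).abs).pow_const
        _).aestronglyMeasurable (Eventually.of_forall fun ω => by
          rw [Real.norm_eq_abs, abs_of_nonneg (by positivity)]; exact hle ω)
    refine ⟨hint, (integral_mono hint hg hle).trans ?_⟩
    rw [integral_div, integral_add' (hm i s).1 (hm i t).1]
    have := (hm i s).2
    have := (hm i t).2
    linarith

/-- Davydov's inequality with the exponent that is used throughout. -/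
theorem abs_cov_le (hδ : 0 < δ) {m₁ m₂ : MeasurableSpace Ω} (h₁ : m₁ ≤ mΩ) (h₂ : m₂ ≤ mΩ)
    {X Y : Ω → ℝ} {K a : ℝ} (hX : Measurable[m₁] X) (hY : Measurable[m₂] Y)
    (hXi : Integrable (fun ω => |X ω| ^ ((4 + δ) / 2)) P)
    (hYi : Integrable (fun ω => |Y ω| ^ ((4 + δ) / 2)) P)
    (hXK : ∫ ω, |X ω| ^ ((4 + δ) / 2) ∂P ≤ K) (hYK : ∫ ω, |Y ω| ^ ((4 + δ) / 2) ∂P ≤ K)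
    (ha : @alphaCoeff Ω mΩ P m₁ m₂ ≤ a) :
    |∫ ω, X ω * Y ω ∂P - (∫ ω, X ω ∂P) * ∫ ω, Y ω ∂P| ≤ (4 + 6 * K) * a ^ (δ / (4 + δ)) := by
  have hK : 0 ≤ K := (integral_nonneg fun ω => by positivity).trans hXK
  have := @abs_cov_le_rpow Ω m₁ m₂ mΩ P _ h₁ h₂ X Y ((4 + δ) / 2) K (by linarith)
    hX.stronglyMeasurable hY.stronglyMeasurable hXi hYi hXK hYK
  have he : 1 - 2 / ((4 + δ) / 2) = δ / (4 + δ) := by field_simp; ring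
  rw [he] at this
  refine this.trans ?_
  gcongr
  exact @alphaCoeff_nonneg Ω m₁ m₂ mΩ P _

/-- The covariance bounds for the errors that enter the second moments of the cross section and
time series averages. -/
theorem error_cov_bounds (h : M.SamplingAssumptions P δ Slam) : ∃ C : ℝ, 0 ≤ C ∧
    (∀ i j t, |∫ ω, M.e i t ω * M.e j t ω ∂P| ≤
      C * crossMixing P (M.e i) (M.e j) 0 ^ (δ / (4 + δ))) ∧
    (∀ i s t, |∫ ω, M.e i s ω * M.e i t ω ∂P| ≤
      C * mixing P (M.e i) (Nat.dist s t) ^ (δ / (4 + δ))) ∧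
    (∀ i j s t, |∫ ω, (M.e i s ω * M.e i t ω) * (M.e j s ω * M.e j t ω) ∂P -
      (∫ ω, M.e i s ω * M.e i t ω ∂P) * ∫ ω, M.e j s ω * M.e j t ω ∂P| ≤
      C * crossMixing P (M.e i) (M.e j) 0 ^ (δ / (4 + δ))) := by
  obtain ⟨K, hK, h1, h2⟩ := h.half_moment_error
  have hle : ∀ i (I : Set ℕ), sigmaOf (M.e i) I ≤ mΩ := fun i I => sigmaOf_le (h.measurable_e i) I
  refine ⟨4 + 6 * K, by positivity, fun i j t => ?_, fun i s t => ?_, fun i j s t => ?_⟩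
  · have := abs_cov_le (P := P) h.δ_pos (hle i Set.univ) (hle j Set.univ)
      (measurable_sigmaOf (X := M.e i) (Set.mem_univ t))
      (measurable_sigmaOf (X := M.e j) (Set.mem_univ t)) (h1 i t).1 (h1 j t).1 (h1 i t).2
      (h1 j t).2 (alphaCoeff_le_crossMixing (n := 0) Set.ordConnected_univ Set.ordConnected_univ
        fun _ _ _ _ => Nat.zero_le _)
    rwa [h.mean_e i t, zero_mul, sub_zero] at this
  · have := abs_cov_le (P := P) h.δ_pos (hle i {s}) (hle i {t})
      (measurable_sigmaOf (X := M.e i) (Set.mem_singleton s))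
      (measurable_sigmaOf (X := M.e i) (Set.mem_singleton t)) (h1 i s).1 (h1 i t).1 (h1 i s).2
      (h1 i t).2 (alphaCoeff_le_crossMixing (n := Nat.dist s t) Set.ordConnected_singleton
        Set.ordConnected_singleton fun a ha b hb => by
          rw [Set.mem_singleton_iff] at ha hb; rw [ha, hb])
    rwa [h.mean_e i t, mul_zero, sub_zero] at this
  · exact abs_cov_le (P := P) h.δ_pos (hle i Set.univ) (hle j Set.univ)
      ((measurable_sigmaOf (X := M.e i) (Set.mem_univ s)).mul
        (measurable_sigmaOf (X := M.e i) (Set.mem_univ t)))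
      ((measurable_sigmaOf (X := M.e j) (Set.mem_univ s)).mul
        (measurable_sigmaOf (X := M.e j) (Set.mem_univ t))) (h2 i s t).1 (h2 j s t).1 (h2 i s t).2
      (h2 j s t).2 (alphaCoeff_le_crossMixing (n := 0) Set.ordConnected_univ Set.ordConnected_univ
        fun _ _ _ _ => Nat.zero_le _)

theorem exponent_pos (h : M.SamplingAssumptions P δ Slam) : 0 < δ / (4 + δ) := by
  have := h.δ_pos
  positivity

theorem sum_crossMixing_le (h : M.SamplingAssumptions P δ Slam) : ∃ C : ℝ, 0 ≤ C ∧
    ∀ N : ℕ, ∑ i ∈ Finset.range N, ∑ j ∈ Finset.range N,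
      crossMixing P (M.e i) (M.e j) 0 ^ (δ / (4 + δ)) ≤ C * N := by
  obtain ⟨C, hC⟩ := h.sum_mixing_e
  have key : ∀ N : ℕ, ∑ i ∈ Finset.range N, ∑ j ∈ Finset.range N,
      crossMixing P (M.e i) (M.e j) 0 ^ (δ / (4 + δ)) ≤ C * N := fun N =>
    (Finset.sum_le_sum fun i _ => Finset.sum_le_sum fun j _ =>
      (h.summable_mixing_e i j).le_tsum 0 fun n _ =>
        Real.rpow_nonneg (crossMixing_nonneg _ _ _) _).trans (hC N)
  refine ⟨max C 0, le_max_right _ _, fun N => (key N).trans ?_⟩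
  gcongr
  exact le_max_left _ _

theorem sum_mixing_dist_le (h : M.SamplingAssumptions P δ Slam) : ∃ C : ℝ, 0 ≤ C ∧
    ∀ i t (F : Finset ℕ), ∑ s ∈ F, mixing P (M.e i) (Nat.dist s t) ^ (δ / (4 + δ)) ≤ C := by
  obtain ⟨C, hC⟩ := h.max_mixing_e
  have key : ∀ i t (F : Finset ℕ),
      ∑ s ∈ F, mixing P (M.e i) (Nat.dist s t) ^ (δ / (4 + δ)) ≤ 2 * (1 + C) := by
    intro i t F
    have hs : Summable fun n => mixing P (M.e i) n ^ (δ / (4 + δ)) := h.summable_mixing_e i i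
    refine (sum_dist_le_two_mul_tsum (a := fun n => mixing P (M.e i) n ^ (δ / (4 + δ)))
      (fun k => Real.rpow_nonneg (crossMixing_nonneg _ _ _) _) hs F t).trans ?_
    have h0 : mixing P (M.e i) 0 ^ (δ / (4 + δ)) ≤ 1 :=
      Real.rpow_le_one (crossMixing_nonneg _ _ _) (crossMixing_le_one _ _ _) h.exponent_pos.le
    have := hC i
    rw [hs.tsum_eq_zero_add]
    linarith
  exact ⟨2 * (1 + C), by simpa using key 0 0 ∅, key⟩

end SamplingAssumptions

end FactorBinaryModel

namespace FactorBinaryModel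

variable {Ω : Type*} {p d : ℕ} [mΩ : MeasurableSpace Ω] {M : FactorBinaryModel Ω p d}
  {P : Measure Ω} [IsProbabilityMeasure P] {δ : ℝ} {Slam : Matrix (Fin d) (Fin d) ℝ}

namespace SamplingAssumptions

theorem measurable_error (M : FactorBinaryModel Ω p d) (i t : ℕ) :
    Measurable[sigmaOf (fun q : ℕ × ℕ => M.e q.1 q.2) Set.univ] (M.e i t) :=
  measurable_sigmaOf (X := fun q : ℕ × ℕ => M.e q.1 q.2) (t := (i, t)) (Set.mem_univ _)

theorem measurable_factor (M : FactorBinaryModel Ω p d) (t : ℕ) :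
    Measurable[sigmaOf M.w Set.univ ⊔ sigmaOf M.lam Set.univ ⊔ sigmaOf M.f Set.univ] (M.f t) :=
  (measurable_sigmaOf (X := M.f) (Set.mem_univ t)).mono le_sup_right le_rfl

theorem measurable_loading (M : FactorBinaryModel Ω p d) (i : ℕ) :
    Measurable[sigmaOf M.w Set.univ ⊔ sigmaOf M.lam Set.univ ⊔ sigmaOf M.f Set.univ] (M.lam i) :=
  (measurable_sigmaOf (X := M.lam) (Set.mem_univ i)).mono (le_sup_right.trans le_sup_left) le_rfl

theorem integrable_error_mul (h : M.SamplingAssumptions P δ Slam) (i j s t : ℕ) :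
    Integrable (fun ω => M.e i s ω * M.e j t ω) P := by
  obtain ⟨C, -, hC⟩ := h.fourth_moment_error
  have := (integrable_mul_four (h.measurable_e i s).aestronglyMeasurable
    (h.measurable_e j t).aestronglyMeasurable (aestronglyMeasurable_const (b := (1:ℝ)))
    (aestronglyMeasurable_const (b := (1:ℝ))) (hC i s).1 (hC j t).1 (integrable_const _)
    (integrable_const _) ((hC i s).2.trans (le_max_left C 1)) ((hC j t).2.trans (le_max_left C 1))
    (by simp) (by simp)).1
  simpa using this

/-- The cross section average of the errors of period `t`, weighted by the common parts of period
`s`. Conditionally on the weights the second moment is a sum of error covariances over pairs of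
units, which is `O(N)`. -/
theorem integral_sq_sum_error_loading (h : M.SamplingAssumptions P δ Slam) : ∃ C : ℝ, 0 ≤ C ∧
    ∀ N s t : ℕ, Integrable (fun ω => (∑ i ∈ Finset.range N,
        M.e i t ω * inner ℝ (M.lam i ω) (M.f s ω)) ^ 2) P ∧
      ∫ ω, (∑ i ∈ Finset.range N, M.e i t ω * inner ℝ (M.lam i ω) (M.f s ω)) ^ 2 ∂P ≤ C * N := by
  obtain ⟨C1, hC1, hcov, -, -⟩ := h.error_cov_bounds
  obtain ⟨Cf, hCf, hf⟩ := h.fourth_moment_factor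
  obtain ⟨Cl, hCl, hl⟩ := h.fourth_moment_loading
  obtain ⟨C2, hC2, hsum⟩ := h.sum_crossMixing_le
  set D := max Cf Cl with hD
  have hm1 : ∀ i, AEStronglyMeasurable (fun ω => ‖M.lam i ω‖) P := fun i =>
    (h.measurable_lam i).norm.aestronglyMeasurable
  have hm2 : ∀ t, AEStronglyMeasurable (fun ω => ‖M.f t ω‖) P := fun t =>
    (h.measurable_f t).norm.aestronglyMeasurable
  have mA : ∀ i s, Measurable[sigmaOf M.w Set.univ ⊔ sigmaOf M.lam Set.univ ⊔
      sigmaOf M.f Set.univ] (fun ω => inner ℝ (M.lam i ω) (M.f s ω)) := fun i s =>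
    (measurable_loading M i).inner (measurable_factor M s)
  have hfac : ∀ i j s, Integrable (fun ω => inner ℝ (M.lam i ω) (M.f s ω) *
      inner ℝ (M.lam j ω) (M.f s ω)) P ∧
      |∫ ω, inner ℝ (M.lam i ω) (M.f s ω) * inner ℝ (M.lam j ω) (M.f s ω) ∂P| ≤ D := by
    intro i j s
    obtain ⟨g1, g2⟩ := integrable_mul_four (hm1 i) (hm2 s) (hm1 j) (hm2 s) (hl i).1 (hf s).1
      (hl j).1 (hf s).1 ((hl i).2.trans (le_max_right Cf Cl)) ((hf s).2.trans (le_max_left Cf Cl))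
      ((hl j).2.trans (le_max_right Cf Cl)) ((hf s).2.trans (le_max_left Cf Cl))
    have hle : ∀ ω, |inner ℝ (M.lam i ω) (M.f s ω) * inner ℝ (M.lam j ω) (M.f s ω)| ≤
        |‖M.lam i ω‖ * ‖M.f s ω‖ * ‖M.lam j ω‖ * ‖M.f s ω‖| := fun ω => by
      rw [abs_mul, abs_of_nonneg (by positivity : 0 ≤ ‖M.lam i ω‖ * ‖M.f s ω‖ * ‖M.lam j ω‖ *
        ‖M.f s ω‖), mul_assoc (‖M.lam i ω‖ * ‖M.f s ω‖)]
      exact mul_le_mul (abs_real_inner_le_norm _ _) (abs_real_inner_le_norm _ _) (abs_nonneg _)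
        (by positivity)
    exact ⟨g1.abs.mono' (((mA i s).mul (mA j s)).mono h.sigma_factor_le
      le_rfl).aestronglyMeasurable (Eventually.of_forall hle),
      abs_integral_le_of_abs_le g1.abs hle g2⟩
  refine ⟨C1 * D * C2, by positivity, fun N s t => ?_⟩
  have hind : ∀ i j, Integrable (fun ω => (M.e i t ω * inner ℝ (M.lam i ω) (M.f s ω)) *
      (M.e j t ω * inner ℝ (M.lam j ω) (M.f s ω))) P ∧
      ∫ ω, (M.e i t ω * inner ℝ (M.lam i ω) (M.f s ω)) *
      (M.e j t ω * inner ℝ (M.lam j ω) (M.f s ω)) ∂P ≤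
      C1 * D * crossMixing P (M.e i) (M.e j) 0 ^ (δ / (4 + δ)) := by
    intro i j
    have hI := integral_mul_of_indep h.sigma_factor_le h.sigma_error_le h.indep_factor_error
      (X := fun ω => inner ℝ (M.lam i ω) (M.f s ω) * inner ℝ (M.lam j ω) (M.f s ω))
      (Y := fun ω => M.e i t ω * M.e j t ω) ((mA i s).mul (mA j s))
      ((measurable_error M i t).mul (measurable_error M j t))
    have he : (fun ω => (M.e i t ω * inner ℝ (M.lam i ω) (M.f s ω)) *
      (M.e j t ω * inner ℝ (M.lam j ω) (M.f s ω))) = fun ω =>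
      (inner ℝ (M.lam i ω) (M.f s ω) * inner ℝ (M.lam j ω) (M.f s ω)) *
        (M.e i t ω * M.e j t ω) := by ext ω; ring
    rw [he]
    refine ⟨hI.2 (hfac i j s).1 (h.integrable_error_mul i j t t), ?_⟩
    rw [hI.1]
    refine (le_abs_self _).trans ?_
    rw [abs_mul]
    refine (mul_le_mul (hfac i j s).2 (hcov i j t) (abs_nonneg _)
      (hCf.trans (le_max_left _ _))).trans (le_of_eq (by ring))
  obtain ⟨g1, g2⟩ := integrable_sq_sum (P := P) (Finset.range N)
    (X := fun i ω => M.e i t ω * inner ℝ (M.lam i ω) (M.f s ω))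
    (fun i _ j _ => (hind i j).1) (fun i _ j _ => (hind i j).2)
  refine ⟨g1, g2.trans ?_⟩
  simp_rw [← Finset.mul_sum]
  calc _ ≤ C1 * D * (C2 * N) := by
        have : 0 ≤ C1 * D := mul_nonneg hC1 (hCf.trans (le_max_left _ _))
        exact mul_le_mul_of_nonneg_left (hsum N) this
    _ = _ := by ring

/-- The cross section average of the products of the errors of two periods. The second moment is the
sum of the covariances over pairs of units, which is `O(N)`, and of the products of the means, which
are of order `N²` for `s = t` and decay with the distance of the periods. -/
theorem integral_sq_sum_error_error (h : M.SamplingAssumptions P δ Slam) : ∃ C : ℝ, 0 ≤ C ∧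
    ∀ N s t : ℕ, Integrable (fun ω => (∑ i ∈ Finset.range N, M.e i t ω * M.e i s ω) ^ 2) P ∧
      ∫ ω, (∑ i ∈ Finset.range N, M.e i t ω * M.e i s ω) ^ 2 ∂P ≤
        C * N + C * N * ∑ i ∈ Finset.range N, mixing P (M.e i) (Nat.dist s t) ^ (δ / (4 + δ)) := by
  obtain ⟨C1, hC1, -, hser, hcov⟩ := h.error_cov_bounds
  obtain ⟨C2, hC2, hsum⟩ := h.sum_crossMixing_le
  obtain ⟨Ce, hCe, he⟩ := h.fourth_moment_error
  refine ⟨C1 * C2 + C1 * C1, by positivity, fun N s t => ?_⟩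
  have hmix1 : ∀ i n, mixing P (M.e i) n ^ (δ / (4 + δ)) ≤ 1 := fun i n =>
    Real.rpow_le_one (crossMixing_nonneg _ _ _) (crossMixing_le_one _ _ _) h.exponent_pos.le
  have hmix0 : ∀ i n, 0 ≤ mixing P (M.e i) n ^ (δ / (4 + δ)) := fun i n =>
    Real.rpow_nonneg (crossMixing_nonneg _ _ _) _
  have hint : ∀ i j, Integrable (fun ω => (M.e i t ω * M.e i s ω) * (M.e j t ω * M.e j s ω)) P := by
    intro i j
    have := (integrable_mul_four (h.measurable_e i t).aestronglyMeasurable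
      (h.measurable_e i s).aestronglyMeasurable (h.measurable_e j t).aestronglyMeasurable
      (h.measurable_e j s).aestronglyMeasurable (he i t).1 (he i s).1 (he j t).1 (he j s).1
      (he i t).2 (he i s).2 (he j t).2 (he j s).2).1
    refine this.congr (Eventually.of_forall fun ω => ?_)
    simp only; ring
  obtain ⟨g1, g2⟩ := integrable_sq_sum (P := P) (Finset.range N)
    (X := fun i ω => M.e i t ω * M.e i s ω)
    (b := fun i j => C1 * crossMixing P (M.e i) (M.e j) 0 ^ (δ / (4 + δ)) +
      C1 * C1 * mixing P (M.e i) (Nat.dist s t) ^ (δ / (4 + δ)))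
    (fun i _ j _ => hint i j) (fun i _ j _ => by
      have h1 := (abs_le.1 (hcov i j t s)).2
      have h2 : (∫ ω, M.e i t ω * M.e i s ω ∂P) * ∫ ω, M.e j t ω * M.e j s ω ∂P ≤
          C1 * C1 * mixing P (M.e i) (Nat.dist s t) ^ (δ / (4 + δ)) := by
        refine (le_abs_self _).trans ?_
        rw [abs_mul]
        have a1 := hser i t s
        have a2 : |∫ ω, M.e j t ω * M.e j s ω ∂P| ≤ C1 :=
          (hser j t s).trans (mul_le_of_le_one_right hC1 (hmix1 _ _))
        rw [Nat.dist_comm t s] at a1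
        calc _ ≤ (C1 * mixing P (M.e i) (Nat.dist s t) ^ (δ / (4 + δ))) * C1 :=
              mul_le_mul a1 a2 (abs_nonneg _) (mul_nonneg hC1 (hmix0 _ _))
          _ = _ := by ring
      linarith)
  refine ⟨g1, g2.trans ?_⟩
  simp_rw [Finset.sum_add_distrib, ← Finset.mul_sum, Finset.sum_const, Finset.card_range,
    nsmul_eq_mul]
  set S1 := ∑ i ∈ Finset.range N, ∑ j ∈ Finset.range N,
    crossMixing P (M.e i) (M.e j) 0 ^ (δ / (4 + δ))
  have hS1 : S1 ≤ C2 * N := hsum N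
  have hS2 : 0 ≤ ∑ i ∈ Finset.range N, mixing P (M.e i) (Nat.dist s t) ^ (δ / (4 + δ)) :=
    Finset.sum_nonneg fun i _ => hmix0 _ _
  rw [← Finset.mul_sum]
  set S2 := ∑ i ∈ Finset.range N, mixing P (M.e i) (Nat.dist s t) ^ (δ / (4 + δ))
  have e1 : C1 * S1 ≤ C1 * (C2 * N) := mul_le_mul_of_nonneg_left hS1 hC1
  have e2 : 0 ≤ C1 * C2 * (N * S2) := by positivity
  have e3 : 0 ≤ C1 * C1 * (N : ℝ) := by positivity
  nlinarith

/-- The mean of `crossError` is of the order `1 / N + 1 / T`, uniformly in the period. -/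
theorem integral_crossError_le (h : M.SamplingAssumptions P δ Slam) : ∃ C : ℝ, 0 ≤ C ∧
    ∀ N T t : ℕ, 0 < N → 0 < T → Integrable (M.crossError N T t) P ∧
      ∫ ω, M.crossError N T t ω ∂P ≤ C * ((N : ℝ)⁻¹ + (T : ℝ)⁻¹) := by
  obtain ⟨C1, hC1, h1⟩ := h.integral_sq_sum_error_loading
  obtain ⟨C2, hC2, h2⟩ := h.integral_sq_sum_error_error
  obtain ⟨C3, hC3, h3⟩ := h.sum_mixing_dist_le
  refine ⟨2 * C1 + 2 * C2 + 2 * C2 * C3, by positivity, fun N T t hN hT => ?_⟩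
  have hN' : (0 : ℝ) < N := by exact_mod_cast hN
  have hT' : (0 : ℝ) < T := by exact_mod_cast hT
  have hmx : ∀ i s, Measurable (M.x i s) := fun i s =>
    ((h.measurable_lam i).inner (h.measurable_f s)).add (h.measurable_e i s)
  have hterm : ∀ s, Integrable (fun ω => ((N : ℝ)⁻¹ * ∑ i ∈ Finset.range N,
      M.e i t ω * M.x i s ω) ^ 2) P ∧ ∫ ω, ((N : ℝ)⁻¹ * ∑ i ∈ Finset.range N,
      M.e i t ω * M.x i s ω) ^ 2 ∂P ≤ (2 * C1 + 2 * C2) * (N : ℝ)⁻¹ +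
        2 * C2 * ((N : ℝ)⁻¹ * ∑ i ∈ Finset.range N,
          mixing P (M.e i) (Nat.dist s t) ^ (δ / (4 + δ))) := by
    intro s
    -- the data consist of a common part and an error, and each part has its own bound
    have hg := (((h1 N s t).1.add (h2 N s t).1).const_mul (2 * ((N : ℝ)⁻¹) ^ 2))
    have hle : ∀ ω, ((N : ℝ)⁻¹ * ∑ i ∈ Finset.range N, M.e i t ω * M.x i s ω) ^ 2 ≤
        2 * ((N : ℝ)⁻¹) ^ 2 * ((∑ i ∈ Finset.range N,
          M.e i t ω * inner ℝ (M.lam i ω) (M.f s ω)) ^ 2 +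
          (∑ i ∈ Finset.range N, M.e i t ω * M.e i s ω) ^ 2) := by
      intro ω
      have : ∑ i ∈ Finset.range N, M.e i t ω * M.x i s ω = ∑ i ∈ Finset.range N,
          M.e i t ω * inner ℝ (M.lam i ω) (M.f s ω) +
          ∑ i ∈ Finset.range N, M.e i t ω * M.e i s ω := by
        rw [← Finset.sum_add_distrib]
        exact Finset.sum_congr rfl fun i _ => by unfold x; ring
      rw [this]
      set a := ∑ i ∈ Finset.range N, M.e i t ω * inner ℝ (M.lam i ω) (M.f s ω)
      set b := ∑ i ∈ Finset.range N, M.e i t ω * M.e i s ω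
      rw [mul_pow]
      nlinarith [mul_nonneg (sq_nonneg ((N : ℝ)⁻¹)) (sq_nonneg (a - b))]
    have hmeas : Measurable (fun ω => ((N : ℝ)⁻¹ * ∑ i ∈ Finset.range N,
        M.e i t ω * M.x i s ω) ^ 2) :=
      ((Finset.measurable_fun_sum _ fun i _ => (h.measurable_e i t).mul (hmx i s)).const_mul
        _).pow_const 2
    have hint := hg.mono' hmeas.aestronglyMeasurable (Eventually.of_forall fun ω => by
      rw [Real.norm_eq_abs, abs_of_nonneg (sq_nonneg _)]; exact hle ω)
    refine ⟨hint, (integral_mono hint hg hle).trans ?_⟩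
    rw [integral_const_mul, integral_add' (h1 N s t).1 (h2 N s t).1]
    have b1 := (h1 N s t).2
    have b2 := (h2 N s t).2
    set S := ∑ i ∈ Finset.range N, mixing P (M.e i) (Nat.dist s t) ^ (δ / (4 + δ))
    calc _ ≤ 2 * ((N : ℝ)⁻¹) ^ 2 * (C1 * N + (C2 * N + C2 * N * S)) := by gcongr
      _ = _ := by field_simp; ring
  unfold crossError
  refine ⟨(integrable_finsetSum _ fun s _ => (hterm s).1).const_mul _, ?_⟩
  rw [integral_const_mul, integral_finsetSum _ fun s _ => (hterm s).1]
  have hb := Finset.sum_le_sum fun s (_ : s ∈ Finset.range T) => (hterm s).2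
  have hb2 : ∑ s ∈ Finset.range T, ((2 * C1 + 2 * C2) * (N : ℝ)⁻¹ +
        2 * C2 * ((N : ℝ)⁻¹ * ∑ i ∈ Finset.range N,
          mixing P (M.e i) (Nat.dist s t) ^ (δ / (4 + δ)))) ≤
      T * ((2 * C1 + 2 * C2) * (N : ℝ)⁻¹) + 2 * C2 * C3 := by
    rw [Finset.sum_add_distrib, Finset.sum_const, Finset.card_range, nsmul_eq_mul,
      ← Finset.mul_sum, ← Finset.mul_sum, Finset.sum_comm]
    -- the sum over the periods `s` is what turns the serial dependence into a term of order `1 / T`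
    have : ∑ i ∈ Finset.range N, ∑ s ∈ Finset.range T,
        mixing P (M.e i) (Nat.dist s t) ^ (δ / (4 + δ)) ≤ N * C3 := by
      refine (Finset.sum_le_sum fun i _ => h3 i t (Finset.range T)).trans ?_
      simp
    have : (N : ℝ)⁻¹ * ∑ i ∈ Finset.range N, ∑ s ∈ Finset.range T,
        mixing P (M.e i) (Nat.dist s t) ^ (δ / (4 + δ)) ≤ C3 := by
      rw [inv_mul_le_iff₀ hN']; exact this
    have := mul_le_mul_of_nonneg_left this (by positivity : 0 ≤ 2 * C2)
    linarith
  have hb3 := mul_le_mul_of_nonneg_left (hb.trans hb2) (inv_nonneg.2 hT'.le)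
  refine hb3.trans ?_
  have e : (T : ℝ)⁻¹ * (T * ((2 * C1 + 2 * C2) * (N : ℝ)⁻¹) + 2 * C2 * C3) =
      (2 * C1 + 2 * C2) * (N : ℝ)⁻¹ + 2 * C2 * C3 * (T : ℝ)⁻¹ := by field_simp
  rw [e]
  have hNi : 0 < (N : ℝ)⁻¹ := inv_pos.2 hN'
  have hTi : 0 < (T : ℝ)⁻¹ := inv_pos.2 hT'
  have : 0 ≤ 2 * C2 * C3 * (N : ℝ)⁻¹ := by positivity
  have : 0 ≤ (2 * C1 + 2 * C2) * (T : ℝ)⁻¹ := by positivity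
  nlinarith

/-- The time series sums of errors times factors are of the order `√T` for each unit. -/
theorem integral_factorError_le (h : M.SamplingAssumptions P δ Slam) : ∃ C : ℝ, 0 ≤ C ∧
    ∀ N T : ℕ, Integrable (M.factorError N T) P ∧
      ∫ ω, M.factorError N T ω ∂P ≤ C * (N * T) := by
  obtain ⟨C1, hC1, -, hser, -⟩ := h.error_cov_bounds
  obtain ⟨C3, hC3, h3⟩ := h.sum_mixing_dist_le
  obtain ⟨Cf, hCf, hf⟩ := h.fourth_moment_factor
  have hcoord : ∀ (a : Fin d) t, Measurable (fun ω => M.f t ω a) := fun a t =>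
    (EuclideanSpace.proj (𝕜 := ℝ) a).continuous.measurable.comp (h.measurable_f t)
  have hcoord' : ∀ (a : Fin d) t, Measurable[sigmaOf M.w Set.univ ⊔ sigmaOf M.lam Set.univ ⊔
      sigmaOf M.f Set.univ] (fun ω => M.f t ω a) := fun a t =>
    (EuclideanSpace.proj (𝕜 := ℝ) a).continuous.measurable.comp (measurable_factor M t)
  have hff : ∀ (a : Fin d) s t, Integrable (fun ω => M.f s ω a * M.f t ω a) P ∧
      |∫ ω, M.f s ω a * M.f t ω a ∂P| ≤ max Cf 1 := by
    intro a s t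
    obtain ⟨g1, g2⟩ := integrable_mul_four (h.measurable_f s).norm.aestronglyMeasurable
      (h.measurable_f t).norm.aestronglyMeasurable (aestronglyMeasurable_const (b := (1:ℝ)))
      (aestronglyMeasurable_const (b := (1:ℝ))) (hf s).1 (hf t).1 (integrable_const _)
      (integrable_const _) ((hf s).2.trans (le_max_left Cf 1)) ((hf t).2.trans (le_max_left Cf 1))
      (by simp) (by simp)
    have hle : ∀ ω, |M.f s ω a * M.f t ω a| ≤ |‖M.f s ω‖ * ‖M.f t ω‖ * 1 * 1| := fun ω => by
      rw [mul_one, mul_one, abs_mul, abs_mul, abs_norm, abs_norm]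
      exact mul_le_mul (PiLp.norm_apply_le (M.f s ω) a) (PiLp.norm_apply_le (M.f t ω) a)
        (abs_nonneg _) (norm_nonneg _)
    exact ⟨g1.abs.mono' ((hcoord a s).mul (hcoord a t)).aestronglyMeasurable
      (Eventually.of_forall hle), abs_integral_le_of_abs_le g1.abs hle g2⟩
  have hia : ∀ (i T : ℕ) (a : Fin d), Integrable (fun ω => (∑ t ∈ Finset.range T,
      M.e i t ω * M.f t ω a) ^ 2) P ∧ ∫ ω, (∑ t ∈ Finset.range T, M.e i t ω * M.f t ω a) ^ 2 ∂P ≤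
        max Cf 1 * C1 * C3 * T := by
    intro i T a
    have key : ∀ s t, Integrable (fun ω => (M.e i s ω * M.f s ω a) * (M.e i t ω * M.f t ω a)) P ∧
        ∫ ω, (M.e i s ω * M.f s ω a) * (M.e i t ω * M.f t ω a) ∂P ≤
          max Cf 1 * C1 * mixing P (M.e i) (Nat.dist t s) ^ (δ / (4 + δ)) := by
      intro s t
      have hI := integral_mul_of_indep h.sigma_factor_le h.sigma_error_le h.indep_factor_error
        (X := fun ω => M.f s ω a * M.f t ω a)
        (Y := fun ω => M.e i s ω * M.e i t ω) ((hcoord' a s).mul (hcoord' a t))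
        ((measurable_error M i s).mul (measurable_error M i t))
      have he : (fun ω => (M.e i s ω * M.f s ω a) * (M.e i t ω * M.f t ω a)) = fun ω =>
        (M.f s ω a * M.f t ω a) * (M.e i s ω * M.e i t ω) := by ext ω; ring
      rw [he]
      refine ⟨hI.2 (hff a s t).1 (h.integrable_error_mul i i s t), ?_⟩
      rw [hI.1]
      refine (le_abs_self _).trans ?_
      rw [abs_mul, Nat.dist_comm t s]
      refine (mul_le_mul (hff a s t).2 (hser i s t) (abs_nonneg _)
        (hCf.trans (le_max_left _ _))).trans (le_of_eq (by ring))
    obtain ⟨g1, g2⟩ := integrable_sq_sum (P := P) (Finset.range T)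
      (X := fun t ω => M.e i t ω * M.f t ω a)
      (fun i _ j _ => (key i j).1) (fun i _ j _ => (key i j).2)
    refine ⟨g1, g2.trans ?_⟩
    have hpos : 0 ≤ max Cf 1 * C1 := mul_nonneg (hCf.trans (le_max_left _ _)) hC1
    calc _ ≤ ∑ s ∈ Finset.range T, max Cf 1 * C1 * C3 := by
          refine Finset.sum_le_sum fun s _ => ?_
          rw [← Finset.mul_sum]
          exact mul_le_mul_of_nonneg_left (h3 i s _) hpos
      _ = _ := by rw [Finset.sum_const, Finset.card_range, nsmul_eq_mul]; ring
  have hexp : ∀ N T, M.factorError N T = fun ω => ∑ i ∈ Finset.range N, ∑ a : Fin d,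
      (∑ t ∈ Finset.range T, M.e i t ω * M.f t ω a) ^ 2 := by
    intro N T; ext ω
    refine Finset.sum_congr rfl fun i _ => ?_
    rw [EuclideanSpace.real_norm_sq_eq]
    refine Finset.sum_congr rfl fun a _ => ?_
    simp
  refine ⟨d * (max Cf 1 * C1 * C3), ?_, fun N T => ?_⟩
  · have := hCf.trans (le_max_left Cf 1)
    positivity
  rw [hexp]
  refine ⟨integrable_finsetSum _ fun i _ => integrable_finsetSum _ fun a _ => (hia i T a).1, ?_⟩
  rw [integral_finsetSum _ fun i _ => integrable_finsetSum _ fun a _ => (hia i T a).1]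
  have : ∀ i ∈ Finset.range N, ∫ ω, ∑ a : Fin d,
      (∑ t ∈ Finset.range T, M.e i t ω * M.f t ω a) ^ 2 ∂P ≤ d * (max Cf 1 * C1 * C3 * T) := by
    intro i _
    rw [integral_finsetSum _ fun a _ => (hia i T a).1]
    refine (Finset.sum_le_sum fun a _ => (hia i T a).2).trans ?_
    simp
  refine (Finset.sum_le_sum this).trans (le_of_eq ?_)
  rw [Finset.sum_const, Finset.card_range, nsmul_eq_mul]; ring

end SamplingAssumptions

end FactorBinaryModel

/-! ### The individual log-likelihood -/

section Calculus

/-- A second order upper bound from a bound on the second derivative along the segment. -/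
theorem le_quadratic_of_deriv_deriv_le {l : ℝ → ℝ} (hl : ContDiff ℝ 2 l) {x v m : ℝ}
    (hm : ∀ s ∈ Set.Icc (0 : ℝ) 1, deriv (deriv l) (x + s * v) ≤ m) :
    l (x + v) ≤ l x + deriv l x * v + m / 2 * v ^ 2 := by
  have hl1 : Differentiable ℝ l := hl.differentiable (by norm_num)
  have hl2 : Differentiable ℝ (deriv l) := hl.differentiable_deriv_two
  have hin : ∀ s : ℝ, HasDerivAt (fun s => x + s * v) v s := fun s => by
    simpa using ((hasDerivAt_id s).mul_const v).const_add x
  have hd2 : ∀ s : ℝ, HasDerivAt (fun s => deriv l (x + s * v) * v)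
      (deriv (deriv l) (x + s * v) * v * v) s := fun s =>
    (HasDerivAt.comp s (hl2 _).hasDerivAt (hin s)).mul_const v
  have h1 : ∀ s ∈ Set.Icc (0 : ℝ) 1, deriv l (x + s * v) * v ≤ deriv l x * v + m * v ^ 2 * s := by
    intro s hs
    have := (convex_Icc (0 : ℝ) 1).image_sub_le_mul_sub_of_deriv_le
      (f := fun s => deriv l (x + s * v) * v) (C := m * v ^ 2)
      (fun s _ => (hd2 s).continuousAt.continuousWithinAt)
      (fun s _ => (hd2 s).differentiableAt.differentiableWithinAt)
      (fun s hs => by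
        rw [(hd2 s).deriv]
        have := hm s (interior_subset hs)
        nlinarith [sq_nonneg v]) 0 (by simp) s hs hs.1
    simp only [zero_mul, add_zero, sub_zero] at this
    linarith
  have hq : ∀ s : ℝ, HasDerivAt (fun s => deriv l x * v * s + m / 2 * v ^ 2 * s ^ 2 - l (x + s * v))
      (deriv l x * v + m * v ^ 2 * s - deriv l (x + s * v) * v) s := fun s => by
    have a1 := (hasDerivAt_id s).const_mul (deriv l x * v)
    have a2 := ((hasDerivAt_id s).pow 2).const_mul (m / 2 * v ^ 2)
    have a3 := HasDerivAt.comp s (hl1 _).hasDerivAt (hin s)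
    refine ((a1.add a2).sub a3).congr_deriv ?_
    simp only [id, mul_one, Nat.cast_ofNat, Nat.add_one_sub_one, pow_one]
    ring
  have hmono : MonotoneOn (fun s => deriv l x * v * s + m / 2 * v ^ 2 * s ^ 2 - l (x + s * v))
      (Set.Icc (0 : ℝ) 1) := by
    apply monotoneOn_of_deriv_nonneg (convex_Icc 0 1)
    · exact fun s _ => (hq s).continuousAt.continuousWithinAt
    · exact fun s _ => (hq s).differentiableAt.differentiableWithinAt
    · intro s hs
      rw [(hq s).deriv]
      have := h1 s (interior_subset hs)
      linarith
  have := hmono (Set.left_mem_Icc.2 zero_le_one) (Set.right_mem_Icc.2 zero_le_one) zero_le_one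
  simp only [mul_zero, zero_mul, add_zero, one_mul, mul_one, one_pow] at this
  norm_num at this
  linarith

theorem abs_sub_le_of_abs_deriv_le {g : ℝ → ℝ} (hg : Differentiable ℝ g) {B : ℝ}
    (hB : ∀ x, |deriv g x| ≤ B) (x y : ℝ) : |g x - g y| ≤ B * |x - y| := by
  have := convex_univ.norm_image_sub_le_of_norm_deriv_le (f := g) (C := B)
    (fun x _ => hg x) (fun x _ => hB x) (Set.mem_univ y) (Set.mem_univ x)
  simpa using this

/-- If `exp l₁ + exp l₀ = 1` and both second derivatives are bounded below, then the Fisher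
information `exp l₁ (l₁')² + exp l₀ (l₀')²` is bounded: differentiate the identity twice. -/
theorem fisher_information_le {l₁ l₀ : ℝ → ℝ} (h1 : ContDiff ℝ 2 l₁) (h0 : ContDiff ℝ 2 l₀)
    (h : ∀ x, Real.exp (l₁ x) + Real.exp (l₀ x) = 1) {B : ℝ}
    (hB1 : ∀ x, |deriv (deriv l₁) x| ≤ B) (hB0 : ∀ x, |deriv (deriv l₀) x| ≤ B) (x : ℝ) :
    Real.exp (l₁ x) * deriv l₁ x ^ 2 + Real.exp (l₀ x) * deriv l₀ x ^ 2 ≤ B := by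
  have d1 : ∀ l : ℝ → ℝ, ContDiff ℝ 2 l → ∀ x, HasDerivAt l (deriv l x) x := fun l hl x =>
    (hl.differentiable (by norm_num) x).hasDerivAt
  have d2 : ∀ l : ℝ → ℝ, ContDiff ℝ 2 l → ∀ x, HasDerivAt (deriv l) (deriv (deriv l) x) x :=
    fun l hl x => (hl.differentiable_deriv_two x).hasDerivAt
  -- the first and the second derivative of the identity `exp l₁ + exp l₀ = 1`
  have e1 : ∀ x, Real.exp (l₁ x) * deriv l₁ x + Real.exp (l₀ x) * deriv l₀ x = 0 := by
    intro x
    have := ((d1 l₁ h1 x).exp.add (d1 l₀ h0 x).exp)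
    have hc : (fun x => Real.exp (l₁ x)) + (fun x => Real.exp (l₀ x)) = fun _ => (1 : ℝ) := by
      ext x; exact h x
    rw [hc] at this
    exact this.unique (hasDerivAt_const x 1)
  have e2 := (((d1 l₁ h1 x).exp.mul (d2 l₁ h1 x)).add ((d1 l₀ h0 x).exp.mul (d2 l₀ h0 x)))
  have hc : (fun x => Real.exp (l₁ x)) * deriv l₁ + (fun x => Real.exp (l₀ x)) * deriv l₀ =
      fun _ => (0 : ℝ) := by ext x; exact e1 x
  rw [hc] at e2
  have e3 := e2.unique (hasDerivAt_const x 0)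
  have b1 := (abs_le.1 (hB1 x)).1
  have b0 := (abs_le.1 (hB0 x)).1
  have p1 := Real.exp_pos (l₁ x)
  have p0 := Real.exp_pos (l₀ x)
  have := h x
  have q1 := mul_le_mul_of_nonneg_left b1 p1.le
  have q0 := mul_le_mul_of_nonneg_left b0 p0.le
  linear_combination q1 + q0 + e3 + B * this

end Calculus

namespace FactorBinaryModel

variable {Ω : Type*} {p d : ℕ} [mΩ : MeasurableSpace Ω] {M : FactorBinaryModel Ω p d}
  {P : Measure Ω} [IsProbabilityMeasure P] {Ξl Ξu : ℕ → ℝ} {c B bL bU : ℝ}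

namespace LikelihoodAssumptions

theorem exp_logLikTerm_one (h : M.LikelihoodAssumptions P Ξl Ξu c B bL bU) (x : ℝ) :
    Real.exp (logLikTerm (M.Phi P) 1 x) = M.Phi P x := by
  simp [logLikTerm, Real.exp_log (h.Phi_mem x).1]

theorem exp_logLikTerm_zero (h : M.LikelihoodAssumptions P Ξl Ξu c B bL bU) (x : ℝ) :
    Real.exp (logLikTerm (M.Phi P) 0 x) = 1 - M.Phi P x := by
  have := (h.Phi_mem x).2
  simp [logLikTerm, Real.exp_log (show 0 < 1 - M.Phi P x by linarith)]

theorem monotone_Phi (M : FactorBinaryModel Ω p d) (P : Measure Ω) : Monotone (M.Phi P) :=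
  fun _ _ hxy => monotone_cdf _ hxy

theorem contDiff_two (h : M.LikelihoodAssumptions P Ξl Ξu c B bL bU) {y : ℝ}
    (hy : y ∈ ({0, 1} : Set ℝ)) : ContDiff ℝ 2 (logLikTerm (M.Phi P) y) :=
  (h.l_smooth y hy).of_le (by norm_num)

theorem deriv_two (l : ℝ → ℝ) : deriv (deriv l) = iteratedDeriv 2 l := by
  rw [iteratedDeriv_succ, iteratedDeriv_one]

theorem abs_deriv_deriv_le (h : M.LikelihoodAssumptions P Ξl Ξu c B bL bU) {y : ℝ}
    (hy : y ∈ ({0, 1} : Set ℝ)) (x : ℝ) : |deriv (deriv (logLikTerm (M.Phi P) y)) x| ≤ B := by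
  rw [deriv_two]
  exact h.l_deriv_two_three y hy 2 (by simp) x

theorem deriv_lipschitz (h : M.LikelihoodAssumptions P Ξl Ξu c B bL bU) {y : ℝ}
    (hy : y ∈ ({0, 1} : Set ℝ)) (x x' : ℝ) :
    |deriv (logLikTerm (M.Phi P) y) x - deriv (logLikTerm (M.Phi P) y) x'| ≤ B * |x - x'| := by
  exact abs_sub_le_of_abs_deriv_le (h.contDiff_two hy).differentiable_deriv_two
    (h.abs_deriv_deriv_le hy) x x'

theorem deriv_deriv_lipschitz (h : M.LikelihoodAssumptions P Ξl Ξu c B bL bU) {y : ℝ}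
    (hy : y ∈ ({0, 1} : Set ℝ)) (x x' : ℝ) :
    |deriv (deriv (logLikTerm (M.Phi P) y)) x - deriv (deriv (logLikTerm (M.Phi P) y)) x'| ≤
      B * |x - x'| := by
  refine abs_sub_le_of_abs_deriv_le ?_ (fun x => ?_) x x'
  · rw [deriv_two]
    exact (h.l_smooth y hy).differentiable_iteratedDeriv 2 (by norm_num)
  · rw [show deriv (deriv (deriv (logLikTerm (M.Phi P) y))) =
      iteratedDeriv 3 (logLikTerm (M.Phi P) y) by
        rw [iteratedDeriv_succ, deriv_two (logLikTerm (M.Phi P) y)]]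
    exact h.l_deriv_two_three y hy 3 (by simp) x

/-- The Fisher information of one observation is bounded, because it is the mean of `-l''`. -/
theorem fisher_le (h : M.LikelihoodAssumptions P Ξl Ξu c B bL bU) (x : ℝ) :
    M.Phi P x * deriv (logLikTerm (M.Phi P) 1) x ^ 2 +
      (1 - M.Phi P x) * deriv (logLikTerm (M.Phi P) 0) x ^ 2 ≤ B := by
  have := fisher_information_le (h.contDiff_two (y := 1) (by simp))
    (h.contDiff_two (y := 0) (by simp)) (fun x => by
      rw [h.exp_logLikTerm_one, h.exp_logLikTerm_zero]; ring)
    (h.abs_deriv_deriv_le (by simp)) (h.abs_deriv_deriv_le (by simp)) x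
  rwa [h.exp_logLikTerm_one, h.exp_logLikTerm_zero] at this

theorem exp_mul_deriv_sq_le (h : M.LikelihoodAssumptions P Ξl Ξu c B bL bU) {y : ℝ}
    (hy : y ∈ ({0, 1} : Set ℝ)) (x : ℝ) :
    Real.exp (logLikTerm (M.Phi P) y x) * deriv (logLikTerm (M.Phi P) y) x ^ 2 ≤ B := by
  have := h.fisher_le x
  have hΦ := h.Phi_mem x
  have p1 := mul_nonneg hΦ.1.le (sq_nonneg (deriv (logLikTerm (M.Phi P) 1) x))
  have p0 := mul_nonneg (show 0 ≤ 1 - M.Phi P x by linarith [hΦ.2])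
    (sq_nonneg (deriv (logLikTerm (M.Phi P) 0) x))
  rcases hy with rfl | hy
  · rw [h.exp_logLikTerm_zero]; linarith
  · rw [Set.mem_singleton_iff.1 hy, h.exp_logLikTerm_one]; linarith

theorem B_nonneg (h : M.LikelihoodAssumptions P Ξl Ξu c B bL bU) : 0 ≤ B :=
  (abs_nonneg _).trans (h.abs_deriv_deriv_le (y := 1) (by simp) 0)

/-- The square root of the likelihood is globally Lipschitz, although the log-likelihood is not. -/
theorem sqrt_lik_lipschitz (h : M.LikelihoodAssumptions P Ξl Ξu c B bL bU) {y : ℝ}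
    (hy : y ∈ ({0, 1} : Set ℝ)) (x x' : ℝ) :
    |Real.exp (logLikTerm (M.Phi P) y x / 2) - Real.exp (logLikTerm (M.Phi P) y x' / 2)| ≤
      √B * |x - x'| := by
  have hd : ∀ x, HasDerivAt (fun x => Real.exp (logLikTerm (M.Phi P) y x / 2))
      (Real.exp (logLikTerm (M.Phi P) y x / 2) * (deriv (logLikTerm (M.Phi P) y) x / 2)) x :=
    fun x => (((h.contDiff_two hy).differentiable (by norm_num) x).hasDerivAt.div_const 2).exp
  refine abs_sub_le_of_abs_deriv_le (fun x => (hd x).differentiableAt) (fun x => ?_) x x'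
  rw [(hd x).deriv]
  apply Real.abs_le_sqrt
  have := h.exp_mul_deriv_sq_le hy x
  have e : Real.exp (logLikTerm (M.Phi P) y x) = Real.exp (logLikTerm (M.Phi P) y x / 2) ^ 2 := by
    rw [← Real.exp_nat_mul]; congr 1; push_cast; ring
  rw [e] at this
  have hB := h.B_nonneg
  calc _ = Real.exp (logLikTerm (M.Phi P) y x / 2) ^ 2 * deriv (logLikTerm (M.Phi P) y) x ^ 2 / 4 :=
        by ring
    _ ≤ B := by linarith

theorem logLikTerm_nonpos (h : M.LikelihoodAssumptions P Ξl Ξu c B bL bU) {y : ℝ}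
    (hy : y ∈ ({0, 1} : Set ℝ)) (x : ℝ) : logLikTerm (M.Phi P) y x ≤ 0 := by
  rw [← Real.exp_le_one_iff]
  have := h.Phi_mem x
  rcases hy with rfl | hy
  · rw [h.exp_logLikTerm_zero]; linarith [this.1]
  · rw [Set.mem_singleton_iff.1 hy, h.exp_logLikTerm_one]; exact this.2.le

/-- The distribution function is Lipschitz. -/
theorem Phi_lipschitz (h : M.LikelihoodAssumptions P Ξl Ξu c B bL bU) (x x' : ℝ) :
    |M.Phi P x - M.Phi P x'| ≤ 2 * √B * |x - x'| := by
  have h1 := h.sqrt_lik_lipschitz (y := 1) (by simp) x x'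
  have hb : ∀ x, Real.exp (logLikTerm (M.Phi P) 1 x / 2) ≤ 1 := fun x => by
    rw [Real.exp_le_one_iff]; linarith [h.logLikTerm_nonpos (y := 1) (by simp) x]
  have e : ∀ x, M.Phi P x = Real.exp (logLikTerm (M.Phi P) 1 x / 2) ^ 2 := fun x => by
    rw [← Real.exp_nat_mul, ← h.exp_logLikTerm_one]; congr 1; push_cast; ring
  rw [e x, e x', sq_sub_sq, abs_mul, abs_of_pos (add_pos (Real.exp_pos _) (Real.exp_pos _))]
  calc _ ≤ 2 * (√B * |x - x'|) := by
        apply mul_le_mul _ h1 (abs_nonneg _) zero_le_two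
        linarith [hb x, hb x']
    _ = _ := by ring

theorem hasDerivAt_Phi (h : M.LikelihoodAssumptions P Ξl Ξu c B bL bU) (x : ℝ) :
    HasDerivAt (M.Phi P) (M.Phi P x * deriv (logLikTerm (M.Phi P) 1) x) x := by
  have := (((h.contDiff_two (y := 1) (by simp)).differentiable (by norm_num) x).hasDerivAt).exp
  rw [h.exp_logLikTerm_one] at this
  exact this.congr_of_eventuallyEq (Eventually.of_forall fun x => (h.exp_logLikTerm_one x).symm)

/-- The derivative of the distribution function in terms of the likelihood of the outcome `0`. -/
theorem hasDerivAt_Phi' (h : M.LikelihoodAssumptions P Ξl Ξu c B bL bU) (x : ℝ) :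
    HasDerivAt (M.Phi P) (-((1 - M.Phi P x) * deriv (logLikTerm (M.Phi P) 0) x)) x := by
  have := (((h.contDiff_two (y := 0) (by simp)).differentiable (by norm_num) x).hasDerivAt).exp
  rw [h.exp_logLikTerm_zero] at this
  refine (this.const_sub 1).congr_of_eventuallyEq (Eventually.of_forall fun x => ?_)
  simp only [h.exp_logLikTerm_zero]; ring

/-- The intervals `Ξ_T` are nondegenerate, since `Φ` increases strictly from end to end. -/
theorem interval_lt (h : M.LikelihoodAssumptions P Ξl Ξu c B bL bU) (T : ℕ) : Ξl T < Ξu T := by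
  by_contra hle
  exact absurd (monotone_Phi M P (not_lt.1 hle)) (not_le.2 (h.Phi_lt T))

theorem B_pos (h : M.LikelihoodAssumptions P Ξl Ξu c B bL bU) : 0 < B := by
  have hx : Ξl 0 ∈ Set.Icc (Ξl 0) (Ξu 0) := Set.left_mem_Icc.2 (h.interval_lt 0).le
  have h1 := (h.l_concave 1 (by simp) 0 _ hx).1
  have h2 := h.l_deriv_two_three 1 (by simp) 2 (by simp) (Ξl 0)
  have := (abs_le.1 h2).1
  linarith [h.bL_pos]

/-- On `Ξ_T` the density is the derivative of the distribution function. -/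
theorem deriv_Phi_eq (h : M.LikelihoodAssumptions P Ξl Ξu c B bL bU)
    (hε : Measurable (M.ε 0)) (T : ℕ) {x : ℝ}
    (hx : x ∈ Set.Icc (Ξl T) (Ξu T)) : deriv (M.Phi P) x = M.φ x := by
  have hlt := h.interval_lt T
  have hcont : ContinuousOn M.φ (Set.Icc (Ξl T) (Ξu T)) := (h.φ_smooth T).continuousOn
  have hprob : IsProbabilityMeasure (P.map (M.ε 0)) :=
    Measure.isProbabilityMeasure_map hε.aemeasurable
  -- the fundamental theorem of calculus applies in the interior, and both sides are continuous up
  -- to the end points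
  have hFTC : ∀ y ∈ Set.Icc (Ξl T) (Ξu T), M.Phi P y = M.Phi P (Ξl T) + ∫ s in Ξl T..y, M.φ s := by
    intro y hy
    have h1 : (P.map (M.ε 0)).real (Set.Ioc (Ξl T) y) = M.Phi P y - M.Phi P (Ξl T) := by
      have : Set.Ioc (Ξl T) y = Set.Iic y \ Set.Iic (Ξl T) := by
        ext s; simp [and_comm]
      rw [this, measureReal_sdiff (Set.Iic_subset_Iic.2 hy.1) measurableSet_Iic]
      unfold Phi
      rw [cdf_eq_real, cdf_eq_real]
    have h2 : (P.map (M.ε 0)).real (Set.Ioc (Ξl T) y) = ∫ s in Ξl T..y, M.φ s := by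
      rw [intervalIntegral.integral_of_le hy.1, measureReal_def, h.density 0,
        withDensity_apply _ measurableSet_Ioc,
        integral_eq_lintegral_of_nonneg_ae (Eventually.of_forall h.φ_nonneg)
          h.measurable_φ.aestronglyMeasurable]
    linarith
  have hIoo : Set.EqOn (deriv (M.Phi P)) M.φ (Set.Ioo (Ξl T) (Ξu T)) := by
    intro y hy
    have hnhds : Set.Icc (Ξl T) (Ξu T) ∈ 𝓝 y := Icc_mem_nhds hy.1 hy.2
    have hi : IntervalIntegrable M.φ volume (Ξl T) y :=
      (hcont.mono (by
        rw [Set.uIcc_of_le hy.1.le]; exact Set.Icc_subset_Icc_right hy.2.le)).intervalIntegrable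
    have hd := intervalIntegral.integral_hasDerivAt_right hi
      h.measurable_φ.stronglyMeasurable.stronglyMeasurableAtFilter
      (hcont.continuousAt hnhds)
    have := (hd.const_add (M.Phi P (Ξl T))).congr_of_eventuallyEq
      (f₁ := M.Phi P) (by filter_upwards [hnhds] with s hs using hFTC s hs)
    exact this.deriv
  have hcl := hIoo.of_subset_closure (t := Set.Icc (Ξl T) (Ξu T)) ?_ hcont Set.Ioo_subset_Icc_self
    (by rw [closure_Ioo hlt.ne])
  · exact hcl hx
  · have : deriv (M.Phi P) = fun x => M.Phi P x * deriv (logLikTerm (M.Phi P) 1) x :=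
      funext fun x => (h.hasDerivAt_Phi x).deriv
    rw [this]
    have hc1 : Continuous (M.Phi P) :=
      continuous_iff_continuousAt.2 fun x => (h.hasDerivAt_Phi x).continuousAt
    exact (hc1.mul
      ((h.contDiff_two (y := 1) (by simp)).continuous_deriv (by norm_num))).continuousOn

theorem le_deriv_Phi (h : M.LikelihoodAssumptions P Ξl Ξu c B bL bU)
    (hε : Measurable (M.ε 0)) (T : ℕ) {x : ℝ}
    (hx : x ∈ Set.Icc (Ξl T) (Ξu T)) : c ≤ deriv (M.Phi P) x := by
  rw [h.deriv_Phi_eq hε T hx, ← abs_of_nonneg (h.φ_nonneg x)]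
  exact h.φ_lower T x hx

/-- On `Ξ_T` both outcomes have probability at least `c² / B`. -/
theorem lik_lower (h : M.LikelihoodAssumptions P Ξl Ξu c B bL bU)
    (hε : Measurable (M.ε 0)) (T : ℕ) {x : ℝ}
    (hx : x ∈ Set.Icc (Ξl T) (Ξu T)) {y : ℝ} (hy : y ∈ ({0, 1} : Set ℝ)) :
    c ^ 2 / B ≤ Real.exp (logLikTerm (M.Phi P) y x) := by
  have hB := h.B_pos
  have hc := h.le_deriv_Phi hε T hx
  have hF := h.exp_mul_deriv_sq_le hy x
  have hpos := Real.exp_pos (logLikTerm (M.Phi P) y x)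
  -- the derivative of `Φ` is, up to sign, the likelihood times the derivative of its logarithm
  have key : c ^ 2 ≤ (Real.exp (logLikTerm (M.Phi P) y x) *
      deriv (logLikTerm (M.Phi P) y) x) ^ 2 := by
    rcases hy with rfl | hy
    · rw [(h.hasDerivAt_Phi' x).deriv, ← h.exp_logLikTerm_zero] at hc
      rw [← neg_sq (_ * _)]
      exact pow_le_pow_left₀ h.c_pos.le hc 2
    · rw [Set.mem_singleton_iff.1 hy]
      rw [(h.hasDerivAt_Phi x).deriv, ← h.exp_logLikTerm_one] at hc
      exact pow_le_pow_left₀ h.c_pos.le hc 2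
  rw [div_le_iff₀ hB]
  nlinarith

/-- The distribution function separates points of `Ξ_T` from all other points. -/
theorem Phi_ne (h : M.LikelihoodAssumptions P Ξl Ξu c B bL bU)
    (hε : Measurable (M.ε 0)) (T : ℕ) {x x' : ℝ}
    (hx : x ∈ Set.Icc (Ξl T) (Ξu T)) (hne : x' ≠ x) : M.Phi P x' ≠ M.Phi P x := by
  intro heq
  have hd : HasDerivAt (M.Phi P) (deriv (M.Phi P) x) x :=
    (h.hasDerivAt_Phi x).differentiableAt.hasDerivAt
  have hpos : 0 < deriv (M.Phi P) x := h.c_pos.trans_le (h.le_deriv_Phi hε T hx)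
  -- by monotonicity `Φ` is constant between the two points, although its derivative at `x` is
  -- positive
  have hconst : ∀ s ∈ Set.uIcc x x', M.Phi P s = M.Phi P x := by
    intro s hs
    rcases le_total x x' with hle | hle
    · rw [Set.uIcc_of_le hle] at hs
      exact le_antisymm ((monotone_Phi M P hs.2).trans heq.le) (monotone_Phi M P hs.1)
    · rw [Set.uIcc_of_ge hle] at hs
      exact le_antisymm (monotone_Phi M P hs.2) (heq.symm.le.trans (monotone_Phi M P hs.1))
  have hu : UniqueDiffWithinAt ℝ (Set.uIcc x x') x :=
    uniqueDiffOn_Icc (by rcases lt_or_gt_of_ne hne with h | h <;> simp [h]) x Set.left_mem_uIcc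
  have h0 : HasDerivWithinAt (M.Phi P) 0 (Set.uIcc x x') x :=
    (hasDerivWithinAt_const x _ (M.Phi P x)).congr hconst rfl
  exact hpos.ne' (hu.eq_deriv _ hd.hasDerivWithinAt h0)

/-- On `Ξ_T` the factor of `z_t` in the score is the derivative of the log-likelihood. -/
theorem score_factor_eq (h : M.LikelihoodAssumptions P Ξl Ξu c B bL bU)
    (hε : Measurable (M.ε 0)) (T : ℕ) {x : ℝ}
    (hx : x ∈ Set.Icc (Ξl T) (Ξu T)) {y : ℝ} (hy : y ∈ ({0, 1} : Set ℝ)) :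
    (y - M.Phi P x) * M.φ x / ((1 - M.Phi P x) * M.Phi P x) =
      deriv (logLikTerm (M.Phi P) y) x := by
  have hΦ := h.Phi_mem x
  have h1 : (1 - M.Phi P x) ≠ 0 := by linarith [hΦ.2]
  have h2 : M.Phi P x ≠ 0 := hΦ.1.ne'
  rw [← h.deriv_Phi_eq hε T hx]
  rcases hy with rfl | hy
  · rw [(h.hasDerivAt_Phi' x).deriv]; field_simp; ring
  · rw [Set.mem_singleton_iff.1 hy, (h.hasDerivAt_Phi x).deriv]; field_simp

/-- The log-likelihood of an observation tends to `-∞` as the index tends to infinity with the wrong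
sign. -/
theorem logLikTerm_far (h : M.LikelihoodAssumptions P Ξl Ξu c B bL bU) (A : ℝ) :
    ∃ V : ℝ, 0 < V ∧ (∀ x, V ≤ x → logLikTerm (M.Phi P) 0 x ≤ -A) ∧
      ∀ x, x ≤ -V → logLikTerm (M.Phi P) 1 x ≤ -A := by
  have h1 : ∀ᶠ x in atTop, 1 - Real.exp (-A) < M.Phi P x :=
    (tendsto_cdf_atTop (P.map (M.ε 0))).eventually (lt_mem_nhds (by linarith [Real.exp_pos (-A)]))
  have h0 : ∀ᶠ x in atBot, M.Phi P x < Real.exp (-A) :=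
    (tendsto_cdf_atBot (P.map (M.ε 0))).eventually (gt_mem_nhds (Real.exp_pos (-A)))
  obtain ⟨V1, hV1⟩ := eventually_atTop.1 h1
  obtain ⟨V0, hV0⟩ := eventually_atBot.1 h0
  refine ⟨max 1 (max V1 (-V0)), by positivity, fun x hx => ?_, fun x hx => ?_⟩
  · rw [← Real.exp_le_exp, h.exp_logLikTerm_zero]
    have := hV1 x ((le_max_left _ _).trans ((le_max_right _ _).trans hx))
    linarith
  · rw [← Real.exp_le_exp, h.exp_logLikTerm_one]
    refine (hV0 x ?_).le
    have : -V0 ≤ max 1 (max V1 (-V0)) := (le_max_right _ _).trans (le_max_right _ _)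
    linarith

end LikelihoodAssumptions

end FactorBinaryModel

/-! ### A uniform lower bound for averages of a stationary mixing series -/

section UniformLaw

variable {Ω S : Type*} [mΩ : MeasurableSpace Ω] [MeasurableSpace S] {P : Measure Ω}
  [IsProbabilityMeasure P] {X : ℕ → Ω → S}

theorem StrictlyStationary.map_pair_eq (hX : ∀ t, Measurable (X t)) (h : StrictlyStationary P X)
    (k t : ℕ) :
    P.map (fun ω => (X t ω, X (t + k) ω)) = P.map (fun ω => (X 0 ω, X k ω)) := by
  have hm : Measurable (fun x : ℕ → S => (x 0, x k)) :=
    (measurable_pi_apply 0).prodMk (measurable_pi_apply k)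
  have h1 : Measurable (fun ω => fun s : ℕ => X (s + t) ω) := measurable_pi_lambda _ fun s => hX _
  have h2 : Measurable (fun ω => fun s : ℕ => X s ω) := measurable_pi_lambda _ fun s => hX _
  have := congrArg (Measure.map (fun x : ℕ → S => (x 0, x k))) (h t)
  rw [Measure.map_map hm h1, Measure.map_map hm h2] at this
  simpa [Function.comp_def, add_comm] using this

theorem StrictlyStationary.integral_pair_eq (hX : ∀ t, Measurable (X t))
    (h : StrictlyStationary P X) (k t : ℕ) {g : S × S → ℝ} (hg : Measurable g) :
    ∫ ω, g (X t ω, X (t + k) ω) ∂P = ∫ ω, g (X 0 ω, X k ω) ∂P := by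
  rw [← integral_map (φ := fun ω => (X t ω, X (t + k) ω)) ((hX t).prodMk (hX _)).aemeasurable
    hg.aestronglyMeasurable, h.map_pair_eq hX, integral_map ((hX 0).prodMk (hX _)).aemeasurable
    hg.aestronglyMeasurable]

theorem StrictlyStationary.integrable_pair_iff (hX : ∀ t, Measurable (X t))
    (h : StrictlyStationary P X) (k t : ℕ) {g : S × S → ℝ} (hg : Measurable g) :
    Integrable (fun ω => g (X t ω, X (t + k) ω)) P ↔ Integrable (fun ω => g (X 0 ω, X k ω)) P := by
  have h1 := integrable_map_measure (μ := P) (f := fun ω => (X t ω, X (t + k) ω))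
    hg.aestronglyMeasurable ((hX t).prodMk (hX _)).aemeasurable
  have h2 := integrable_map_measure (μ := P) (f := fun ω => (X 0 ω, X k ω))
    hg.aestronglyMeasurable ((hX 0).prodMk (hX _)).aemeasurable
  rw [h.map_pair_eq hX] at h1
  exact h1.symm.trans h2

theorem tendsto_measure_zero_of_forall {ι : Type*} {l : Filter ι} {A : ι → Set Ω}
    (h : ∀ η : ℝ, 0 < η → ∀ᶠ n in l, P (A n) ≤ ENNReal.ofReal η) :
    Tendsto (fun n => P (A n)) l (𝓝 0) := by
  rw [ENNReal.tendsto_nhds_zero]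
  intro ε hε
  rcases eq_or_ne ε ∞ with rfl | htop
  · exact Eventually.of_forall fun _ => le_top
  · filter_upwards [h ε.toReal (ENNReal.toReal_pos hε.ne' htop)] with n hn
    rwa [ENNReal.ofReal_toReal htop] at hn

/-- The weak law of large numbers for a bounded function of `(X t, X (t + k))`. -/
theorem tendsto_measure_average_lt (hX : ∀ t, Measurable (X t)) (hst : StrictlyStationary P X)
    (hmix : Summable (mixing P X)) (k : ℕ) {g : S × S → ℝ} (hg : Measurable g) {C : ℝ}
    (hC : ∀ q, |g q| ≤ C) {a : ℝ} (ha : a < ∫ ω, g (X 0 ω, X k ω) ∂P) :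
    Tendsto (fun n : ℕ => P {ω | ∑ t ∈ Finset.range n, g (X t ω, X (t + k) ω) < a * n})
      atTop (𝓝 0) := by
  obtain ⟨ω₀⟩ : Nonempty Ω := nonempty_of_isProbabilityMeasure P
  set m := ∫ ω, g (X 0 ω, X k ω) ∂P with hm
  have hC0 : 0 ≤ C := (abs_nonneg _).trans (hC (X 0 ω₀, X 0 ω₀))
  set Y : ℕ → Ω → ℝ := fun t ω => g (X t ω, X (t + k) ω) with hY
  have hYm : ∀ t, Measurable (Y t) := fun t => hg.comp ((hX t).prodMk (hX _))
  have hYi : ∀ t, Integrable (Y t) P := fun t =>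
    Integrable.of_bound (hYm t).aestronglyMeasurable C (Eventually.of_forall fun ω => hC _)
  have hYY : ∀ s t, Integrable (fun ω => Y s ω * Y t ω) P := fun s t =>
    (hYi t).bdd_mul (hYm s).aestronglyMeasurable (Eventually.of_forall fun ω => hC _)
  have hYE : ∀ t, ∫ ω, Y t ω ∂P = m := fun t => hst.integral_pair_eq hX k t hg
  have hcov : ∀ s t, Integrable (fun ω => (Y s ω - m) * (Y t ω - m)) P ∧
      ∫ ω, (Y s ω - m) * (Y t ω - m) ∂P ≤ 4 * C * C * mixing P X (Nat.dist t s - k) := by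
    intro s t
    have he : (fun ω => (Y s ω - m) * (Y t ω - m)) =
        fun ω => Y s ω * Y t ω - (m * Y s ω + m * Y t ω - m * m) := by ext ω; ring
    have i0 : Integrable (fun ω => m * Y s ω + m * Y t ω) P :=
      ((hYi s).const_mul m).add ((hYi t).const_mul m)
    have i1 : Integrable (fun ω => m * Y s ω + m * Y t ω - m * m) P := i0.sub (integrable_const _)
    rw [he]
    refine ⟨(hYY s t).sub i1, ?_⟩
    rw [integral_sub (hYY s t) i1, integral_sub i0 (integrable_const _),
      integral_add ((hYi s).const_mul m) ((hYi t).const_mul m),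
      integral_const_mul, integral_const_mul, hYE, hYE]
    have hmeas : ∀ t, StronglyMeasurable[sigmaOf X (Set.Icc t (t + k))] (Y t) := fun t =>
      (hg.comp ((measurable_sigmaOf (X := X) (by simp)).prodMk
        (measurable_sigmaOf (X := X) (by simp)))).stronglyMeasurable
    have hb := abs_cov_le_of_bounded (P := P) (sigmaOf_le hX _) (sigmaOf_le hX _)
      (hmeas s) (hmeas t) (fun ω => hC _) (fun ω => hC _)
    -- the pairs starting at `s` and `t` are separated by `dist t s - k` periods; the truncated
    -- subtraction is harmless, as overlapping pairs have coefficient `mixing P X 0`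
    have hα : alphaCoeff P (sigmaOf X (Set.Icc s (s + k))) (sigmaOf X (Set.Icc t (t + k))) ≤
        mixing P X (Nat.dist t s - k) :=
      alphaCoeff_le_crossMixing Set.ordConnected_Icc Set.ordConnected_Icc fun i hi j hj => by
        simp only [Set.mem_Icc] at hi hj
        unfold Nat.dist
        omega
    rw [hYE, hYE] at hb
    have h1 := (abs_le.1 hb).2
    simp only [integral_const, probReal_univ, smul_eq_mul, one_mul]
    have h2 := mul_le_mul_of_nonneg_left hα (by positivity : 0 ≤ 4 * C * C)
    linarith
  have hsum : Summable fun n => mixing P X (n - k) := by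
    rw [← summable_nat_add_iff k]; simpa using hmix
  set V := 4 * C * C * (2 * ∑' n, mixing P X (n - k)) with hV
  have hvar : ∀ n : ℕ, Integrable (fun ω => (∑ t ∈ Finset.range n, (Y t ω - m)) ^ 2) P ∧
      ∫ ω, (∑ t ∈ Finset.range n, (Y t ω - m)) ^ 2 ∂P ≤ V * n := by
    intro n
    obtain ⟨g1, g2⟩ := integrable_sq_sum (P := P) (Finset.range n) (X := fun t ω => Y t ω - m)
      (fun i _ j _ => (hcov i j).1) (fun i _ j _ => (hcov i j).2)
    refine ⟨g1, g2.trans ?_⟩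
    calc _ ≤ ∑ s ∈ Finset.range n, V := by
          refine Finset.sum_le_sum fun s _ => ?_
          rw [← Finset.mul_sum]
          exact mul_le_mul_of_nonneg_left (sum_dist_le_two_mul_tsum
            (a := fun n => mixing P X (n - k)) (fun _ => crossMixing_nonneg _ _ _) hsum _ s)
            (by positivity)
      _ = V * n := by rw [Finset.sum_const, Finset.card_range, nsmul_eq_mul, mul_comm]
  have hma : 0 < m - a := by linarith
  have hbound : ∀ n : ℕ, 0 < n → P {ω | ∑ t ∈ Finset.range n, Y t ω < a * n} ≤
      ENNReal.ofReal (V / ((m - a) ^ 2 / 4 * n)) := by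
    intro n hn
    have hn' : (0 : ℝ) < n := by exact_mod_cast hn
    have h1 := measure_lt_le_of_integral_le (hvar n).1 (fun ω => sq_nonneg _) (hvar n).2
      (K := ((m - a) / 2 * n) ^ 2) (by positivity)
    refine (measure_mono fun ω hω => ?_).trans (h1.trans (le_of_eq ?_))
    · simp only [Set.mem_ofPred_eq] at hω ⊢
      have e : ∑ t ∈ Finset.range n, (Y t ω - m) = ∑ t ∈ Finset.range n, Y t ω - m * n := by
        rw [Finset.sum_sub_distrib]; simp [mul_comm]
      rw [e, sq_lt_sq, abs_of_pos (by positivity), abs_of_neg (by nlinarith)]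
      nlinarith
    · congr 1; field_simp; ring
  have hlim : Tendsto (fun n : ℕ => ENNReal.ofReal (V / ((m - a) ^ 2 / 4 * n))) atTop (𝓝 0) := by
    have : Tendsto (fun n : ℕ => V / ((m - a) ^ 2 / 4 * n)) atTop (𝓝 0) :=
      Tendsto.div_atTop tendsto_const_nhds
        (tendsto_natCast_atTop_atTop.const_mul_atTop (by positivity))
    simpa using ENNReal.tendsto_ofReal this
  exact tendsto_of_tendsto_of_tendsto_of_le_of_le' tendsto_const_nhds hlim
    (Eventually.of_forall fun _ => zero_le)
    ((eventually_gt_atTop 0).mono hbound)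

/-- A family of bounded functions that is Lipschitz in a parameter from a compact set and has
positive means has sample averages that are bounded below, uniformly in the parameter, with
probability tending to one. -/
theorem exists_uniform_lower_bound (hX : ∀ t, Measurable (X t)) (hst : StrictlyStationary P X)
    (hmix : Summable (mixing P X)) (k : ℕ) {E : Type*} [PseudoMetricSpace E] {K : Set E}
    (hK : IsCompact K) {Ψ : E → S × S → ℝ} (hΨ : ∀ θ, Measurable (Ψ θ)) {C : ℝ}
    (hC : ∀ θ q, |Ψ θ q| ≤ C) {b : S → ℝ} (hb : Measurable b) (hb0 : ∀ x, 0 ≤ b x)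
    (hbi : Integrable (fun ω => b (X 0 ω)) P)
    (hL : ∀ θ θ' q, |Ψ θ q - Ψ θ' q| ≤ dist θ θ' * b q.1)
    (hpos : ∀ θ ∈ K, 0 < ∫ ω, Ψ θ (X 0 ω, X k ω) ∂P) :
    ∃ c : ℝ, 0 < c ∧ Tendsto (fun n : ℕ => P {ω | ¬ ∀ θ ∈ K,
      c * n ≤ ∑ t ∈ Finset.range n, Ψ θ (X t ω, X (t + k) ω)}) atTop (𝓝 0) := by
  rcases K.eq_empty_or_nonempty with rfl | hne
  · exact ⟨1, one_pos, by simp⟩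
  set m : E → ℝ := fun θ => ∫ ω, Ψ θ (X 0 ω, X k ω) ∂P with hm
  set β := ∫ ω, b (X 0 ω) ∂P with hβ
  have hβ0 : 0 ≤ β := integral_nonneg fun ω => hb0 _
  have hi : ∀ θ, Integrable (fun ω => Ψ θ (X 0 ω, X k ω)) P := fun θ =>
    Integrable.of_bound ((hΨ θ).comp ((hX 0).prodMk (hX k))).aestronglyMeasurable C
      (Eventually.of_forall fun ω => hC _ _)
  have hmL : LipschitzWith (Real.toNNReal β) m := by
    refine LipschitzWith.of_dist_le_mul fun θ θ' => ?_
    rw [Real.dist_eq, Real.coe_toNNReal _ hβ0, hm]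
    simp only
    rw [← integral_sub (hi θ) (hi θ')]
    refine abs_integral_le_of_abs_le (hbi.const_mul (dist θ θ')) (fun ω => hL θ θ' _) ?_
    rw [integral_const_mul, mul_comm]
  obtain ⟨θ₀, hθ₀, hmin⟩ := hK.exists_isMinOn hne hmL.continuous.continuousOn
  set c₀ := m θ₀ with hc₀
  have hc₀pos : 0 < c₀ := hpos θ₀ hθ₀
  refine ⟨c₀ / 4, by positivity, tendsto_measure_zero_of_forall fun η hη => ?_⟩
  -- a bound for the random Lipschitz constant that fails with probability at most `η / 2`
  set Cb := (β + 1) / (η / 2) with hCb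
  have hCbpos : 0 < Cb := by positivity
  set r := c₀ / 4 / Cb with hr
  have hrpos : 0 < r := by positivity
  -- on a finite net of mesh `r` the law of large numbers applies pointwise, and between its points
  -- the averages vary by at most `r * Cb`
  obtain ⟨F, hFK, hFfin, hcover⟩ := hK.finite_cover_balls hrpos
  have hnet : Tendsto (fun n : ℕ => ∑ θ ∈ hFfin.toFinset,
      P {ω | ∑ t ∈ Finset.range n, Ψ θ (X t ω, X (t + k) ω) < c₀ / 2 * n}) atTop (𝓝 0) := by
    have h0 : (0 : ℝ≥0∞) = ∑ _θ ∈ hFfin.toFinset, 0 := Finset.sum_const_zero.symm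
    refine h0 ▸ tendsto_finsetSum _ fun θ hθ => ?_
    refine tendsto_measure_average_lt hX hst hmix k (hΨ θ) (hC θ) ?_
    have : m θ₀ ≤ m θ := hmin (hFK (hFfin.mem_toFinset.1 hθ))
    have : m θ = ∫ ω, Ψ θ (X 0 ω, X k ω) ∂P := rfl
    linarith
  have hev := (ENNReal.tendsto_nhds_zero.1 hnet) (ENNReal.ofReal (η / 2)) (by simpa using hη)
  filter_upwards [hev, eventually_gt_atTop 0] with n hn hn0
  have hn' : (0 : ℝ) < n := by exact_mod_cast hn0
  have hbt : ∀ t, Integrable (fun ω => b (X t ω)) P ∧ ∫ ω, b (X t ω) ∂P = β := fun t =>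
    ⟨(hst.integrable_pair_iff hX 0 t (g := fun q => b q.1) (hb.comp measurable_fst)).2 hbi,
      hst.integral_pair_eq hX 0 t (g := fun q => b q.1) (hb.comp measurable_fst)⟩
  have hbs : P {ω | Cb * n < ∑ t ∈ Finset.range n, b (X t ω)} ≤ ENNReal.ofReal (η / 2) := by
    have h1 := measure_lt_le_of_integral_le (X := fun ω => ∑ t ∈ Finset.range n, b (X t ω))
      (C := n * β) (K := Cb * n)
      (integrable_finsetSum (Finset.range n) fun t _ => (hbt t).1)
      (fun ω => Finset.sum_nonneg fun t _ => hb0 _)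
      (by rw [integral_finsetSum _ fun t _ => (hbt t).1]; simp [(hbt _).2])
      (by positivity)
    refine h1.trans (ENNReal.ofReal_le_ofReal ?_)
    rw [hCb]
    field_simp
    nlinarith
  have hsub : {ω | ¬ ∀ θ ∈ K, c₀ / 4 * n ≤ ∑ t ∈ Finset.range n, Ψ θ (X t ω, X (t + k) ω)} ⊆
      (⋃ θ ∈ hFfin.toFinset,
        {ω | ∑ t ∈ Finset.range n, Ψ θ (X t ω, X (t + k) ω) < c₀ / 2 * n}) ∪
      {ω | Cb * n < ∑ t ∈ Finset.range n, b (X t ω)} := by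
    intro ω hω
    by_contra hnot
    apply hω
    simp only [Set.mem_union, Set.mem_iUnion, Set.mem_ofPred_eq, not_or, not_exists, not_lt,
      Set.Finite.mem_toFinset] at hnot
    obtain ⟨h1, h2⟩ := hnot
    intro θ hθ
    obtain ⟨θ', hθ', hd⟩ := Set.mem_iUnion₂.1 (hcover hθ)
    have h3 := h1 θ' hθ'
    have h4 : ∑ t ∈ Finset.range n, Ψ θ' (X t ω, X (t + k) ω) -
        ∑ t ∈ Finset.range n, Ψ θ (X t ω, X (t + k) ω) ≤ r * ∑ t ∈ Finset.range n, b (X t ω) := by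
      rw [← Finset.sum_sub_distrib, Finset.mul_sum]
      refine Finset.sum_le_sum fun t _ => ((le_abs_self _).trans (hL θ' θ _)).trans ?_
      refine mul_le_mul_of_nonneg_right ?_ (hb0 _)
      rw [dist_comm]; exact (Metric.mem_ball.1 hd).le
    have h5 : r * ∑ t ∈ Finset.range n, b (X t ω) ≤ c₀ / 4 * n := by
      calc _ ≤ r * (Cb * n) := mul_le_mul_of_nonneg_left h2 hrpos.le
        _ = c₀ / 4 * n := by rw [hr]; field_simp
    linarith
  calc _ ≤ _ := measure_mono hsub
    _ ≤ _ := measure_union_le _ _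
    _ ≤ ENNReal.ofReal (η / 2) + ENNReal.ofReal (η / 2) :=
        add_le_add ((measure_biUnion_finset_le _ _).trans hn) hbs
    _ = ENNReal.ofReal η := by
        rw [← ENNReal.ofReal_add (by positivity) (by positivity)]; congr 1; ring

end UniformLaw

/-! ### Principal components -/

/-- The easy half of the min-max principle: a quadratic form that is at least `κ` on a subspace of
dimension `d` has `d` eigenvalues that are at least `κ`. -/
theorem Matrix.IsHermitian.le_eigenvalues₀ {T d : ℕ} {G : Matrix (Fin T) (Fin T) ℝ}
    (hG : G.IsHermitian) {κ : ℝ} (L : EuclideanSpace ℝ (Fin d) →ₗ[ℝ] EuclideanSpace ℝ (Fin T))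
    (hinj : Function.Injective L)
    (hL : ∀ a, κ * ‖L a‖ ^ 2 ≤ inner ℝ (L a) (Matrix.toEuclideanLin G (L a)))
    (hd : d ≤ Fintype.card (Fin T)) (k : Fin d) : κ ≤ hG.eigenvalues₀ (Fin.castLE hd k) := by
  have hS := Matrix.isSymmetric_toEuclideanLin_iff.mpr hG
  set b := hS.eigenvectorBasis finrank_euclideanSpace with hb
  have hlam : ∀ j, Matrix.toEuclideanLin G (b j) = hG.eigenvalues₀ j • b j := fun j => by
    have := hS.apply_eigenvectorBasis finrank_euclideanSpace j
    exact this
  -- a vector of the subspace that is orthogonal to the first `k` eigenvectors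
  let Q : EuclideanSpace ℝ (Fin d) →ₗ[ℝ] (Fin k → ℝ) := LinearMap.pi fun j =>
    (innerSL ℝ (b (Fin.castLE hd (Fin.castLE k.2.le j)))).toLinearMap ∘ₗ L
  have hker : LinearMap.ker Q ≠ ⊥ := LinearMap.ker_ne_bot_of_finrank_lt (by simp)
  obtain ⟨a, ha, ha0⟩ := (Submodule.ne_bot_iff _).1 hker
  set v := L a with hv
  have hv0 : 0 < ‖v‖ := norm_pos_iff.2 fun h => ha0 (hinj (by rw [← hv, h, map_zero]))
  have horth : ∀ j : Fin (Fintype.card (Fin T)), (j : ℕ) < k → inner ℝ (b j) v = 0 := by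
    intro j hj
    have := congrFun (LinearMap.mem_ker.1 ha) ⟨j, hj⟩
    simpa [Q] using this
  have hform : inner ℝ v (Matrix.toEuclideanLin G v) =
      ∑ j, hG.eigenvalues₀ j * (inner ℝ (b j) v) ^ 2 := by
    rw [← b.sum_inner_mul_inner]
    refine Finset.sum_congr rfl fun j _ => ?_
    rw [← hS (b j) v, hlam, real_inner_smul_left, real_inner_comm v]; ring
  have hnorm : ‖v‖ ^ 2 = ∑ j, (inner ℝ (b j) v) ^ 2 := by
    rw [← real_inner_self_eq_norm_sq, ← b.sum_inner_mul_inner]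
    refine Finset.sum_congr rfl fun j _ => ?_
    rw [real_inner_comm v]; ring
  have hle : inner ℝ v (Matrix.toEuclideanLin G v) ≤
      hG.eigenvalues₀ (Fin.castLE hd k) * ‖v‖ ^ 2 := by
    rw [hform, hnorm, Finset.mul_sum]
    refine Finset.sum_le_sum fun j _ => ?_
    rcases lt_or_ge (j : ℕ) k with hj | hj
    · rw [horth j hj]; simp
    · exact mul_le_mul_of_nonneg_right (hG.eigenvalues₀_antitone (by
        rw [Fin.le_def]; simpa using hj)) (sq_nonneg _)
  have := (hL a).trans hle
  exact le_of_mul_le_mul_right this (by positivity)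

namespace FactorBinaryModel

variable {Ω : Type*} {p d : ℕ} {M : FactorBinaryModel Ω p d}

/-- The quadratic form of the matrix `X Xᵀ / (N T)` is a mean square over the units. -/
theorem gram_quadratic (M : FactorBinaryModel Ω p d) (N T : ℕ) (ω : Ω)
    (v : EuclideanSpace ℝ (Fin T)) :
    inner ℝ v (Matrix.toEuclideanLin (M.gram N T ω) v) =
      ((N : ℝ) * T)⁻¹ * ∑ i : Fin N, (∑ t : Fin T, M.x i t ω * v t) ^ 2 := by
  have h1 : inner ℝ v (Matrix.toEuclideanLin (M.gram N T ω) v) =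
      v.ofLp ⬝ᵥ (M.gram N T ω *ᵥ v.ofLp) := by
    rw [EuclideanSpace.inner_eq_star_dotProduct, dotProduct_comm]
    simp
  rw [h1, gram, Matrix.smul_mulVec, dotProduct_smul, smul_eq_mul, ← Matrix.mulVec_mulVec,
    Matrix.dotProduct_mulVec, ← Matrix.mulVec_transpose]
  congr 1
  simp only [dotProduct, Matrix.mulVec, Matrix.transpose_apply, dataMatrix, Matrix.of_apply]
  exact Finset.sum_congr rfl fun i _ => (sq _).symm

namespace IsPCA

variable {N T : ℕ} {ω : Ω} {g : ℕ → EuclideanSpace ℝ (Fin d)}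

/-- The coordinates of the estimated factors are orthogonal with mean square one. -/
theorem sum_mul (h : M.IsPCA N T ω g) (hT : 0 < T) (k l : Fin d) :
    ∑ t ∈ Finset.range T, g t k * g t l = if k = l then (T : ℝ) else 0 := by
  obtain ⟨hd, -, h2⟩ := h
  have := congrFun (congrFun h2 k) l
  simp only [Matrix.smul_apply, Matrix.mul_apply, Matrix.transpose_apply, Matrix.of_apply,
    smul_eq_mul, Matrix.one_apply] at this
  have hT' : (T : ℝ) ≠ 0 := by exact_mod_cast hT.ne'
  rw [← Fin.sum_univ_eq_sum_range (fun t => g t k * g t l)]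
  rw [inv_mul_eq_iff_eq_mul₀ hT'] at this
  rw [this]; split_ifs <;> simp

/-- In every direction the estimated factors have mean square one. -/
theorem sum_inner_sq (h : M.IsPCA N T ω g) (hT : 0 < T) (a : EuclideanSpace ℝ (Fin d)) :
    ∑ t ∈ Finset.range T, (inner ℝ (g t) a) ^ 2 = T * ‖a‖ ^ 2 := by
  have e : ∀ t, (inner ℝ (g t) a) ^ 2 = ∑ k, ∑ l, (a k * a l) * (g t k * g t l) := fun t => by
    rw [PiLp.inner_apply, sq, Finset.sum_mul_sum]
    refine Finset.sum_congr rfl fun k _ => Finset.sum_congr rfl fun l _ => ?_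
    simp only [RCLike.inner_apply, conj_trivial]; ring
  simp_rw [e]
  rw [Finset.sum_comm]
  simp_rw [Finset.sum_comm (s := Finset.range T), ← Finset.mul_sum, h.sum_mul hT]
  rw [EuclideanSpace.real_norm_sq_eq]
  simp [Finset.mul_sum]
  exact Finset.sum_congr rfl fun k _ => by ring

end IsPCA

/-- **Consistency of principal components**, as a statement about one sample: if the factors and
the loadings are well conditioned and the errors are small, then the estimates `g t` agree with
the factors up to a rotation and an error `ρ t` that is controlled by `crossError`. The map `A` is
the adjoint of the rotation. -/
theorem IsPCA.exists_rotation {N T : ℕ} {ω : Ω} {g : ℕ → EuclideanSpace ℝ (Fin d)}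
    (h : M.IsPCA N T ω g) (hN : 0 < N) (hT : 0 < T) {cF CF cL κ : ℝ} (hcF : 0 < cF) (hCF : 0 < CF)
    (hcL : 0 < cL) (hκ : κ = cL * cF ^ 2 / (4 * CF))
    (hF1 : ∀ a, cF * T * ‖a‖ ^ 2 ≤ ∑ t ∈ Finset.range T, (inner ℝ (M.f t ω) a) ^ 2)
    (hF2 : ∑ t ∈ Finset.range T, ‖M.f t ω‖ ^ 2 ≤ CF * T)
    (hL : ∀ a, cL * N * ‖a‖ ^ 2 ≤ ∑ i ∈ Finset.range N, (inner ℝ (M.lam i ω) a) ^ 2)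
    (hD : M.factorError N T ω ≤ cL * cF ^ 2 / 4 * N * T ^ 2)
    (hR : d / κ ^ 2 * ∑ t ∈ Finset.range T, M.crossError N T t ω ≤ T / 4) :
    ∃ (A : EuclideanSpace ℝ (Fin d) ≃ₗ[ℝ] EuclideanSpace ℝ (Fin d))
      (ρ : ℕ → EuclideanSpace ℝ (Fin d)), ∀ t < T,
        (∀ b, inner ℝ b (g t) = inner ℝ (A b) (M.f t ω + ρ t)) ∧
        ‖ρ t‖ ^ 2 ≤ 4 * CF * (d / κ ^ 2) * M.crossError N T t ω := by
  have hN' : (0 : ℝ) < N := by exact_mod_cast hN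
  have hT' : (0 : ℝ) < T := by exact_mod_cast hT
  have hκ0 : 0 < κ := by rw [hκ]; positivity
  obtain ⟨hd, heig, -⟩ := id h
  set V : Fin d → ℝ := fun k => (M.gram_isHermitian N T ω).eigenvalues₀ (Fin.castLE hd k) with hV
  -- the test space `{(⟪f t, a⟫)_t}` bounds the leading eigenvalues from below
  have hVκ : ∀ k, κ ≤ V k := by
    let L : EuclideanSpace ℝ (Fin d) →ₗ[ℝ] EuclideanSpace ℝ (Fin T) :=
      (WithLp.linearEquiv 2 ℝ (Fin T → ℝ)).symm.toLinearMap ∘ₗ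
        LinearMap.pi fun t : Fin T => (innerSL ℝ (M.f t ω)).toLinearMap
    have hLap : ∀ a (t : Fin T), L a t = inner ℝ (M.f t ω) a := fun a t => by simp [L]
    have hLn : ∀ a, ‖L a‖ ^ 2 = ∑ t ∈ Finset.range T, (inner ℝ (M.f t ω) a) ^ 2 := fun a => by
      rw [EuclideanSpace.real_norm_sq_eq,
        ← Fin.sum_univ_eq_sum_range (fun t => (inner ℝ (M.f t ω) a) ^ 2)]
      simp only [hLap]
    refine (M.gram_isHermitian N T ω).le_eigenvalues₀ L ?_ ?_ hd
    · rw [injective_iff_map_eq_zero]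
      intro a ha
      have h1 := hF1 a
      rw [← hLn, ha, norm_zero] at h1
      by_contra hne
      have : 0 < ‖a‖ := norm_pos_iff.2 hne
      have : 0 < cF * T * ‖a‖ ^ 2 := by positivity
      norm_num at h1
      linarith
    · intro a
      rw [gram_quadratic]
      set w := ∑ t ∈ Finset.range T, inner ℝ (M.f t ω) a • M.f t ω with hw
      have hsplit : ∀ i : ℕ, ∑ t : Fin T, M.x i t ω * L a t = inner ℝ (M.lam i ω) w +
          inner ℝ (∑ t ∈ Finset.range T, M.e i t ω • M.f t ω) a := by
        intro i
        simp only [hLap]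
        rw [Fin.sum_univ_eq_sum_range (fun t => M.x i t ω * inner ℝ (M.f t ω) a), hw, inner_sum,
          sum_inner, ← Finset.sum_add_distrib]
        refine Finset.sum_congr rfl fun t _ => ?_
        rw [inner_smul_left, inner_smul_right, x]
        simp only [conj_trivial]; ring
      rw [Fin.sum_univ_eq_sum_range (fun i => (∑ t : Fin T, M.x i t ω * L a t) ^ 2)]
      simp only [hsplit]
      have hwa : inner ℝ w a = ‖L a‖ ^ 2 := by
        rw [hLn, hw, sum_inner]
        refine Finset.sum_congr rfl fun t _ => ?_
        rw [inner_smul_left]; simp only [conj_trivial]; ring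
      have hwn : (cF * T * ‖a‖) ^ 2 ≤ ‖w‖ ^ 2 := by
        rcases (norm_nonneg a).eq_or_lt with h0 | hpos
        · rw [← h0]; simp
        · have h1 := real_inner_le_norm w a
          rw [hwa] at h1
          have h2 := hF1 a
          rw [← hLn] at h2
          have : cF * T * ‖a‖ ≤ ‖w‖ := by
            have : cF * T * ‖a‖ * ‖a‖ ≤ ‖w‖ * ‖a‖ := by nlinarith
            exact le_of_mul_le_mul_right this hpos
          exact pow_le_pow_left₀ (by positivity) this 2
      -- `(x + y)² ≥ x² / 2 - y²`
      have hlow : ∑ i ∈ Finset.range N, (inner ℝ (M.lam i ω) w +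
          inner ℝ (∑ t ∈ Finset.range T, M.e i t ω • M.f t ω) a) ^ 2 ≥
          (1 / 2) * ∑ i ∈ Finset.range N, (inner ℝ (M.lam i ω) w) ^ 2 -
            M.factorError N T ω * ‖a‖ ^ 2 := by
        rw [factorError, Finset.sum_mul, Finset.mul_sum, ← Finset.sum_sub_distrib]
        refine Finset.sum_le_sum fun i _ => ?_
        set q := ∑ t ∈ Finset.range T, M.e i t ω • M.f t ω
        have h1 : (inner ℝ q a) ^ 2 ≤ ‖q‖ ^ 2 * ‖a‖ ^ 2 := by
          rw [← mul_pow, ← sq_abs]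
          exact pow_le_pow_left₀ (abs_nonneg _) (abs_real_inner_le_norm _ _) 2
        nlinarith [sq_nonneg (inner ℝ (M.lam i ω) w + 2 * inner ℝ q a)]
      have hup : ‖L a‖ ^ 2 ≤ CF * T * ‖a‖ ^ 2 := by
        rw [hLn]
        calc _ ≤ ∑ t ∈ Finset.range T, ‖M.f t ω‖ ^ 2 * ‖a‖ ^ 2 := by
              refine Finset.sum_le_sum fun t _ => ?_
              rw [← mul_pow, ← sq_abs]
              exact pow_le_pow_left₀ (abs_nonneg _) (abs_real_inner_le_norm _ _) 2
          _ ≤ _ := by rw [← Finset.sum_mul]; gcongr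
      have hl := hL w
      have e1 : cL * N * (cF * T * ‖a‖) ^ 2 ≤ cL * N * ‖w‖ ^ 2 :=
        mul_le_mul_of_nonneg_left hwn (by positivity)
      have e2 := mul_le_mul_of_nonneg_right hD (sq_nonneg ‖a‖)
      have e3 : cL * cF ^ 2 / 4 * N * T ^ 2 * ‖a‖ ^ 2 ≤ ∑ i ∈ Finset.range N,
          (inner ℝ (M.lam i ω) w +
          inner ℝ (∑ t ∈ Finset.range T, M.e i t ω • M.f t ω) a) ^ 2 := by
        refine le_trans ?_ hlow
        linarith
      rw [inv_mul_eq_div, le_div_iff₀ (by positivity)]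
      refine le_trans ?_ e3
      calc κ * ‖L a‖ ^ 2 * (N * T) ≤ κ * (CF * T * ‖a‖ ^ 2) * (N * T) := by gcongr
        _ = _ := by rw [hκ]; field_simp
  have hV0 : ∀ k, 0 < V k := fun k => hκ0.trans_le (hVκ k)
  -- the eigenvalue equation, row by row
  have heq : ∀ t < T, ∀ k, V k * g t k = ((N : ℝ) * T)⁻¹ *
      ∑ s ∈ Finset.range T, (∑ i ∈ Finset.range N, M.x i t ω * M.x i s ω) * g s k := by
    intro t ht k
    have := congrFun (congrFun heig ⟨t, ht⟩) k
    rw [Matrix.mul_diagonal] at this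
    simp only [Matrix.of_apply, Matrix.mul_apply, gram, Matrix.smul_apply, smul_eq_mul,
      dataMatrix, Matrix.transpose_apply] at this
    rw [mul_comm, hV]
    simp only
    rw [← this, ← Fin.sum_univ_eq_sum_range
      (fun s => (∑ i ∈ Finset.range N, M.x i t ω * M.x i s ω) * g s k), Finset.mul_sum]
    refine Finset.sum_congr rfl fun s _ => ?_
    rw [← Fin.sum_univ_eq_sum_range (fun i => M.x i t ω * M.x i s ω)]
    ring
  -- the rotation, and the part of the estimate that is due to the errors of period `t`
  let H : EuclideanSpace ℝ (Fin d) →ₗ[ℝ] EuclideanSpace ℝ (Fin d) :=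
    (WithLp.linearEquiv 2 ℝ (Fin d → ℝ)).symm.toLinearMap ∘ₗ
      LinearMap.pi fun k : Fin d => ((V k)⁻¹ * ((N : ℝ) * T)⁻¹) •
        ∑ s ∈ Finset.range T, g s k • ∑ i ∈ Finset.range N,
          M.x i s ω • (innerSL ℝ (M.lam i ω)).toLinearMap
  let r : ℕ → EuclideanSpace ℝ (Fin d) := fun t => WithLp.toLp 2 fun k =>
    ((V k)⁻¹ * ((N : ℝ) * T)⁻¹) *
      ∑ s ∈ Finset.range T, g s k * ∑ i ∈ Finset.range N, M.e i t ω * M.x i s ω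
  have hHap : ∀ u k, H u k = ((V k)⁻¹ * ((N : ℝ) * T)⁻¹) * ∑ s ∈ Finset.range T,
      g s k * ∑ i ∈ Finset.range N, M.x i s ω * inner ℝ (M.lam i ω) u := fun u k => by
    simp [H, LinearMap.sum_apply]
  have hdec : ∀ t < T, g t = H (M.f t ω) + r t := by
    intro t ht
    ext k
    have h1 := heq t ht k
    have h2 : g t k = (V k)⁻¹ * (V k * g t k) := by rw [inv_mul_cancel_left₀ (hV0 k).ne']
    rw [h2, h1, PiLp.add_apply, hHap]
    simp only [r]
    rw [← mul_add, ← Finset.sum_add_distrib, mul_assoc]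
    congr 2
    refine Finset.sum_congr rfl fun s _ => ?_
    rw [← mul_add, ← Finset.sum_add_distrib, mul_comm]
    congr 1
    refine Finset.sum_congr rfl fun i _ => ?_
    rw [x, x]; ring
  have hr : ∀ t, ‖r t‖ ^ 2 ≤ d / κ ^ 2 * M.crossError N T t ω := by
    intro t
    rw [EuclideanSpace.real_norm_sq_eq]
    have hk : ∀ k, (r t k) ^ 2 ≤ (κ ^ 2)⁻¹ * M.crossError N T t ω := by
      intro k
      have hcs := Finset.sum_mul_sq_le_sq_mul_sq (Finset.range T) (fun s => g s k)
        (fun s => (N : ℝ)⁻¹ * ∑ i ∈ Finset.range N, M.e i t ω * M.x i s ω)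
      have hg : ∑ s ∈ Finset.range T, g s k ^ 2 = T := by
        have := h.sum_mul hT k k
        simpa [sq] using this
      rw [hg] at hcs
      have e : r t k = (V k)⁻¹ * ((T : ℝ)⁻¹ * ∑ s ∈ Finset.range T, g s k *
          ((N : ℝ)⁻¹ * ∑ i ∈ Finset.range N, M.e i t ω * M.x i s ω)) := by
        simp only [r]
        simp only [Finset.mul_sum]
        exact Finset.sum_congr rfl fun s _ => Finset.sum_congr rfl fun i _ => by ring
      rw [e, mul_pow, mul_pow]
      have hVi : ((V k)⁻¹) ^ 2 ≤ (κ ^ 2)⁻¹ := by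
        rw [inv_pow]
        exact inv_anti₀ (by positivity) (pow_le_pow_left₀ hκ0.le (hVκ k) 2)
      refine mul_le_mul hVi ?_ (by positivity) (by positivity)
      rw [crossError]
      calc _ ≤ ((T : ℝ)⁻¹) ^ 2 * (T * ∑ s ∈ Finset.range T,
              ((N : ℝ)⁻¹ * ∑ i ∈ Finset.range N, M.e i t ω * M.x i s ω) ^ 2) := by gcongr
        _ = _ := by field_simp
    refine (Finset.sum_le_sum fun k _ => hk k).trans (le_of_eq ?_)
    rw [Finset.sum_const, Finset.card_univ, Fintype.card_fin, nsmul_eq_mul]; ring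
  -- the estimates are normalized in every direction, and little of this is due to `r`; hence the
  -- adjoint of `H` is bounded below, and `H` is invertible
  have hadj : ∀ a, ‖a‖ ^ 2 ≤ 4 * CF * ‖LinearMap.adjoint H a‖ ^ 2 := by
    intro a
    have h1 := h.sum_inner_sq hT a
    have h2 : ∀ t ∈ Finset.range T, (inner ℝ (g t) a) ^ 2 ≤
        2 * (‖M.f t ω‖ ^ 2 * ‖LinearMap.adjoint H a‖ ^ 2) +
          2 * (d / κ ^ 2 * M.crossError N T t ω * ‖a‖ ^ 2) := by
      intro t ht
      rw [hdec t (Finset.mem_range.1 ht), inner_add_left, ← LinearMap.adjoint_inner_right]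
      have b1 : (inner ℝ (M.f t ω) (LinearMap.adjoint H a)) ^ 2 ≤
          ‖M.f t ω‖ ^ 2 * ‖LinearMap.adjoint H a‖ ^ 2 := by
        rw [← mul_pow, ← sq_abs]
        exact pow_le_pow_left₀ (abs_nonneg _) (abs_real_inner_le_norm _ _) 2
      have b2 : (inner ℝ (r t) a) ^ 2 ≤ d / κ ^ 2 * M.crossError N T t ω * ‖a‖ ^ 2 := by
        refine le_trans ?_ (mul_le_mul_of_nonneg_right (hr t) (sq_nonneg _))
        rw [← mul_pow, ← sq_abs]
        exact pow_le_pow_left₀ (abs_nonneg _) (abs_real_inner_le_norm _ _) 2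
      nlinarith [sq_nonneg (inner ℝ (M.f t ω) (LinearMap.adjoint H a) - inner ℝ (r t) a)]
    have h3 := Finset.sum_le_sum h2
    rw [h1, Finset.sum_add_distrib, ← Finset.mul_sum, ← Finset.mul_sum, ← Finset.sum_mul,
      ← Finset.sum_mul, ← Finset.mul_sum] at h3
    have h4 := mul_le_mul_of_nonneg_right hF2 (sq_nonneg ‖LinearMap.adjoint H a‖)
    have h5 := mul_le_mul_of_nonneg_right hR (sq_nonneg ‖a‖)
    have h6 : (T : ℝ) * ‖a‖ ^ 2 ≤ T * (4 * CF * ‖LinearMap.adjoint H a‖ ^ 2) := by nlinarith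
    exact le_of_mul_le_mul_left h6 hT'
  have hinj : Function.Injective (LinearMap.adjoint H) := by
    rw [injective_iff_map_eq_zero]
    intro a ha
    have := hadj a
    rw [ha, norm_zero] at this
    have h0 : ‖a‖ ^ 2 = 0 := le_antisymm (by simpa using this) (sq_nonneg _)
    simpa using h0
  let A := LinearEquiv.ofInjectiveEndo (LinearMap.adjoint H) hinj
  have hA : ∀ a, A a = LinearMap.adjoint H a := fun a => rfl
  refine ⟨A, fun t => LinearMap.adjoint A.symm.toLinearMap (r t), fun t ht => ⟨fun b => ?_, ?_⟩⟩
  · rw [hdec t ht, inner_add_right, inner_add_right, LinearMap.adjoint_inner_right, hA,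
      LinearMap.adjoint_inner_left]
    congr 1
    rw [← hA]; simp
  · set q := LinearMap.adjoint A.symm.toLinearMap (r t) with hq
    have h1 : ‖q‖ ^ 2 ≤ ‖A.symm q‖ * ‖r t‖ := by
      rw [← real_inner_self_eq_norm_sq]
      nth_rewrite 2 [hq]
      rw [LinearMap.adjoint_inner_right]
      exact real_inner_le_norm _ _
    have h2 : ‖A.symm q‖ ^ 2 ≤ 4 * CF * ‖q‖ ^ 2 := by
      have := hadj (A.symm q)
      rwa [← hA, LinearEquiv.apply_symm_apply] at this
    have h3 : (‖q‖ ^ 2) ^ 2 ≤ 4 * CF * ‖q‖ ^ 2 * ‖r t‖ ^ 2 := by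
      calc _ ≤ (‖A.symm q‖ * ‖r t‖) ^ 2 := pow_le_pow_left₀ (sq_nonneg _) h1 2
        _ = ‖A.symm q‖ ^ 2 * ‖r t‖ ^ 2 := mul_pow _ _ _
        _ ≤ _ := mul_le_mul_of_nonneg_right h2 (sq_nonneg _)
    have h4 : ‖q‖ ^ 2 ≤ 4 * CF * ‖r t‖ ^ 2 := by
      rcases (sq_nonneg ‖q‖).eq_or_lt with h0 | hpos
      · rw [← h0]; positivity
      · have : ‖q‖ ^ 2 * ‖q‖ ^ 2 ≤ ‖q‖ ^ 2 * (4 * CF * ‖r t‖ ^ 2) := by nlinarith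
        exact le_of_mul_le_mul_left this hpos
    refine h4.trans ?_
    rw [mul_assoc (4 * CF)]
    exact mul_le_mul_of_nonneg_left (hr t) (by positivity)

end FactorBinaryModel

/-! ### The maximum likelihood estimator with estimated regressors -/

/-- The positive part, capped at one. -/
def ramp (v : ℝ) : ℝ := min (max v 0) 1

theorem ramp_nonneg (v : ℝ) : 0 ≤ ramp v := le_min (le_max_right _ _) zero_le_one

theorem ramp_le_one (v : ℝ) : ramp v ≤ 1 := min_le_right _ _

theorem abs_ramp_sub_le (v v' : ℝ) : |ramp v - ramp v'| ≤ |v - v'| := by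
  unfold ramp
  exact (abs_min_sub_min_le_max _ _ _ _).trans
    (max_le ((abs_max_sub_max_le_max _ _ _ _).trans (by simp)) (by simp))

theorem pos_of_ramp_pos {v x : ℝ} (hx : 0 ≤ x) (h : x < ramp v) : x < v := by
  unfold ramp at h
  have := (lt_min_iff.1 h).1
  rcases lt_max_iff.1 this with h | h
  · exact h
  · linarith

/-- Twice one minus the square root of the likelihood ratio `q_y(v) / q_y(u)`, where `q_y(u)` is
bounded away from zero artificially. Its mean over `y` is the squared Hellinger distance. -/
def hellinger (Φ : ℝ → ℝ) (κ y u v : ℝ) : ℝ :=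
  2 * (1 - Real.exp (logLikTerm Φ y v / 2) / √(max κ (Real.exp (logLikTerm Φ y u))))

/-- The part of `‖z‖²` above the level `K`. -/
def tailSq {E : Type*} [NormedAddCommGroup E] (K : ℝ) (z : E) : ℝ :=
  if K < ‖z‖ then ‖z‖ ^ 2 else 0

namespace FactorBinaryModel

namespace LikelihoodAssumptions

variable {Ω : Type*} {p d : ℕ} [mΩ : MeasurableSpace Ω] {M : FactorBinaryModel Ω p d}
  {P : Measure Ω} [IsProbabilityMeasure P] {Ξl Ξu : ℕ → ℝ} {c B bL bU : ℝ}
  {E : Type*} [NormedAddCommGroup E] [InnerProductSpace ℝ E]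

/-- A mean square error of `σ²` bounds the mean error by `σ`. -/
theorem sum_norm_le {n : ℕ} {ρ : ℕ → E} {σ : ℝ} (hσ : 0 < σ)
    (h7 : ∑ t ∈ Finset.range n, ‖ρ t‖ ^ 2 ≤ n * σ ^ 2) :
    ∑ t ∈ Finset.range n, ‖ρ t‖ ≤ n * σ := by
  have h1 : ∀ t ∈ Finset.range n, ‖ρ t‖ ≤ σ / 2 + ‖ρ t‖ ^ 2 / (2 * σ) := fun t _ => by
    have : 0 ≤ (‖ρ t‖ - σ) ^ 2 / (2 * σ) := by positivity
    have e : (‖ρ t‖ - σ) ^ 2 / (2 * σ) = σ / 2 + ‖ρ t‖ ^ 2 / (2 * σ) - ‖ρ t‖ := by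
      field_simp; ring
    linarith
  refine (Finset.sum_le_sum h1).trans ?_
  rw [Finset.sum_add_distrib, ← Finset.sum_div (f := fun t => ‖ρ t‖ ^ 2)]
  have : (∑ t ∈ Finset.range n, ‖ρ t‖ ^ 2) / (2 * σ) ≤ n * σ ^ 2 / (2 * σ) := by gcongr
  have e : (n : ℝ) * σ ^ 2 / (2 * σ) = n * (σ / 2) := by field_simp
  simp only [Finset.sum_const, Finset.card_range, nsmul_eq_mul]
  linarith

/-- Replacing the regressors by their estimates changes the log-likelihood at the true parameter
little. -/
theorem loglik_true_ge (h : M.LikelihoodAssumptions P Ξl Ξu c B bL bU) {n T : ℕ} {y : ℕ → ℝ}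
    (hy : ∀ t, y t ∈ ({0, 1} : Set ℝ)) {z ρ : ℕ → E} {β : E} {σ : ℝ} (hσ : 0 < σ)
    (hu : ∀ t < n, inner ℝ β (z t) ∈ Set.Icc (Ξl T) (Ξu T))
    (h7 : ∑ t ∈ Finset.range n, ‖ρ t‖ ^ 2 ≤ n * σ ^ 2) :
    ∑ t ∈ Finset.range n, logLikTerm (M.Phi P) (y t) (inner ℝ β (z t)) -
        n * (B * ‖β‖ * σ + B * ‖β‖ ^ 2 * σ ^ 2) ≤
      ∑ t ∈ Finset.range n, logLikTerm (M.Phi P) (y t) (inner ℝ β (z t + ρ t)) := by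
  have hB := h.B_nonneg
  have key : ∀ t ∈ Finset.range n, logLikTerm (M.Phi P) (y t) (inner ℝ β (z t)) -
      (B * ‖β‖ * ‖ρ t‖ + B * ‖β‖ ^ 2 * ‖ρ t‖ ^ 2) ≤
      logLikTerm (M.Phi P) (y t) (inner ℝ β (z t + ρ t)) := by
    intro t ht
    set l := logLikTerm (M.Phi P) (y t) with hl
    have hc : ContDiff ℝ 2 l := h.contDiff_two (hy t)
    have h1 := le_quadratic_of_deriv_deriv_le (l := fun x => -l x) hc.neg
      (x := inner ℝ β (z t)) (v := inner ℝ β (ρ t)) (m := B) (fun s _ => by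
        rw [deriv.fun_neg', deriv.fun_neg]
        exact (neg_le_abs _).trans (h.abs_deriv_deriv_le (hy t) _))
    rw [deriv.fun_neg] at h1
    have h2 := h.l_deriv_one (y t) (hy t) T _ (hu t (Finset.mem_range.1 ht))
    have h3 : |inner ℝ β (ρ t)| ≤ ‖β‖ * ‖ρ t‖ := abs_real_inner_le_norm _ _
    have h4 : -deriv l (inner ℝ β (z t)) * inner ℝ β (ρ t) ≤ B * (‖β‖ * ‖ρ t‖) := by
      refine (le_abs_self _).trans ?_
      rw [abs_mul, abs_neg]
      exact mul_le_mul h2 h3 (abs_nonneg _) hB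
    have h5 : (inner ℝ β (ρ t)) ^ 2 ≤ (‖β‖ * ‖ρ t‖) ^ 2 := by
      rw [← sq_abs]; exact pow_le_pow_left₀ (abs_nonneg _) h3 2
    have h6 := mul_le_mul_of_nonneg_left h5 (by positivity : 0 ≤ B / 2)
    have h7 : 0 ≤ B * (‖β‖ * ‖ρ t‖) ^ 2 := by positivity
    rw [inner_add_right]
    rw [mul_pow] at h6 h7
    linarith
  refine le_trans ?_ (Finset.sum_le_sum key)
  rw [Finset.sum_sub_distrib, Finset.sum_add_distrib, ← Finset.mul_sum, ← Finset.mul_sum]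
  have h1 := mul_le_mul_of_nonneg_left (sum_norm_le hσ h7) (by positivity : 0 ≤ B * ‖β‖)
  have h2 := mul_le_mul_of_nonneg_left h7 (by positivity : 0 ≤ B * ‖β‖ ^ 2)
  linarith

/-- The Hellinger loss is Lipschitz in the index, because the square root of the likelihood is. -/
theorem hellinger_lipschitz (h : M.LikelihoodAssumptions P Ξl Ξu c B bL bU) {y κ : ℝ}
    (hy : y ∈ ({0, 1} : Set ℝ)) (hκ : 0 < κ) (u v v' : ℝ) :
    |hellinger (M.Phi P) κ y u v - hellinger (M.Phi P) κ y u v'| ≤ 2 * √B / √κ * |v - v'| := by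
  unfold hellinger
  set D := √(max κ (Real.exp (logLikTerm (M.Phi P) y u))) with hD
  have hκ' : 0 < √κ := Real.sqrt_pos.2 hκ
  have hDκ : √κ ≤ D := Real.sqrt_le_sqrt (le_max_left _ _)
  have hD0 : 0 < D := hκ'.trans_le hDκ
  have h1 := h.sqrt_lik_lipschitz hy v' v
  set a := Real.exp (logLikTerm (M.Phi P) y v / 2)
  set a' := Real.exp (logLikTerm (M.Phi P) y v' / 2)
  have e : 2 * (1 - a / D) - 2 * (1 - a' / D) = 2 * ((a' - a) / D) := by ring
  rw [e, abs_mul, abs_div, abs_of_pos hD0, abs_two, abs_sub_comm v v']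
  calc 2 * (|a' - a| / D) ≤ 2 * (√B * |v' - v| / √κ) := by gcongr
    _ = _ := by ring

/-- The Hellinger loss is bounded: this is why its denominator is bounded away from zero. -/
theorem abs_hellinger_le (h : M.LikelihoodAssumptions P Ξl Ξu c B bL bU) {y κ : ℝ}
    (hy : y ∈ ({0, 1} : Set ℝ)) (hκ : 0 < κ) (u v : ℝ) :
    |hellinger (M.Phi P) κ y u v| ≤ 2 * (1 + 1 / √κ) := by
  unfold hellinger
  set D := √(max κ (Real.exp (logLikTerm (M.Phi P) y u))) with hD
  have hκ' : 0 < √κ := Real.sqrt_pos.2 hκ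
  have hDκ : √κ ≤ D := Real.sqrt_le_sqrt (le_max_left _ _)
  have h1 : Real.exp (logLikTerm (M.Phi P) y v / 2) ≤ 1 := by
    rw [Real.exp_le_one_iff]; linarith [h.logLikTerm_nonpos hy v]
  have h2 : Real.exp (logLikTerm (M.Phi P) y v / 2) / D ≤ 1 / √κ := by gcongr
  have h3 : 0 ≤ Real.exp (logLikTerm (M.Phi P) y v / 2) / D := by positivity
  rw [abs_le]
  constructor <;> linarith

/-- A log-likelihood ratio is at most minus the Hellinger loss. -/
theorem logLikTerm_sub_le (h : M.LikelihoodAssumptions P Ξl Ξu c B bL bU)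
    (hε : Measurable (M.ε 0)) {T : ℕ} {y u : ℝ} (hy : y ∈ ({0, 1} : Set ℝ))
    (hu : u ∈ Set.Icc (Ξl T) (Ξu T)) (v : ℝ) :
    logLikTerm (M.Phi P) y v - logLikTerm (M.Phi P) y u ≤
      -hellinger (M.Phi P) (c ^ 2 / B) y u v := by
  unfold hellinger
  rw [max_eq_right (h.lik_lower hε T hu hy), ← Real.exp_half, ← Real.exp_sub]
  have := Real.add_one_le_exp (logLikTerm (M.Phi P) y v / 2 - logLikTerm (M.Phi P) y u / 2)
  linarith

/-- Parameters in a bounded region that is separated from the truth. -/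
theorem loglik_mid_le (h : M.LikelihoodAssumptions P Ξl Ξu c B bL bU)
    (hε : Measurable (M.ε 0)) {n T : ℕ} {y : ℕ → ℝ}
    (hy : ∀ t, y t ∈ ({0, 1} : Set ℝ)) {z ρ : ℕ → E} {β θ : E} {σ R c₃ : ℝ} (hσ : 0 < σ)
    (hu : ∀ t < n, inner ℝ β (z t) ∈ Set.Icc (Ξl T) (Ξu T))
    (h7 : ∑ t ∈ Finset.range n, ‖ρ t‖ ^ 2 ≤ n * σ ^ 2) (hR : ‖θ‖ ≤ R)
    (h5 : c₃ * n ≤ ∑ t ∈ Finset.range n,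
      hellinger (M.Phi P) (c ^ 2 / B) (y t) (inner ℝ β (z t)) (inner ℝ θ (z t))) :
    ∑ t ∈ Finset.range n, logLikTerm (M.Phi P) (y t) (inner ℝ θ (z t + ρ t)) ≤
      ∑ t ∈ Finset.range n, logLikTerm (M.Phi P) (y t) (inner ℝ β (z t)) -
        n * (c₃ - 2 * √B / √(c ^ 2 / B) * R * σ) := by
  have hκ : 0 < c ^ 2 / B := div_pos (pow_pos h.c_pos 2) h.B_pos
  have hR0 : 0 ≤ R := (norm_nonneg _).trans hR
  set Lψ := 2 * √B / √(c ^ 2 / B) with hLψ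
  have hLψ0 : 0 ≤ Lψ := by positivity
  have key : ∀ t ∈ Finset.range n, logLikTerm (M.Phi P) (y t) (inner ℝ θ (z t + ρ t)) ≤
      logLikTerm (M.Phi P) (y t) (inner ℝ β (z t)) -
      hellinger (M.Phi P) (c ^ 2 / B) (y t) (inner ℝ β (z t)) (inner ℝ θ (z t)) +
      Lψ * R * ‖ρ t‖ := by
    intro t ht
    have h1 := h.logLikTerm_sub_le hε (hy t) (hu t (Finset.mem_range.1 ht))
      (inner ℝ θ (z t + ρ t))
    have h2 := h.hellinger_lipschitz (hy t) hκ (inner ℝ β (z t)) (inner ℝ θ (z t))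
      (inner ℝ θ (z t + ρ t))
    have h3 : |inner ℝ θ (z t) - inner ℝ θ (z t + ρ t)| ≤ R * ‖ρ t‖ := by
      rw [inner_add_right, sub_add_cancel_left, abs_neg]
      exact (abs_real_inner_le_norm _ _).trans (by gcongr)
    have h4 := (le_abs_self _).trans (h2.trans (mul_le_mul_of_nonneg_left h3 hLψ0))
    linarith
  refine (Finset.sum_le_sum key).trans ?_
  rw [Finset.sum_add_distrib, Finset.sum_sub_distrib, ← Finset.mul_sum]
  have := mul_le_mul_of_nonneg_left (sum_norm_le hσ h7) (mul_nonneg hLψ0 hR0)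
  linarith

/-- Parameters far away from the truth: a positive fraction of the observations contradicts the
prediction of any large parameter. -/
theorem loglik_far_le (h : M.LikelihoodAssumptions P Ξl Ξu c B bL bU) {n : ℕ} {y : ℕ → ℝ}
    (hy : ∀ t, y t ∈ ({0, 1} : Set ℝ)) {z ρ : ℕ → E} {θ : E} {σ c₂ A V : ℝ} (hσ : 0 < σ)
    (hA : 0 ≤ A) (hc₂ : 0 < c₂) (hV : 0 < V)
    (hV0 : ∀ x, V ≤ x → logLikTerm (M.Phi P) 0 x ≤ -A)
    (hV1 : ∀ x, x ≤ -V → logLikTerm (M.Phi P) 1 x ≤ -A)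
    (h7 : ∑ t ∈ Finset.range n, ‖ρ t‖ ^ 2 ≤ n * σ ^ 2) (hσ4 : σ ≤ c₂ / 2)
    (hθ : 4 * V / c₂ ≤ ‖θ‖)
    (h4 : ∀ a : E, ‖a‖ = 1 → c₂ * n ≤ ∑ t ∈ Finset.range n,
      ((1 - y t) * ramp (inner ℝ a (z t)) + y t * ramp (-inner ℝ a (z t)))) :
    ∑ t ∈ Finset.range n, logLikTerm (M.Phi P) (y t) (inner ℝ θ (z t + ρ t)) ≤
      -(A * (c₂ / 4) * n) := by
  have hθ0 : 0 < ‖θ‖ := lt_of_lt_of_le (by positivity) hθ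
  set a := ‖θ‖⁻¹ • θ with ha
  have ha1 : ‖a‖ = 1 := by rw [ha, norm_smul, norm_inv, norm_norm, inv_mul_cancel₀ hθ0.ne']
  have hθa : θ = ‖θ‖ • a := by rw [ha, smul_inv_smul₀ hθ0.ne']
  have hVθ : V ≤ ‖θ‖ * (c₂ / 4) := by
    rw [div_le_iff₀ hc₂] at hθ; linarith
  -- `w' t` measures by how much the direction `a` predicts the wrong outcome in period `t`
  set w' : ℕ → ℝ := fun t => (1 - y t) * ramp (inner ℝ a (z t + ρ t)) +
    y t * ramp (-inner ℝ a (z t + ρ t)) with hw'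
  have key : ∀ t ∈ Finset.range n,
      logLikTerm (M.Phi P) (y t) (inner ℝ θ (z t + ρ t)) ≤ -A * (w' t - c₂ / 4) := by
    intro t _
    have h0 := h.logLikTerm_nonpos (hy t) (inner ℝ θ (z t + ρ t))
    have hin : inner ℝ θ (z t + ρ t) = ‖θ‖ * inner ℝ a (z t + ρ t) := by
      nth_rewrite 1 [hθa]; rw [real_inner_smul_left]
    have hA' : -A ≤ -A * (w' t - c₂ / 4) := by
      have : w' t ≤ 1 := by
        simp only [hw']
        rcases hy t with e | e
        · rw [e]; simpa using ramp_le_one _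
        · rw [Set.mem_singleton_iff.1 e]; simpa using ramp_le_one _
      nlinarith
    rcases le_or_gt (w' t) (c₂ / 4) with hle | hlt
    · nlinarith
    · refine le_trans ?_ hA'
      simp only [hw'] at hlt
      rcases hy t with e | e
      · rw [e] at hlt ⊢
        have : c₂ / 4 < inner ℝ a (z t + ρ t) :=
          pos_of_ramp_pos (by positivity) (by simpa using hlt)
        refine hV0 _ (hVθ.trans ?_)
        rw [hin]; gcongr
      · rw [Set.mem_singleton_iff.1 e] at hlt ⊢
        have : c₂ / 4 < -inner ℝ a (z t + ρ t) :=
          pos_of_ramp_pos (by positivity) (by simpa using hlt)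
        refine hV1 _ ?_
        rw [hin]
        have := mul_le_mul_of_nonneg_left this.le hθ0.le
        linarith
  have hww : ∀ t ∈ Finset.range n, (1 - y t) * ramp (inner ℝ a (z t)) +
      y t * ramp (-inner ℝ a (z t)) ≤ w' t + ‖ρ t‖ := by
    intro t _
    have hb : |inner ℝ a (ρ t)| ≤ ‖ρ t‖ := by
      simpa [ha1] using abs_real_inner_le_norm a (ρ t)
    simp only [hw']
    rcases hy t with e | e
    · rw [e]
      have := (le_abs_self _).trans (abs_ramp_sub_le (inner ℝ a (z t)) (inner ℝ a (z t + ρ t)))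
      rw [inner_add_right, sub_add_cancel_left, abs_neg] at this
      rw [inner_add_right]
      linarith
    · rw [Set.mem_singleton_iff.1 e]
      have := (le_abs_self _).trans (abs_ramp_sub_le (-inner ℝ a (z t)) (-inner ℝ a (z t + ρ t)))
      rw [inner_add_right, neg_sub_neg, add_sub_cancel_left] at this
      rw [inner_add_right]
      linarith
  refine (Finset.sum_le_sum key).trans ?_
  rw [← Finset.mul_sum, Finset.sum_sub_distrib]
  have h1 := (h4 a ha1).trans (Finset.sum_le_sum hww)
  rw [Finset.sum_add_distrib] at h1
  have h2 := sum_norm_le hσ h7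
  simp only [Finset.sum_const, Finset.card_range, nsmul_eq_mul]
  have hn : (0 : ℝ) ≤ n := Nat.cast_nonneg n
  have h3 : (n : ℝ) * σ ≤ n * (c₂ / 2) := by gcongr
  have h5 : n * (c₂ / 4) ≤ ∑ t ∈ Finset.range n, w' t - n * (c₂ / 4) := by linarith
  have := mul_le_mul_of_nonneg_left h5 hA
  linarith

/-- The score at the truth, computed from the estimated regressors. -/
theorem norm_score_le (h : M.LikelihoodAssumptions P Ξl Ξu c B bL bU) {n T : ℕ} {y : ℕ → ℝ}
    (hy : ∀ t, y t ∈ ({0, 1} : Set ℝ)) {z ρ : ℕ → E} {β : E} {σ Cz Ks : ℝ} (hσ : 0 < σ)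
    (hσ1 : σ ≤ 1) (hu : ∀ t < n, inner ℝ β (z t) ∈ Set.Icc (Ξl T) (Ξu T))
    (h1 : ∑ t ∈ Finset.range n, ‖z t‖ ^ 2 ≤ Cz * n)
    (h6 : ‖∑ t ∈ Finset.range n,
      deriv (logLikTerm (M.Phi P) (y t)) (inner ℝ β (z t)) • z t‖ ≤ Ks * (n * σ))
    (h7 : ∑ t ∈ Finset.range n, ‖ρ t‖ ^ 2 ≤ n * σ ^ 2) :
    ‖∑ t ∈ Finset.range n,
      deriv (logLikTerm (M.Phi P) (y t)) (inner ℝ β (z t + ρ t)) • (z t + ρ t)‖ ≤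
      (Ks + B * ‖β‖ * (Cz + 2) + B) * (n * σ) := by
  have hB := h.B_nonneg
  set l' : ℕ → ℝ → ℝ := fun t => deriv (logLikTerm (M.Phi P) (y t)) with hl'
  have hdec : ∑ t ∈ Finset.range n, l' t (inner ℝ β (z t + ρ t)) • (z t + ρ t) =
      ∑ t ∈ Finset.range n, l' t (inner ℝ β (z t)) • z t +
      ∑ t ∈ Finset.range n, ((l' t (inner ℝ β (z t + ρ t)) - l' t (inner ℝ β (z t))) •
        (z t + ρ t) + l' t (inner ℝ β (z t)) • ρ t) := by
    rw [← Finset.sum_add_distrib]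
    refine Finset.sum_congr rfl fun t _ => ?_
    rw [sub_smul, smul_add, smul_add]; abel
  have hterm : ∀ t ∈ Finset.range n,
      ‖(l' t (inner ℝ β (z t + ρ t)) - l' t (inner ℝ β (z t))) • (z t + ρ t) +
        l' t (inner ℝ β (z t)) • ρ t‖ ≤
      B * ‖β‖ * (σ / 2 * ‖z t‖ ^ 2 + ‖ρ t‖ ^ 2 / (2 * σ) + ‖ρ t‖ ^ 2) + B * ‖ρ t‖ := by
    intro t ht
    refine (norm_add_le _ _).trans (add_le_add ?_ ?_)
    · rw [norm_smul, Real.norm_eq_abs]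
      have a1 : |l' t (inner ℝ β (z t + ρ t)) - l' t (inner ℝ β (z t))| ≤ B * (‖β‖ * ‖ρ t‖) := by
        refine (h.deriv_lipschitz (hy t) _ _).trans (mul_le_mul_of_nonneg_left ?_ hB)
        rw [inner_add_right, add_sub_cancel_left]
        exact abs_real_inner_le_norm _ _
      have a2 : ‖ρ t‖ * ‖z t + ρ t‖ ≤ σ / 2 * ‖z t‖ ^ 2 + ‖ρ t‖ ^ 2 / (2 * σ) + ‖ρ t‖ ^ 2 := by
        have b1 : ‖ρ t‖ * ‖z t + ρ t‖ ≤ ‖ρ t‖ * (‖z t‖ + ‖ρ t‖) := by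
          gcongr; exact norm_add_le _ _
        have b2 : 0 ≤ (σ * ‖z t‖ - ‖ρ t‖) ^ 2 / (2 * σ) := by positivity
        have e : (σ * ‖z t‖ - ‖ρ t‖) ^ 2 / (2 * σ) =
          σ / 2 * ‖z t‖ ^ 2 + ‖ρ t‖ ^ 2 / (2 * σ) - ‖ρ t‖ * ‖z t‖ := by field_simp; ring
        nlinarith
      calc _ ≤ B * (‖β‖ * ‖ρ t‖) * ‖z t + ρ t‖ := by gcongr
        _ = B * ‖β‖ * (‖ρ t‖ * ‖z t + ρ t‖) := by ring
        _ ≤ _ := by gcongr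
    · rw [norm_smul, Real.norm_eq_abs]
      exact mul_le_mul_of_nonneg_right
        (h.l_deriv_one (y t) (hy t) T _ (hu t (Finset.mem_range.1 ht))) (norm_nonneg _)
  rw [hdec]
  refine (norm_add_le _ _).trans ?_
  have hsum := (norm_sum_le _ _).trans (Finset.sum_le_sum hterm)
  have hR : ∑ t ∈ Finset.range n,
      (B * ‖β‖ * (σ / 2 * ‖z t‖ ^ 2 + ‖ρ t‖ ^ 2 / (2 * σ) + ‖ρ t‖ ^ 2) + B * ‖ρ t‖) =
      B * ‖β‖ * (σ / 2 * ∑ t ∈ Finset.range n, ‖z t‖ ^ 2 +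
        (∑ t ∈ Finset.range n, ‖ρ t‖ ^ 2) / (2 * σ) + ∑ t ∈ Finset.range n, ‖ρ t‖ ^ 2) +
        B * ∑ t ∈ Finset.range n, ‖ρ t‖ := by
    rw [Finset.sum_add_distrib, ← Finset.mul_sum, ← Finset.mul_sum, Finset.sum_add_distrib,
      Finset.sum_add_distrib, ← Finset.mul_sum, ← Finset.sum_div]
  rw [hR] at hsum
  have s1 := sum_norm_le hσ h7
  have hn : (0 : ℝ) ≤ n := Nat.cast_nonneg n
  have s2 : σ / 2 * ∑ t ∈ Finset.range n, ‖z t‖ ^ 2 ≤ Cz * (n * σ) := by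
    have h0 : 0 ≤ ∑ t ∈ Finset.range n, ‖z t‖ ^ 2 := Finset.sum_nonneg fun t _ => sq_nonneg _
    nlinarith
  have s3 : (∑ t ∈ Finset.range n, ‖ρ t‖ ^ 2) / (2 * σ) ≤ n * σ := by
    rw [div_le_iff₀ (by positivity)]
    have : 0 ≤ n * σ ^ 2 := by positivity
    linarith
  have s4 : ∑ t ∈ Finset.range n, ‖ρ t‖ ^ 2 ≤ n * σ := by
    refine h7.trans (mul_le_mul_of_nonneg_left ?_ hn)
    nlinarith
  have s5 := mul_le_mul_of_nonneg_left (add_le_add (add_le_add s2 s3) s4)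
    (by positivity : 0 ≤ B * ‖β‖)
  have s6 := mul_le_mul_of_nonneg_left s1 hB
  linarith

/-- The second order term of an observation at which the log-likelihood is concave. Here `x` and `w`
are the components of the regressor and of its error in the direction considered. -/
theorem quadratic_le_of_concave {bL B x w m r τ X : ℝ} (hbL : 0 ≤ bL) (hB : 0 ≤ B)
    (h : x ^ 2 / 2 - w ^ 2 ≤ (x + w) ^ 2) (hw : w ^ 2 ≤ r ^ 2) (hm : m ≤ x ^ 2) (hτ : 0 ≤ τ)
    (hr : 0 ≤ r ^ 2) (hX : 0 ≤ X * r ^ 2) :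
    -(bL / 2) / 2 * (x + w) ^ 2 ≤ -(bL / 8) * m + (bL + B) * (τ + (X + 1) * r ^ 2) := by
  have h1 := mul_le_mul_of_nonneg_left h hbL
  have h2 := mul_le_mul_of_nonneg_left hw hbL
  have h3 := mul_le_mul_of_nonneg_left hm hbL
  have h4 := mul_nonneg (add_nonneg hbL hB) hτ
  have h5 := mul_nonneg (add_nonneg hbL hB) hX
  have h6 := mul_nonneg hB hr
  have h7 := mul_nonneg hbL hr
  linarith

/-- The second order term of an observation with a large regressor or a large error, at which only
the second derivative is bounded. The excess is charged to the tail `τ` and the squared error. -/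
theorem quadratic_le_of_tail {bL B x w m r τ X ζ : ℝ} (hbL : 0 ≤ bL) (hB : 0 ≤ B)
    (h : (x + w) ^ 2 ≤ 2 * (ζ + r ^ 2)) (h1 : 1 + ζ ≤ 2 * (τ + X * r ^ 2))
    (h2 : ζ ≤ τ + X * r ^ 2) (hm : m ≤ 1) (hr : 0 ≤ r ^ 2) (hζ : 0 ≤ ζ) :
    B / 2 * (x + w) ^ 2 ≤ -(bL / 8) * m + (bL + B) * (τ + (X + 1) * r ^ 2) := by
  have g1 := mul_le_mul_of_nonneg_left h hB
  have g2 := mul_le_mul_of_nonneg_left h1 hbL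
  have g3 := mul_le_mul_of_nonneg_left h2 hB
  have g4 := mul_le_mul_of_nonneg_left hm hbL
  have g5 := mul_nonneg hbL hr
  have g6 := mul_nonneg hbL hζ
  linarith

/-- An observation with a large regressor or a large error is dominated by the tail of the
regressors and by the squared error. -/
theorem bad_observation_le {E : Type*} [NormedAddCommGroup E] {z ρ : E} {K s : ℝ} (hK : 1 ≤ K)
    (hs : 0 < s) (hbad : K < ‖z‖ ∨ s < ‖ρ‖) :
    1 + ‖z‖ ^ 2 ≤ 2 * (tailSq K z + 2 * K ^ 2 / s ^ 2 * ‖ρ‖ ^ 2) ∧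
      ‖z‖ ^ 2 ≤ tailSq K z + 2 * K ^ 2 / s ^ 2 * ‖ρ‖ ^ 2 := by
  have hG : 0 ≤ 2 * K ^ 2 / s ^ 2 * ‖ρ‖ ^ 2 := by positivity
  by_cases hz : K < ‖z‖
  · have h1 : tailSq K z = ‖z‖ ^ 2 := by simp [tailSq, hz]
    have h2 : 1 ≤ ‖z‖ ^ 2 := one_le_pow₀ (hK.trans hz.le)
    constructor <;> linarith
  · have hρs : s < ‖ρ‖ := hbad.resolve_left hz
    have h1 : tailSq K z = 0 := by simp [tailSq, hz]
    have h2 : 1 ≤ ‖ρ‖ ^ 2 / s ^ 2 := by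
      rw [one_le_div (by positivity)]
      exact pow_le_pow_left₀ hs.le hρs.le 2
    have e : 2 * K ^ 2 / s ^ 2 * ‖ρ‖ ^ 2 = 2 * K ^ 2 * (‖ρ‖ ^ 2 / s ^ 2) := by ring
    have hz2 : ‖z‖ ^ 2 ≤ K ^ 2 := pow_le_pow_left₀ (norm_nonneg _) (not_lt.1 hz) 2
    have hK2 : 1 ≤ K ^ 2 := one_le_pow₀ hK
    have h3 := mul_le_mul_of_nonneg_left h2 (sq_nonneg K)
    rw [e, h1]
    constructor <;> linarith

/-- A quadratic upper bound near the truth. Observations with large regressors or large errors in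
the regressors, for which the log-likelihood need not be concave, are few. -/
theorem loglik_near_le (h : M.LikelihoodAssumptions P Ξl Ξu c B bL bU) {n T : ℕ} {y : ℕ → ℝ}
    (hy : ∀ t, y t ∈ ({0, 1} : Set ℝ)) {z ρ : ℕ → E} {β Δ : E} {σ Cz Ks K s ε c₁ : ℝ}
    (hσ : 0 < σ) (hσ1 : σ ≤ 1) (hK : 1 ≤ K) (hs : 0 < s) (hs1 : s ≤ 1)
    (hsmall : B * (‖β‖ * s + ε * (K + 1)) ≤ bL / 2)
    (hσs : (2 * K ^ 2 / s ^ 2 + 1) * σ ^ 2 ≤ bL * c₁ / (32 * (bL + B)))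
    (hu : ∀ t < n, inner ℝ β (z t) ∈ Set.Icc (Ξl T) (Ξu T))
    (h1 : ∑ t ∈ Finset.range n, ‖z t‖ ^ 2 ≤ Cz * n)
    (h2 : ∑ t ∈ Finset.range n, tailSq K (z t) ≤ bL * c₁ / (32 * (bL + B)) * n)
    (h3 : ∀ a : E, ‖a‖ = 1 → c₁ * n ≤ ∑ t ∈ Finset.range n, min ((inner ℝ a (z t)) ^ 2) 1)
    (h6 : ‖∑ t ∈ Finset.range n,
      deriv (logLikTerm (M.Phi P) (y t)) (inner ℝ β (z t)) • z t‖ ≤ Ks * (n * σ))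
    (h7 : ∑ t ∈ Finset.range n, ‖ρ t‖ ^ 2 ≤ n * σ ^ 2) (hΔ : ‖Δ‖ ≤ ε) :
    ∑ t ∈ Finset.range n, logLikTerm (M.Phi P) (y t) (inner ℝ (β + Δ) (z t + ρ t)) ≤
      ∑ t ∈ Finset.range n, logLikTerm (M.Phi P) (y t) (inner ℝ β (z t + ρ t)) +
      n * ((Ks + B * ‖β‖ * (Cz + 2) + B) * σ * ‖Δ‖ - bL * c₁ / 16 * ‖Δ‖ ^ 2) := by
  have hB := h.B_pos
  have hbL := h.bL_pos
  have hn : (0 : ℝ) ≤ n := Nat.cast_nonneg n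
  rcases (norm_nonneg Δ).eq_or_lt with h0 | hpos
  · have : Δ = 0 := norm_eq_zero.1 h0.symm
    simp [this]
  set a := ‖Δ‖⁻¹ • Δ with ha
  have ha1 : ‖a‖ = 1 := by rw [ha, norm_smul, norm_inv, norm_norm, inv_mul_cancel₀ hpos.ne']
  have hΔa : Δ = ‖Δ‖ • a := by rw [ha, smul_inv_smul₀ hpos.ne']
  have hin : ∀ x, inner ℝ Δ x = ‖Δ‖ * inner ℝ a x := fun x => by
    nth_rewrite 1 [hΔa]; rw [real_inner_smul_left]
  set Q : ℕ → ℝ := fun t => -(bL / 8) * min ((inner ℝ a (z t)) ^ 2) 1 +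
    (bL + B) * (tailSq K (z t) + (2 * K ^ 2 / s ^ 2 + 1) * ‖ρ t‖ ^ 2) with hQ
  have key : ∀ t ∈ Finset.range n, logLikTerm (M.Phi P) (y t) (inner ℝ (β + Δ) (z t + ρ t)) ≤
      logLikTerm (M.Phi P) (y t) (inner ℝ β (z t + ρ t)) +
      deriv (logLikTerm (M.Phi P) (y t)) (inner ℝ β (z t + ρ t)) * inner ℝ Δ (z t + ρ t) +
      ‖Δ‖ ^ 2 * Q t := by
    intro t ht
    set l := logLikTerm (M.Phi P) (y t) with hl
    rw [inner_add_left]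
    have hc : ContDiff ℝ 2 l := h.contDiff_two (hy t)
    have haz : (inner ℝ a (z t)) ^ 2 ≤ ‖z t‖ ^ 2 := by
      rw [← sq_abs]
      exact pow_le_pow_left₀ (abs_nonneg _)
        (by simpa [ha1] using abs_real_inner_le_norm a (z t)) 2
    have haρ : (inner ℝ a (ρ t)) ^ 2 ≤ ‖ρ t‖ ^ 2 := by
      rw [← sq_abs]
      exact pow_le_pow_left₀ (abs_nonneg _)
        (by simpa [ha1] using abs_real_inner_le_norm a (ρ t)) 2
    have hmin1 := min_le_left ((inner ℝ a (z t)) ^ 2) 1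
    have hmin2 := min_le_right ((inner ℝ a (z t)) ^ 2) 1
    have hmin0 : 0 ≤ min ((inner ℝ a (z t)) ^ 2) 1 := le_min (sq_nonneg _) zero_le_one
    have htail : 0 ≤ tailSq K (z t) := by unfold tailSq; split_ifs <;> positivity
    have hρ2 := sq_nonneg ‖ρ t‖
    have hKs : 0 ≤ 2 * K ^ 2 / s ^ 2 * ‖ρ t‖ ^ 2 := by positivity
    by_cases hgood : ‖z t‖ ≤ K ∧ ‖ρ t‖ ≤ s
    · -- the second derivative is at most `-bL / 2` on the segment
      have hq := le_quadratic_of_deriv_deriv_le hc (x := inner ℝ β (z t + ρ t))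
        (v := inner ℝ Δ (z t + ρ t)) (m := -(bL / 2)) (fun r hr => by
          have b1 := h.deriv_deriv_lipschitz (hy t)
            (inner ℝ β (z t + ρ t) + r * inner ℝ Δ (z t + ρ t)) (inner ℝ β (z t))
          have b2 := (h.l_concave (y t) (hy t) T _ (hu t (Finset.mem_range.1 ht))).1
          rw [← deriv_two] at b2
          have b3 : |inner ℝ β (z t + ρ t) + r * inner ℝ Δ (z t + ρ t) - inner ℝ β (z t)| ≤
              ‖β‖ * s + ε * (K + 1) := by
            have e : inner ℝ β (z t + ρ t) + r * inner ℝ Δ (z t + ρ t) - inner ℝ β (z t) =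
              inner ℝ β (ρ t) + r * inner ℝ Δ (z t + ρ t) := by rw [inner_add_right β]; ring
            rw [e]
            refine (abs_add_le _ _).trans (add_le_add ?_ ?_)
            · exact (abs_real_inner_le_norm _ _).trans (by gcongr; exact hgood.2)
            · rw [abs_mul, abs_of_nonneg hr.1]
              have h5 : |inner ℝ Δ (z t + ρ t)| ≤ ε * (K + 1) := by
                refine (abs_real_inner_le_norm _ _).trans ?_
                have : ‖z t + ρ t‖ ≤ K + 1 := (norm_add_le _ _).trans
                  (add_le_add hgood.1 (hgood.2.trans hs1))
                have hε0 : 0 ≤ ε := (norm_nonneg _).trans hΔ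
                gcongr
              calc r * |inner ℝ Δ (z t + ρ t)| ≤ 1 * |inner ℝ Δ (z t + ρ t)| := by
                    gcongr; exact hr.2
                _ ≤ _ := by rw [one_mul]; exact h5
          have b4 := (le_abs_self _).trans (b1.trans (mul_le_mul_of_nonneg_left b3 hB.le))
          linarith)
      refine hq.trans ?_
      have e1 : -(bL / 2) / 2 * (inner ℝ Δ (z t + ρ t)) ^ 2 ≤ ‖Δ‖ ^ 2 * Q t := by
        rw [hin, mul_pow, ← mul_assoc, mul_comm (-(bL / 2) / 2), mul_assoc]
        refine mul_le_mul_of_nonneg_left ?_ (sq_nonneg _)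
        rw [inner_add_right]
        have e2 : (inner ℝ a (z t)) ^ 2 / 2 - (inner ℝ a (ρ t)) ^ 2 ≤
            (inner ℝ a (z t) + inner ℝ a (ρ t)) ^ 2 := by
          nlinarith [sq_nonneg (inner ℝ a (z t) + 2 * inner ℝ a (ρ t))]
        exact quadratic_le_of_concave hbL.le hB.le e2 haρ hmin1 htail hρ2 hKs
      linarith
    · have hq := le_quadratic_of_deriv_deriv_le hc (x := inner ℝ β (z t + ρ t))
        (v := inner ℝ Δ (z t + ρ t)) (m := B)
        (fun r _ => (le_abs_self _).trans (h.abs_deriv_deriv_le (hy t) _))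
      refine hq.trans ?_
      have e1 : B / 2 * (inner ℝ Δ (z t + ρ t)) ^ 2 ≤ ‖Δ‖ ^ 2 * Q t := by
        rw [hin, mul_pow, ← mul_assoc, mul_comm (B / 2), mul_assoc]
        refine mul_le_mul_of_nonneg_left ?_ (sq_nonneg _)
        rw [inner_add_right]
        have e2 : (inner ℝ a (z t) + inner ℝ a (ρ t)) ^ 2 ≤ 2 * (‖z t‖ ^ 2 + ‖ρ t‖ ^ 2) := by
          nlinarith [sq_nonneg (inner ℝ a (z t) - inner ℝ a (ρ t))]
        have e3 : 1 + ‖z t‖ ^ 2 ≤ 2 * (tailSq K (z t) + 2 * K ^ 2 / s ^ 2 * ‖ρ t‖ ^ 2) ∧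
            ‖z t‖ ^ 2 ≤ tailSq K (z t) + 2 * K ^ 2 / s ^ 2 * ‖ρ t‖ ^ 2 :=
          bad_observation_le hK hs (by
            by_contra hcon
            rw [not_or, not_lt, not_lt] at hcon
            exact hgood hcon)
        exact quadratic_le_of_tail hbL.le hB.le e2 e3.1 e3.2 hmin2 hρ2 (sq_nonneg ‖z t‖)
      linarith
  refine (Finset.sum_le_sum key).trans ?_
  rw [Finset.sum_add_distrib, Finset.sum_add_distrib, ← Finset.mul_sum]
  have hlin : ∑ t ∈ Finset.range n, deriv (logLikTerm (M.Phi P) (y t))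
      (inner ℝ β (z t + ρ t)) * inner ℝ Δ (z t + ρ t) ≤
      (Ks + B * ‖β‖ * (Cz + 2) + B) * (n * σ) * ‖Δ‖ := by
    have e : ∑ t ∈ Finset.range n, deriv (logLikTerm (M.Phi P) (y t))
      (inner ℝ β (z t + ρ t)) * inner ℝ Δ (z t + ρ t) = inner ℝ (∑ t ∈ Finset.range n,
      deriv (logLikTerm (M.Phi P) (y t)) (inner ℝ β (z t + ρ t)) • (z t + ρ t)) Δ := by
      rw [sum_inner]
      exact Finset.sum_congr rfl fun t _ => by rw [real_inner_smul_left, real_inner_comm Δ]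
    rw [e]
    exact (real_inner_le_norm _ _).trans
      (mul_le_mul_of_nonneg_right (h.norm_score_le hy hσ hσ1 hu h1 h6 h7) (norm_nonneg _))
  have hQsum : ∑ t ∈ Finset.range n, Q t ≤ -(bL * c₁ / 16) * n := by
    simp only [hQ]
    rw [Finset.sum_add_distrib, ← Finset.mul_sum, ← Finset.mul_sum, Finset.sum_add_distrib,
      ← Finset.mul_sum]
    have q1 := mul_le_mul_of_nonneg_left (h3 a ha1) (by positivity : 0 ≤ bL / 8)
    have q2 : (2 * K ^ 2 / s ^ 2 + 1) * ∑ t ∈ Finset.range n, ‖ρ t‖ ^ 2 ≤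
        bL * c₁ / (32 * (bL + B)) * n := by
      calc _ ≤ (2 * K ^ 2 / s ^ 2 + 1) * (n * σ ^ 2) := by gcongr
        _ = (2 * K ^ 2 / s ^ 2 + 1) * σ ^ 2 * n := by ring
        _ ≤ _ := by gcongr
    have q3 := mul_le_mul_of_nonneg_left (add_le_add h2 q2) (by positivity : 0 ≤ bL + B)
    have e : (bL + B) * (bL * c₁ / (32 * (bL + B)) * n + bL * c₁ / (32 * (bL + B)) * n) =
        bL * c₁ / 16 * n := by field_simp; ring
    rw [e] at q3
    linarith
  have := mul_le_mul_of_nonneg_left hQsum (sq_nonneg ‖Δ‖)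
  linarith

set_option maxHeartbeats 1000000 in
/-- The three regimes combined: only parameters within a distance of the order `σ` of the truth
can have a likelihood as large as the truth. The order of the quantifiers records which constants
may depend on which. -/
theorem exists_loglik_lt (h : M.LikelihoodAssumptions P Ξl Ξu c B bL bU)
    (hε : Measurable (M.ε 0)) (β : E) {c₁ c₂ : ℝ} (hc₁ : 0 < c₁) (hc₂ : 0 < c₂) {K : ℝ}
    (hK : 1 ≤ K) :
    ∃ ε R : ℝ, 0 < ε ∧ ∀ c₃ : ℝ, 0 < c₃ → ∃ σ₀ : ℝ, 0 < σ₀ ∧ ∀ Cz Ks : ℝ, ∃ Kr : ℝ, 0 < Kr ∧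
      ∀ (n T : ℕ) (y : ℕ → ℝ) (z ρ : ℕ → E) (σ : ℝ), 0 < n → (∀ t, y t ∈ ({0, 1} : Set ℝ)) →
      0 < σ → σ ≤ σ₀ →
      (∀ t < n, inner ℝ β (z t) ∈ Set.Icc (Ξl T) (Ξu T)) →
      ∑ t ∈ Finset.range n, ‖z t‖ ^ 2 ≤ Cz * n →
      ∑ t ∈ Finset.range n, tailSq K (z t) ≤ bL * c₁ / (32 * (bL + B)) * n →
      (∀ a : E, ‖a‖ = 1 → c₁ * n ≤ ∑ t ∈ Finset.range n, min ((inner ℝ a (z t)) ^ 2) 1) →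
      (∀ a : E, ‖a‖ = 1 → c₂ * n ≤ ∑ t ∈ Finset.range n,
        ((1 - y t) * ramp (inner ℝ a (z t)) + y t * ramp (-inner ℝ a (z t)))) →
      (∀ θ : E, ε ≤ ‖θ - β‖ → ‖θ‖ ≤ R → c₃ * n ≤ ∑ t ∈ Finset.range n,
        hellinger (M.Phi P) (c ^ 2 / B) (y t) (inner ℝ β (z t)) (inner ℝ θ (z t))) →
      ‖∑ t ∈ Finset.range n,
        deriv (logLikTerm (M.Phi P) (y t)) (inner ℝ β (z t)) • z t‖ ≤ Ks * (n * σ) →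
      ∑ t ∈ Finset.range n, ‖ρ t‖ ^ 2 ≤ n * σ ^ 2 →
      ∀ θ, Kr * σ < ‖θ - β‖ →
        ∑ t ∈ Finset.range n, logLikTerm (M.Phi P) (y t) (inner ℝ θ (z t + ρ t)) <
          ∑ t ∈ Finset.range n, logLikTerm (M.Phi P) (y t) (inner ℝ β (z t + ρ t)) := by
  have hB := h.B_pos
  have hbL := h.bL_pos
  have hκ : 0 < c ^ 2 / B := div_pos (pow_pos h.c_pos 2) hB
  -- `s` and `ε` keep the segment between `u t` and `θᵀ (z t + ρ t)` in the region of concavity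
  set s := min 1 (bL / (4 * B * (‖β‖ + 1))) with hs
  have hs0 : 0 < s := lt_min one_pos (by positivity)
  have hs1 : s ≤ 1 := min_le_left _ _
  set ε := bL / (4 * B * (K + 1)) with hεdef
  have hε0 : 0 < ε := by positivity
  have hsmall : B * (‖β‖ * s + ε * (K + 1)) ≤ bL / 2 := by
    have e1 : ‖β‖ * s ≤ bL / (4 * B) := by
      calc ‖β‖ * s ≤ (‖β‖ + 1) * (bL / (4 * B * (‖β‖ + 1))) :=
            mul_le_mul (by linarith) (min_le_right _ _) hs0.le (by positivity)
        _ = _ := by field_simp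
    have e2 : ε * (K + 1) = bL / (4 * B) := by rw [hεdef]; field_simp
    have e3 := mul_le_mul_of_nonneg_left (add_le_add e1 e2.le) hB.le
    refine e3.trans (le_of_eq ?_)
    field_simp; ring
  -- `A` makes the far region worse than the truth
  set A := 4 / c₂ * (1 + |Real.log (c ^ 2 / B)|) with hA
  have hA0 : 0 ≤ A := by positivity
  obtain ⟨V, hV, hV0, hV1⟩ := h.logLikTerm_far A
  set R := 4 * V / c₂ with hR
  have hR0 : 0 < R := by positivity
  refine ⟨ε, R, hε0, fun c₃ hc₃ => ?_⟩
  set Lψ := 2 * √B / √(c ^ 2 / B) with hLψ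
  have hLψ0 : 0 ≤ Lψ := by positivity
  set G := B * ‖β‖ + B * ‖β‖ ^ 2 with hG
  have hG0 : 0 ≤ G := by positivity
  set s2 := bL * c₁ / (32 * (bL + B)) with hs2
  have hs20 : 0 < s2 := by positivity
  set W := 2 * K ^ 2 / s ^ 2 + 1 with hW
  have hW0 : 0 < W := by positivity
  set σ₀ := min (min 1 (c₂ / 2)) (min (min (1 / (2 * (G + 1))) (s2 / W))
    (c₃ / (2 * (Lψ * R + G + 1)))) with hσ₀
  have hσ₀0 : 0 < σ₀ := by
    simp only [hσ₀, lt_min_iff]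
    refine ⟨⟨one_pos, by positivity⟩, ⟨by positivity, by positivity⟩, by positivity⟩
  refine ⟨σ₀, hσ₀0, fun Cz Ks => ?_⟩
  set Ke := Ks + B * ‖β‖ * (Cz + 2) + B with hKe
  set q := bL * c₁ / 16 with hq
  have hq0 : 0 < q := by positivity
  refine ⟨(|Ke| + 1) / q, by positivity, ?_⟩
  intro n T y z ρ σ hn hy hσ hσle hu h1 h2 h3 h4 h5 h6 h7 θ hθ
  have hn' : (0 : ℝ) < n := by exact_mod_cast hn
  have hσ1 : σ ≤ 1 := hσle.trans ((min_le_left _ _).trans (min_le_left _ _))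
  have hσ4 : σ ≤ c₂ / 2 := hσle.trans ((min_le_left _ _).trans (min_le_right _ _))
  have hσG : σ ≤ 1 / (2 * (G + 1)) := hσle.trans ((min_le_right _ _).trans
    ((min_le_left _ _).trans (min_le_left _ _)))
  have hσW : σ ≤ s2 / W := hσle.trans ((min_le_right _ _).trans
    ((min_le_left _ _).trans (min_le_right _ _)))
  have hσ5 : σ ≤ c₃ / (2 * (Lψ * R + G + 1)) := hσle.trans ((min_le_right _ _).trans
    (min_le_right _ _))
  have hσ2 : σ ^ 2 ≤ σ := by
    rw [sq]; exact mul_le_of_le_one_left hσ.le hσ1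
  have htrue := h.loglik_true_ge hy hσ hu h7
  have hGσ : B * ‖β‖ * σ + B * ‖β‖ ^ 2 * σ ^ 2 ≤ G * σ := by
    have := mul_le_mul_of_nonneg_left hσ2 (by positivity : 0 ≤ B * ‖β‖ ^ 2)
    rw [hG]; linarith
  have hGn := mul_le_mul_of_nonneg_left hGσ hn'.le
  rcases le_or_gt ‖θ - β‖ ε with hnear | hnot
  · have hσs : W * σ ^ 2 ≤ s2 := by
      rw [le_div_iff₀ hW0] at hσW
      exact (mul_le_mul_of_nonneg_left hσ2 hW0.le).trans (by rwa [mul_comm])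
    have key := h.loglik_near_le (Δ := θ - β) hy hσ hσ1 hK hs0 hs1 hsmall hσs hu h1 h2 h3 h6 h7
      hnear
    rw [add_sub_cancel] at key
    refine lt_of_le_of_lt key ?_
    have hpos : 0 < ‖θ - β‖ := lt_of_le_of_lt (by positivity) hθ
    have hlt : Ke * σ < q * ‖θ - β‖ := by
      rw [div_mul_eq_mul_div, div_lt_iff₀ hq0] at hθ
      have : Ke * σ ≤ (|Ke| + 1) * σ := by
        gcongr
        linarith [le_abs_self Ke]
      linarith
    have h8 : Ke * σ * ‖θ - β‖ - q * ‖θ - β‖ ^ 2 < 0 := by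
      have := mul_lt_mul_of_pos_right hlt hpos
      rw [mul_assoc q, ← sq] at this
      linarith
    have := mul_neg_of_pos_of_neg hn' h8
    exact (add_lt_iff_neg_left).2 this
  · rcases le_or_gt ‖θ‖ R with hmid | hfar
    · have key := h.loglik_mid_le hε hy hσ hu h7 hmid (h5 θ hnot.le hmid)
      refine lt_of_le_of_lt key (lt_of_lt_of_le ?_ htrue)
      have h8 : (Lψ * R + G) * σ < c₃ := by
        rw [le_div_iff₀ (by positivity)] at hσ5
        have : 0 ≤ (Lψ * R + G) * σ := by positivity
        linarith
      have h9 := mul_lt_mul_of_pos_left h8 hn'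
      linarith
    · have key := h.loglik_far_le hy hσ hA0 hc₂ hV hV0 hV1 h7 hσ4 hfar.le h4
      refine lt_of_le_of_lt key (lt_of_lt_of_le ?_ htrue)
      have hlow : ∑ t ∈ Finset.range n, Real.log (c ^ 2 / B) ≤
          ∑ t ∈ Finset.range n, logLikTerm (M.Phi P) (y t) (inner ℝ β (z t)) := by
        refine Finset.sum_le_sum fun t ht => ?_
        have := h.lik_lower hε T (hu t (Finset.mem_range.1 ht)) (hy t)
        exact (Real.log_le_iff_le_exp hκ).2 this
      rw [Finset.sum_const, Finset.card_range, nsmul_eq_mul] at hlow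
      have e : A * (c₂ / 4) = 1 + |Real.log (c ^ 2 / B)| := by rw [hA]; field_simp
      have h8 : G * σ < 1 := by
        rw [le_div_iff₀ (by positivity)] at hσG
        have : 0 ≤ G * σ := by positivity
        linarith
      have h9 := neg_abs_le (Real.log (c ^ 2 / B))
      rw [e]
      have h10 := mul_lt_mul_of_pos_left h8 hn'
      have h11 := mul_le_mul_of_nonneg_left h9 hn'.le
      linarith

end LikelihoodAssumptions

end FactorBinaryModel

/-! ### The regressors of the sample and the conditional law of the response -/

/-- The coefficient vectors and the regressors with the Euclidean norm. -/
abbrev CoefSpace (p d : ℕ) : Type := EuclideanSpace ℝ (Coef p d)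

/-- The values of `(w_t, f_t, ε_t)`. -/
abbrev State (p d : ℕ) : Type := EuclideanSpace ℝ (Fin p) × EuclideanSpace ℝ (Fin d) × ℝ

/-- The regressor `(1, wᵀ, fᵀ)ᵀ` of a state `(w, f, ε)`. -/
def regVec {p d : ℕ} (s : State p d) : CoefSpace p d := WithLp.toLp 2 (regressor s.1 s.2.1)

/-- The response in the state `s'`, predicted from the state `s`, when the coefficients are `b`. -/
def response {p d : ℕ} (b : CoefSpace p d) (q : State p d × State p d) : ℝ :=
  if q.2.2.2 ≤ inner ℝ b (regVec q.1) then 1 else 0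

theorem response_mem {p d : ℕ} (b : CoefSpace p d) (q : State p d × State p d) :
    response b q ∈ ({0, 1} : Set ℝ) := by
  unfold response; split_ifs <;> simp

theorem inner_toLp_eq_dotProduct {ι : Type*} [Fintype ι] (a b : ι → ℝ) :
    inner ℝ (WithLp.toLp 2 a : EuclideanSpace ℝ ι) (WithLp.toLp 2 b) = a ⬝ᵥ b := by
  rw [EuclideanSpace.inner_toLp_toLp, dotProduct_comm]; rfl

theorem measurable_regVec {p d : ℕ} : Measurable (regVec (p := p) (d := d)) := by
  refine (WithLp.measurable_toLp 2 _).comp (measurable_pi_iff.2 ?_)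
  rintro (_ | j | j)
  · exact measurable_const
  · change Measurable fun s : State p d => s.1 j
    fun_prop
  · change Measurable fun s : State p d => s.2.1 j
    fun_prop

theorem measurable_inner_regVec {p d : ℕ} (b : CoefSpace p d) :
    Measurable fun s : State p d => inner ℝ b (regVec s) :=
  Measurable.inner measurable_const measurable_regVec

theorem measurable_response {p d : ℕ} (b : CoefSpace p d) : Measurable (response b) :=
  Measurable.ite (measurableSet_le (by fun_prop)
    ((measurable_inner_regVec b).comp measurable_fst)) measurable_const measurable_const

theorem norm_regVec_sq {p d : ℕ} (s : State p d) :
    ‖regVec s‖ ^ 2 = 1 + ‖s.1‖ ^ 2 + ‖s.2.1‖ ^ 2 := by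
  rw [EuclideanSpace.norm_sq_eq, EuclideanSpace.norm_sq_eq, EuclideanSpace.norm_sq_eq]
  simp [regVec, regressor, add_assoc]

namespace FactorBinaryModel

variable {Ω : Type*} {p d : ℕ}

/-- The series `(w_t, f_t, ε_t)`. -/
def state (M : FactorBinaryModel Ω p d) (t : ℕ) (ω : Ω) : State p d := (M.w t ω, M.f t ω, M.ε t ω)

/-- The true coefficients as a Euclidean vector. -/
def βVec (M : FactorBinaryModel Ω p d) : CoefSpace p d := WithLp.toLp 2 M.β

theorem inner_βVec (M : FactorBinaryModel Ω p d) (t : ℕ) (ω : Ω) :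
    inner ℝ M.βVec (regVec (M.state t ω)) = M.u t ω :=
  inner_toLp_eq_dotProduct _ _

theorem yLead_eq (M : FactorBinaryModel Ω p d) (t : ℕ) (ω : Ω) :
    M.yLead t ω = response M.βVec (M.state t ω, M.state (t + M.h) ω) := by
  unfold yLead response
  simp only [inner_βVec, sub_nonneg]
  rfl

theorem yLead_mem (M : FactorBinaryModel Ω p d) (t : ℕ) (ω : Ω) :
    M.yLead t ω ∈ ({0, 1} : Set ℝ) := by
  rw [yLead_eq]; exact response_mem _ _

variable [mΩ : MeasurableSpace Ω] {M : FactorBinaryModel Ω p d}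
  {P : Measure Ω} [IsProbabilityMeasure P] {δ : ℝ} {Slam : Matrix (Fin d) (Fin d) ℝ}
  {Ξl Ξu : ℕ → ℝ} {c B bL bU : ℝ} {Ωβ : Matrix (Coef p d) (Coef p d) ℝ}

theorem SamplingAssumptions.measurable_state (h : M.SamplingAssumptions P δ Slam) (t : ℕ) :
    Measurable (M.state t) :=
  (h.measurable_w t).prodMk ((h.measurable_f t).prodMk (h.measurable_ε t))

theorem SamplingAssumptions.measurable_u (h : M.SamplingAssumptions P δ Slam) (t : ℕ) :
    Measurable (M.u t) := by
  simp_rw [show M.u t = fun ω => inner ℝ M.βVec (regVec (M.state t ω)) from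
    funext fun ω => (M.inner_βVec t ω).symm]
  exact (measurable_inner_regVec _).comp (h.measurable_state t)

theorem SamplingAssumptions.stationary_state (h : M.SamplingAssumptions P δ Slam) :
    StrictlyStationary P M.state := h.stationary

theorem SamplingAssumptions.summable_mixing_state (h : M.SamplingAssumptions P δ Slam) :
    Summable (mixing P M.state) := by
  have hδ := h.δ_pos
  refine Summable.of_nonneg_of_le (fun n => crossMixing_nonneg _ _ _) (fun n => ?_)
    h.summable_mixing
  refine Real.self_le_rpow_of_le_one (crossMixing_nonneg _ _ _) (crossMixing_le_one _ _ _) ?_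
  rw [div_le_one (by positivity)]; linarith

/-- The index lies in one of the intervals almost surely, since all of `u_0, …, u_{T-1}` lie in
`Ξ_T` with probability tending to one. -/
theorem ae_mem_support (hs : M.SamplingAssumptions P δ Slam)
    (hl : M.LikelihoodAssumptions P Ξl Ξu c B bL bU) (t : ℕ) :
    ∀ᵐ ω ∂P, ∃ T, M.u t ω ∈ Set.Icc (Ξl T) (Ξu T) := by
  have hm : MeasurableSet {ω | ∃ T, M.u t ω ∈ Set.Icc (Ξl T) (Ξu T)} := by
    rw [Set.ofPred_exists]
    exact MeasurableSet.iUnion fun T => hs.measurable_u t measurableSet_Icc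
  have h1 : P {ω | ∃ T, M.u t ω ∈ Set.Icc (Ξl T) (Ξu T)} = 1 := by
    refine le_antisymm prob_le_one (le_of_tendsto hl.support ?_)
    filter_upwards [eventually_gt_atTop t] with T hT
    exact measure_mono fun ω hω => ⟨T, hω t hT⟩
  exact (prob_compl_eq_zero_iff hm).2 h1

/-- Almost surely, the log-likelihood is strongly concave at the true index. -/
theorem ae_le_negHessian_factor (hs : M.SamplingAssumptions P δ Slam)
    (hl : M.LikelihoodAssumptions P Ξl Ξu c B bL bU) (t : ℕ) :
    ∀ᵐ ω ∂P, bL ≤ -iteratedDeriv 2 (logLikTerm (M.Phi P) (M.yLead t ω)) (M.u t ω) := by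
  filter_upwards [ae_mem_support hs hl t] with ω hω
  obtain ⟨T, hT⟩ := hω
  exact (hl.l_concave _ (M.yLead_mem t ω) T _ hT).1

/-- The regressors have second moments: the integrable Hessian dominates their squares, as its
factor `-l''` is bounded below. -/
theorem integrable_sq_regVec (hs : M.SamplingAssumptions P δ Slam)
    (hl : M.LikelihoodAssumptions P Ξl Ξu c B bL bU) (hc : M.CovarianceAssumptions P Ωβ) (t : ℕ) :
    Integrable (fun ω => ‖regVec (M.state t ω)‖ ^ 2) P := by
  have hz := measurable_regVec.comp (hs.measurable_state t)
  have hcoord : ∀ a, Integrable (fun ω => (M.z t ω a) ^ 2) P := by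
    intro a
    have hza : Measurable (fun ω => M.z t ω a) := by
      have : Measurable (fun v : CoefSpace p d => v a) := by fun_prop
      exact this.comp hz
    refine ((hc.integrable_hessian t a a).const_mul bL⁻¹).mono'
      (hza.pow_const 2).aestronglyMeasurable ?_
    filter_upwards [ae_le_negHessian_factor hs hl t] with ω hω
    rw [Real.norm_eq_abs, abs_of_nonneg (sq_nonneg _), ← div_eq_inv_mul, le_div_iff₀ hl.bL_pos]
    simp only [negHessian, Matrix.of_apply]
    nlinarith [mul_le_mul_of_nonneg_right hω (sq_nonneg (M.z t ω a))]
  have he : (fun ω => ‖regVec (M.state t ω)‖ ^ 2) = fun ω => ∑ a, (M.z t ω a) ^ 2 := by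
    ext ω
    rw [EuclideanSpace.norm_sq_eq]
    simp only [Real.norm_eq_abs, sq_abs]
    rfl
  rw [he]
  exact integrable_finsetSum _ fun a _ => hcoord a

theorem integral_sq_regVec_eq (hs : M.SamplingAssumptions P δ Slam) (t : ℕ) :
    ∫ ω, ‖regVec (M.state t ω)‖ ^ 2 ∂P = ∫ ω, ‖regVec (M.state 0 ω)‖ ^ 2 ∂P :=
  hs.stationary_state.integral_pair_eq hs.measurable_state 0 t
    (g := fun q => ‖regVec q.1‖ ^ 2) ((measurable_regVec.comp measurable_fst).norm.pow_const 2)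

/-- The regressors are not collinear, since the expected Hessian is nonsingular. -/
theorem not_ae_inner_eq_zero (hc : M.CovarianceAssumptions P Ωβ) {a : CoefSpace p d}
    (ha : a ≠ 0) : ¬ ∀ᵐ ω ∂P, inner ℝ a (regVec (M.state 0 ω)) = 0 := by
  intro h0
  have hpos := (hc.posDef_hessian 0).dotProduct_mulVec_pos (x := WithLp.ofLp a)
    (fun h => ha ((WithLp.ofLp_eq_zero 2).1 h))
  refine hpos.ne' ?_
  simp only [dotProduct, Matrix.mulVec, Matrix.of_apply, Pi.star_apply, star_trivial,
    Finset.mul_sum]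
  have hi : ∀ i j, Integrable (fun ω => a i * (M.negHessian P 0 ω i j * a j)) P := fun i j =>
    ((hc.integrable_hessian 0 i j).mul_const _).const_mul _
  have he : ∀ i j, a i * ((∫ ω, M.negHessian P 0 ω i j ∂P) * a j) =
      ∫ ω, a i * (M.negHessian P 0 ω i j * a j) ∂P := fun i j => by
    rw [integral_const_mul, integral_mul_const]
  simp_rw [he]
  rw [Finset.sum_congr rfl fun i _ => (integral_finsetSum _ fun j _ => hi i j).symm,
    ← integral_finsetSum _ fun i _ => integrable_finsetSum _ fun j _ => hi i j]
  refine integral_eq_zero_of_ae ?_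
  filter_upwards [h0] with ω hω
  have hin : ∑ i, a i * M.z 0 ω i = 0 := by
    rw [← hω]
    exact (inner_toLp_eq_dotProduct (WithLp.ofLp a) (M.z 0 ω)).symm
  have hfac : ∑ i, ∑ j, a i * (M.negHessian P 0 ω i j * a j) =
      -iteratedDeriv 2 (logLikTerm (M.Phi P) (M.yLead 0 ω)) (M.u 0 ω) *
        ((∑ i, a i * M.z 0 ω i) * ∑ j, a j * M.z 0 ω j) := by
    rw [Finset.sum_mul_sum, Finset.mul_sum]
    refine Finset.sum_congr rfl fun i _ => ?_
    rw [Finset.mul_sum]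
    refine Finset.sum_congr rfl fun j _ => ?_
    simp only [negHessian, Matrix.of_apply]
    ring
  rw [hfac, hin]
  simp

/-- A nonnegative variable that vanishes only where a direction of the regressors does has a
positive mean. -/
theorem integral_pos_of_inner_eq_zero (hc : M.CovarianceAssumptions P Ωβ) {a : CoefSpace p d}
    (ha : a ≠ 0) {g : Ω → ℝ} (hg : Integrable g P) (h0 : ∀ᵐ ω ∂P, 0 ≤ g ω)
    (hz : ∀ᵐ ω ∂P, g ω = 0 → inner ℝ a (regVec (M.state 0 ω)) = 0) : 0 < ∫ ω, g ω ∂P := by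
  refine lt_of_le_of_ne (integral_nonneg_of_ae h0) fun h => not_ae_inner_eq_zero hc ha ?_
  have := (integral_eq_zero_iff_of_nonneg_ae h0 hg).1 h.symm
  filter_upwards [this, hz] with ω h1 h2 using h2 h1

/-- The response has conditional probability `Φ(u_t)` of being one, given the regressors. -/
theorem integral_response (hs : M.SamplingAssumptions P δ Slam)
    (hl : M.LikelihoodAssumptions P Ξl Ξu c B bL bU) {G : ℝ → CoefSpace p d → ℝ} {C : ℝ}
    (hGm : ∀ y, Measurable (G y)) (hGC : ∀ y ∈ ({0, 1} : Set ℝ), ∀ z, |G y z| ≤ C) :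
    Integrable (fun ω => M.Phi P (M.u 0 ω) * G 1 (regVec (M.state 0 ω)) +
      (1 - M.Phi P (M.u 0 ω)) * G 0 (regVec (M.state 0 ω))) P ∧
    ∫ ω, G (response M.βVec (M.state 0 ω, M.state M.h ω)) (regVec (M.state 0 ω)) ∂P =
      ∫ ω, M.Phi P (M.u 0 ω) * G 1 (regVec (M.state 0 ω)) +
        (1 - M.Phi P (M.u 0 ω)) * G 0 (regVec (M.state 0 ω)) ∂P := by
  set Z : Ω → CoefSpace p d := fun ω => regVec (M.state 0 ω) with hZ
  have hZm : Measurable Z := measurable_regVec.comp (hs.measurable_state 0)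
  have hind : IndepFun Z (M.ε M.h) P := by
    rw [IndepFun_iff_Indep]
    refine indep_of_indep_of_le_left (indep_of_indep_of_le_right hs.indep_factor_noise
      (Measurable.comap_le ?_)) (Measurable.comap_le ?_)
    · exact measurable_sigmaOf (X := M.ε) (Set.mem_univ _)
    · have hw : Measurable[sigmaOf M.w Set.univ ⊔ sigmaOf M.lam Set.univ ⊔ sigmaOf M.f Set.univ]
          (M.w 0) :=
        (measurable_sigmaOf (X := M.w) (Set.mem_univ _)).mono (le_sup_left.trans le_sup_left) le_rfl
      have hf : Measurable[sigmaOf M.w Set.univ ⊔ sigmaOf M.lam Set.univ ⊔ sigmaOf M.f Set.univ]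
          (M.f 0) :=
        (measurable_sigmaOf (X := M.f) (Set.mem_univ _)).mono le_sup_right le_rfl
      have : Z = (fun s : EuclideanSpace ℝ (Fin p) × EuclideanSpace ℝ (Fin d) =>
          regVec (s.1, s.2, (0 : ℝ))) ∘ fun ω => (M.w 0 ω, M.f 0 ω) := rfl
      rw [this]
      exact (measurable_regVec.comp (by fun_prop)).comp (hw.prodMk hf)
  -- all `ε_t` have the same density, hence the law of `ε_0` that defines `Φ`
  have hlaw : P.map (fun ω => (Z ω, M.ε M.h ω)) = (P.map Z).prod (P.map (M.ε 0)) := by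
    rw [(indepFun_iff_map_prod_eq_prod_map_map hZm.aemeasurable
      (hs.measurable_ε _).aemeasurable).1 hind, hl.density M.h, ← hl.density 0]
  have hp1 : IsProbabilityMeasure (P.map Z) := Measure.isProbabilityMeasure_map hZm.aemeasurable
  have hp2 : IsProbabilityMeasure (P.map (M.ε 0)) :=
    Measure.isProbabilityMeasure_map (hs.measurable_ε 0).aemeasurable
  set H : CoefSpace p d × ℝ → ℝ := fun q =>
    if q.2 ≤ inner ℝ M.βVec q.1 then G 1 q.1 else G 0 q.1 with hH
  have hHm : Measurable H := Measurable.ite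
    (measurableSet_le measurable_snd (Measurable.inner measurable_const measurable_fst))
    ((hGm 1).comp measurable_fst) ((hGm 0).comp measurable_fst)
  have hHC : ∀ q, |H q| ≤ C := fun q => by
    simp only [hH]; split_ifs
    · exact hGC 1 (by simp) _
    · exact hGC 0 (by simp) _
  have hHi : Integrable H ((P.map Z).prod (P.map (M.ε 0))) :=
    Integrable.of_bound hHm.aestronglyMeasurable C (Eventually.of_forall hHC)
  have hinner : ∀ z : CoefSpace p d, ∫ x, H (z, x) ∂(P.map (M.ε 0)) =
      M.Phi P (inner ℝ M.βVec z) * G 1 z + (1 - M.Phi P (inner ℝ M.βVec z)) * G 0 z := by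
    intro z
    have e : (fun x => H (z, x)) = fun x =>
        (Set.Iic (inner ℝ M.βVec z)).indicator (fun _ => G 1 z - G 0 z) x + G 0 z := by
      ext x
      simp only [hH, Set.indicator, Set.mem_Iic]
      split_ifs <;> ring
    rw [e, integral_add ((integrable_const _).indicator measurableSet_Iic) (integrable_const _),
      integral_indicator_const _ measurableSet_Iic, ← cdf_eq_real]
    simp only [integral_const, probReal_univ, smul_eq_mul, Phi]
    ring
  have h1 : ∀ ω, G (response M.βVec (M.state 0 ω, M.state M.h ω)) (Z ω) = H (Z ω, M.ε M.h ω) := by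
    intro ω
    by_cases hh : M.ε M.h ω ≤ inner ℝ M.βVec (Z ω)
    · rw [show response M.βVec (M.state 0 ω, M.state M.h ω) = 1 from if_pos hh,
        show H (Z ω, M.ε M.h ω) = G 1 (Z ω) from if_pos hh]
    · rw [show response M.βVec (M.state 0 ω, M.state M.h ω) = 0 from if_neg hh,
        show H (Z ω, M.ε M.h ω) = G 0 (Z ω) from if_neg hh]
  have h2 : ∀ ω, M.Phi P (M.u 0 ω) * G 1 (Z ω) + (1 - M.Phi P (M.u 0 ω)) * G 0 (Z ω) =
      ∫ x, H (Z ω, x) ∂(P.map (M.ε 0)) := fun ω => by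
    rw [hinner, hZ, inner_βVec]
  have hmeas : Measurable fun z : CoefSpace p d => ∫ x, H (z, x) ∂(P.map (M.ε 0)) :=
    (hHm.stronglyMeasurable.integral_prod_right).measurable
  constructor
  · refine Integrable.congr ?_ (Eventually.of_forall fun ω => (h2 ω).symm)
    exact (integrable_map_measure hmeas.aestronglyMeasurable hZm.aemeasurable).1
      hHi.integral_prod_left
  · refine (integral_congr_ae (Eventually.of_forall h1)).trans
      (Eq.trans ?_ (integral_congr_ae (Eventually.of_forall fun ω => (h2 ω).symm)))
    rw [← integral_map (f := H) (φ := fun ω => (Z ω, M.ε M.h ω))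
      (hZm.prodMk (hs.measurable_ε _)).aemeasurable hHm.aestronglyMeasurable, hlaw,
      integral_prod _ hHi, integral_map hZm.aemeasurable hmeas.aestronglyMeasurable]

end FactorBinaryModel

/-! ### Uniform lower bounds for the regressors and the likelihood -/

namespace FactorBinaryModel

variable {Ω : Type*} {p d : ℕ} [mΩ : MeasurableSpace Ω] {M : FactorBinaryModel Ω p d}
  {P : Measure Ω} [IsProbabilityMeasure P] {δ : ℝ} {Slam : Matrix (Fin d) (Fin d) ℝ}
  {Ξl Ξu : ℕ → ℝ} {c B bL bU : ℝ} {Ωβ : Matrix (Coef p d) (Coef p d) ℝ}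

theorem abs_inner_sub_inner_le {E : Type*} [NormedAddCommGroup E] [InnerProductSpace ℝ E]
    (a a' z : E) : |inner ℝ a z - inner ℝ a' z| ≤ dist a a' * ‖z‖ := by
  rw [← inner_sub_left, dist_eq_norm]
  exact abs_real_inner_le_norm _ _

theorem abs_min_sq_sub_le (x x' : ℝ) : |min (x ^ 2) 1 - min (x' ^ 2) 1| ≤ 2 * |x - x'| := by
  have e : ∀ x : ℝ, min (x ^ 2) 1 = min |x| 1 ^ 2 := fun x => by
    rcases le_total |x| 1 with h | h
    · rw [min_eq_left h, sq_abs, min_eq_left ((sq_le_one_iff_abs_le_one x).2 h)]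
    · rw [min_eq_right h, one_pow, min_eq_right ((one_le_sq_iff_one_le_abs x).2 h)]
  have h0 : ∀ x : ℝ, 0 ≤ min |x| 1 ∧ min |x| 1 ≤ 1 := fun x =>
    ⟨le_min (abs_nonneg _) zero_le_one, min_le_right _ _⟩
  have h1 : |min |x| 1 - min |x'| 1| ≤ |x - x'| :=
    (abs_min_sub_min_le_max _ _ _ _).trans
      (max_le (abs_abs_sub_abs_le _ _) (by simp))
  have h2 : |min |x| 1 + min |x'| 1| ≤ 2 := by
    rw [abs_of_nonneg (add_nonneg (h0 x).1 (h0 x').1)]; linarith [(h0 x).2, (h0 x').2]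
  rw [e, e, sq_sub_sq, abs_mul]
  exact mul_le_mul h2 h1 (abs_nonneg _) zero_le_two

theorem measurable_norm_regVec {K : ℝ} : Measurable fun s : State p d => K * ‖regVec s‖ :=
  measurable_regVec.norm.const_mul K

theorem integrable_norm_regVec (hs : M.SamplingAssumptions P δ Slam)
    (hl : M.LikelihoodAssumptions P Ξl Ξu c B bL bU) (hc : M.CovarianceAssumptions P Ωβ) :
    Integrable (fun ω => ‖regVec (M.state 0 ω)‖) P := by
  refine ((integrable_const (1 : ℝ)).add (integrable_sq_regVec hs hl hc 0)).mono'
    (measurable_regVec.comp (hs.measurable_state 0)).norm.aestronglyMeasurable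
    (Eventually.of_forall fun ω => ?_)
  simp only [norm_norm, Pi.add_apply]
  nlinarith [sq_nonneg (‖regVec (M.state 0 ω)‖ - 1), norm_nonneg (regVec (M.state 0 ω))]

/-- No direction carries only a vanishing share of the variation of the regressors. -/
theorem exists_lower_bound_min_sq (hs : M.SamplingAssumptions P δ Slam)
    (hl : M.LikelihoodAssumptions P Ξl Ξu c B bL bU) (hc : M.CovarianceAssumptions P Ωβ) :
    ∃ c₁ : ℝ, 0 < c₁ ∧ Tendsto (fun n : ℕ => P {ω | ¬ ∀ a : CoefSpace p d, ‖a‖ = 1 →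
      c₁ * n ≤ ∑ t ∈ Finset.range n, min ((inner ℝ a (regVec (M.state t ω))) ^ 2) 1})
      atTop (𝓝 0) := by
  have hm : ∀ a : CoefSpace p d, Measurable fun q : State p d × State p d =>
      min ((inner ℝ a (regVec q.1)) ^ 2) 1 := fun a =>
    (((measurable_inner_regVec a).comp measurable_fst).pow_const 2).min measurable_const
  have h0 : ∀ (a : CoefSpace p d) (q : State p d × State p d),
      0 ≤ min ((inner ℝ a (regVec q.1)) ^ 2) 1 := fun a q => le_min (sq_nonneg _) zero_le_one
  have h1 : ∀ (a : CoefSpace p d) (q : State p d × State p d),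
      |min ((inner ℝ a (regVec q.1)) ^ 2) 1| ≤ 1 := fun a q => by
    rw [abs_of_nonneg (h0 a q)]; exact min_le_right _ _
  obtain ⟨c₁, hc₁, h⟩ := exists_uniform_lower_bound hs.measurable_state hs.stationary_state
    hs.summable_mixing_state 0 (isCompact_sphere (0 : CoefSpace p d) 1)
    (Ψ := fun a q => min ((inner ℝ a (regVec q.1)) ^ 2) 1) hm h1
    (b := fun s => 2 * ‖regVec s‖) measurable_norm_regVec
    (fun s => by positivity) ((integrable_norm_regVec hs hl hc).const_mul 2)
    (fun a a' q => (abs_min_sq_sub_le _ _).trans (by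
      linarith [abs_inner_sub_inner_le a a' (regVec q.1)]))
    (fun a ha => by
      have ha0 : a ≠ 0 := fun h => by simp [h] at ha
      refine integral_pos_of_inner_eq_zero hc ha0 (Integrable.of_bound
        ((hm a).comp ((hs.measurable_state 0).prodMk
          (hs.measurable_state 0))).aestronglyMeasurable 1
          (Eventually.of_forall fun ω => h1 a _))
        (Eventually.of_forall fun ω => h0 a (M.state 0 ω, M.state 0 ω))
        (Eventually.of_forall fun ω hω => ?_)
      rcases min_choice ((inner ℝ a (regVec (M.state 0 ω))) ^ 2) 1 with h | h
      · rw [h] at hω; exact pow_eq_zero_iff two_ne_zero |>.1 hω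
      · rw [h] at hω; exact absurd hω one_ne_zero)
  refine ⟨c₁, hc₁, h.congr fun n => ?_⟩
  simp only [mem_sphere_zero_iff_norm]

/-- In every direction, a nonvanishing share of the observations has the wrong outcome. -/
theorem exists_lower_bound_ramp (hs : M.SamplingAssumptions P δ Slam)
    (hl : M.LikelihoodAssumptions P Ξl Ξu c B bL bU) (hc : M.CovarianceAssumptions P Ωβ) :
    ∃ c₂ : ℝ, 0 < c₂ ∧ Tendsto (fun n : ℕ => P {ω | ¬ ∀ a : CoefSpace p d, ‖a‖ = 1 →
      c₂ * n ≤ ∑ t ∈ Finset.range n,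
        ((1 - M.yLead t ω) * ramp (inner ℝ a (regVec (M.state t ω))) +
          M.yLead t ω * ramp (-inner ℝ a (regVec (M.state t ω))))}) atTop (𝓝 0) := by
  have hramp : Measurable ramp := (measurable_id.max measurable_const).min measurable_const
  set G : CoefSpace p d → ℝ → CoefSpace p d → ℝ := fun a y z =>
    (1 - y) * ramp (inner ℝ a z) + y * ramp (-inner ℝ a z) with hG
  have hGm : ∀ a, Measurable fun q : ℝ × CoefSpace p d => G a q.1 q.2 := fun a => by
    have hi : Measurable fun q : ℝ × CoefSpace p d => (inner ℝ a q.2 : ℝ) :=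
      Measurable.inner measurable_const measurable_snd
    exact ((measurable_const.sub measurable_fst).mul (hramp.comp hi)).add
      (measurable_fst.mul (hramp.comp hi.neg))
  have hG0 : ∀ a, ∀ y ∈ ({0, 1} : Set ℝ), ∀ z, |G a y z| ≤ 1 := by
    intro a y hy z
    rcases hy with rfl | hy
    · simp [hG, abs_of_nonneg (ramp_nonneg _), ramp_le_one]
    · rw [Set.mem_singleton_iff.1 hy]
      simp [hG, abs_of_nonneg (ramp_nonneg _), ramp_le_one]
  have hGL : ∀ a a', ∀ y ∈ ({0, 1} : Set ℝ), ∀ z, |G a y z - G a' y z| ≤ dist a a' * ‖z‖ := by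
    intro a a' y hy z
    refine le_trans ?_ (abs_inner_sub_inner_le a a' z)
    rcases hy with rfl | hy
    · simpa [hG] using abs_ramp_sub_le (inner ℝ a z) (inner ℝ a' z)
    · rw [Set.mem_singleton_iff.1 hy]
      have := abs_ramp_sub_le (-inner ℝ a z) (-inner ℝ a' z)
      rw [show -inner ℝ a z - -inner ℝ a' z = -(inner ℝ a z - inner ℝ a' z) by ring, abs_neg]
        at this
      simpa [hG] using this
  have hpair : Measurable fun q : State p d × State p d => (response M.βVec q, regVec q.1) :=
    (measurable_response _).prodMk (measurable_regVec.comp measurable_fst)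
  obtain ⟨c₂, hc₂, h⟩ := exists_uniform_lower_bound hs.measurable_state hs.stationary_state
    hs.summable_mixing_state M.h (isCompact_sphere (0 : CoefSpace p d) 1)
    (Ψ := fun a q => G a (response M.βVec q) (regVec q.1)) (fun a => (hGm a).comp hpair)
    (fun a q => hG0 a _ (response_mem _ _) _)
    (b := fun s => 1 * ‖regVec s‖) measurable_norm_regVec
    (fun s => by positivity) ((integrable_norm_regVec hs hl hc).const_mul 1)
    (fun a a' q => by simpa using hGL a a' _ (response_mem _ _) (regVec q.1))
    (fun a ha => by
      have ha0 : a ≠ 0 := fun h => by simp [h] at ha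
      obtain ⟨hi, he⟩ := integral_response hs hl (G := G a) (C := 1)
        (fun y => (hGm a).comp (measurable_const.prodMk measurable_id)) (hG0 a)
      rw [he]
      refine integral_pos_of_inner_eq_zero hc ha0 hi (Eventually.of_forall fun ω => ?_)
        (Eventually.of_forall fun ω hω => ?_)
      · have hΦ := hl.Phi_mem (M.u 0 ω)
        simp only [hG, sub_self, zero_mul, one_mul, zero_add, sub_zero, add_zero]
        exact add_nonneg (mul_nonneg hΦ.1.le (ramp_nonneg _))
          (mul_nonneg (by linarith [hΦ.2]) (ramp_nonneg _))
      · have hΦ := hl.Phi_mem (M.u 0 ω)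
        simp only [hG, sub_self, zero_mul, one_mul, zero_add, sub_zero, add_zero] at hω
        have n1 := mul_nonneg hΦ.1.le (ramp_nonneg (-inner ℝ a (regVec (M.state 0 ω))))
        have n2 := mul_nonneg (show 0 ≤ 1 - M.Phi P (M.u 0 ω) by linarith [hΦ.2])
          (ramp_nonneg (inner ℝ a (regVec (M.state 0 ω))))
        have z1 := (mul_eq_zero.1 (le_antisymm (by linarith) n1)).resolve_left hΦ.1.ne'
        have z2 := (mul_eq_zero.1 (le_antisymm (by linarith) n2)).resolve_left
          (by linarith [hΦ.2])
        have hz : ∀ v, ramp v = 0 → v ≤ 0 := fun v hv => by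
          by_contra hv'
          have : 0 < ramp v := lt_min (lt_max_of_lt_left (not_le.1 hv')) one_pos
          linarith
        linarith [hz _ z1, hz _ z2])
  refine ⟨c₂, hc₂, h.congr fun n => ?_⟩
  simp only [mem_sphere_zero_iff_norm, yLead_eq, hG]

theorem measurable_hellinger (κ : ℝ) :
    Measurable fun q : ℝ × ℝ × ℝ => hellinger (M.Phi P) κ q.1 q.2.1 q.2.2 := by
  have hΦ : Measurable (M.Phi P) := (LikelihoodAssumptions.monotone_Phi M P).measurable
  unfold hellinger logLikTerm
  fun_prop

/-- The mean of `hellinger` is positive away from the truth. -/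
theorem hellinger_mean_pos (hs : M.SamplingAssumptions P δ Slam)
    (hl : M.LikelihoodAssumptions P Ξl Ξu c B bL bU) {T : ℕ} {u v : ℝ}
    (hu : u ∈ Set.Icc (Ξl T) (Ξu T)) :
    0 ≤ M.Phi P u * hellinger (M.Phi P) (c ^ 2 / B) 1 u v +
        (1 - M.Phi P u) * hellinger (M.Phi P) (c ^ 2 / B) 0 u v ∧
      (M.Phi P u * hellinger (M.Phi P) (c ^ 2 / B) 1 u v +
        (1 - M.Phi P u) * hellinger (M.Phi P) (c ^ 2 / B) 0 u v = 0 → v = u) := by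
  have hΦu := hl.Phi_mem u
  have hΦv := hl.Phi_mem v
  have hε := hs.measurable_ε 0
  have e : ∀ y ∈ ({0, 1} : Set ℝ), max (c ^ 2 / B) (Real.exp (logLikTerm (M.Phi P) y u)) =
      Real.exp (logLikTerm (M.Phi P) y u) := fun y hy => max_eq_right (hl.lik_lower hε T hu hy)
  have hhalf : ∀ y x, Real.exp (logLikTerm (M.Phi P) y x / 2) =
      √(Real.exp (logLikTerm (M.Phi P) y x)) := fun y x => Real.exp_half _
  -- on `Ξ_T` the lower bound `c² / B` is not binding, and the mean is a squared distance
  have key : M.Phi P u * hellinger (M.Phi P) (c ^ 2 / B) 1 u v +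
      (1 - M.Phi P u) * hellinger (M.Phi P) (c ^ 2 / B) 0 u v =
      (√(M.Phi P u) - √(M.Phi P v)) ^ 2 + (√(1 - M.Phi P u) - √(1 - M.Phi P v)) ^ 2 := by
    unfold hellinger
    rw [e 1 (by simp), e 0 (by simp), hhalf, hhalf, hl.exp_logLikTerm_one, hl.exp_logLikTerm_zero,
      hl.exp_logLikTerm_one, hl.exp_logLikTerm_zero]
    have s1 := Real.sq_sqrt hΦu.1.le
    have s2 := Real.sq_sqrt hΦv.1.le
    have s3 := Real.sq_sqrt (show 0 ≤ 1 - M.Phi P u by linarith [hΦu.2])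
    have s4 := Real.sq_sqrt (show 0 ≤ 1 - M.Phi P v by linarith [hΦv.2])
    have p1 := Real.sqrt_pos.2 hΦu.1
    have p3 := Real.sqrt_pos.2 (show 0 < 1 - M.Phi P u by linarith [hΦu.2])
    set a := √(M.Phi P u)
    set b := √(M.Phi P v)
    set a' := √(1 - M.Phi P u)
    set b' := √(1 - M.Phi P v)
    have q1 : M.Phi P u * (2 * (1 - b / a)) = 2 * (a ^ 2 - a * b) := by
      rw [← s1]; field_simp
    have q2 : (1 - M.Phi P u) * (2 * (1 - b' / a')) = 2 * (a' ^ 2 - a' * b') := by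
      rw [← s3]; field_simp
    rw [q1, q2]
    linarith
  rw [key]
  refine ⟨by positivity, fun h0 => ?_⟩
  by_contra hne
  refine hl.Phi_ne hε T hu hne ?_
  have h1 : (√(M.Phi P u) - √(M.Phi P v)) ^ 2 = 0 := by
    nlinarith [sq_nonneg (√(M.Phi P u) - √(M.Phi P v)),
      sq_nonneg (√(1 - M.Phi P u) - √(1 - M.Phi P v))]
  have h2 : √(M.Phi P v) = √(M.Phi P u) := by
    have := pow_eq_zero_iff two_ne_zero |>.1 h1
    linarith
  exact (Real.sqrt_inj hΦv.1.le hΦu.1.le).1 h2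

/-- Coefficients at a moderate distance from the truth are separated from it in the Hellinger
distance. -/
theorem exists_lower_bound_hellinger (hs : M.SamplingAssumptions P δ Slam)
    (hl : M.LikelihoodAssumptions P Ξl Ξu c B bL bU) (hc : M.CovarianceAssumptions P Ωβ)
    {ε : ℝ} (hε : 0 < ε) (R : ℝ) :
    ∃ c₃ : ℝ, 0 < c₃ ∧ Tendsto (fun n : ℕ => P {ω | ¬ ∀ θ : CoefSpace p d,
      ε ≤ ‖θ - M.βVec‖ → ‖θ‖ ≤ R → c₃ * n ≤ ∑ t ∈ Finset.range n,
        hellinger (M.Phi P) (c ^ 2 / B) (M.yLead t ω) (inner ℝ M.βVec (regVec (M.state t ω)))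
          (inner ℝ θ (regVec (M.state t ω)))}) atTop (𝓝 0) := by
  have hκ : 0 < c ^ 2 / B := div_pos (pow_pos hl.c_pos 2) hl.B_pos
  obtain ⟨G, hG⟩ : ∃ G : CoefSpace p d → ℝ → CoefSpace p d → ℝ, ∀ θ y z, G θ y z =
    hellinger (M.Phi P) (c ^ 2 / B) y (inner ℝ M.βVec z) (inner ℝ θ z) := ⟨_, fun _ _ _ => rfl⟩
  have hGm : ∀ a, Measurable fun q : ℝ × CoefSpace p d => G a q.1 q.2 := fun a => by
    have hi : ∀ a : CoefSpace p d, Measurable fun q : ℝ × CoefSpace p d => (inner ℝ a q.2 : ℝ) :=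
      fun a => Measurable.inner measurable_const measurable_snd
    have hq : Measurable fun q : ℝ × CoefSpace p d =>
        (q.1, (inner ℝ M.βVec q.2 : ℝ), (inner ℝ a q.2 : ℝ)) :=
      measurable_fst.prodMk ((hi _).prodMk (hi _))
    simp only [hG]
    have hcomp := (measurable_hellinger (M := M) (P := P) (c ^ 2 / B)).comp hq
    simpa only [Function.comp_def] using hcomp
  have hcomp : IsCompact {θ : CoefSpace p d | ε ≤ ‖θ - M.βVec‖ ∧ ‖θ‖ ≤ R} := by
    have : {θ : CoefSpace p d | ε ≤ ‖θ - M.βVec‖ ∧ ‖θ‖ ≤ R} =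
        {θ | ε ≤ ‖θ - M.βVec‖} ∩ Metric.closedBall 0 R := by
      ext θ; simp
    rw [this]
    exact (isCompact_closedBall 0 R).inter_left
      (isClosed_le continuous_const (by fun_prop))
  have hpair : Measurable fun q : State p d × State p d => (response M.βVec q, regVec q.1) :=
    (measurable_response _).prodMk (measurable_regVec.comp measurable_fst)
  set L := 2 * √B / √(c ^ 2 / B) with hL
  have hL0 : 0 ≤ L := by positivity
  have hGC : ∀ a, ∀ y ∈ ({0, 1} : Set ℝ), ∀ z, |G a y z| ≤ 2 * (1 + 1 / √(c ^ 2 / B)) :=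
    fun a y hy z => by rw [hG]; exact hl.abs_hellinger_le hy hκ _ _
  have hGL : ∀ a a', ∀ y ∈ ({0, 1} : Set ℝ), ∀ z,
      |G a y z - G a' y z| ≤ dist a a' * (L * ‖z‖) := fun a a' y hy z => by
    rw [hG, hG]
    refine (hl.hellinger_lipschitz hy hκ _ _ _).trans ?_
    have := mul_le_mul_of_nonneg_left (abs_inner_sub_inner_le a a' z) hL0
    linarith
  have hpos : ∀ θ ∈ {θ : CoefSpace p d | ε ≤ ‖θ - M.βVec‖ ∧ ‖θ‖ ≤ R},
      0 < ∫ ω, G θ (response M.βVec (M.state 0 ω, M.state M.h ω)) (regVec (M.state 0 ω)) ∂P := by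
    intro θ hθ
    have ha0 : θ - M.βVec ≠ 0 := fun h => by
      have := hθ.1
      rw [h, norm_zero] at this
      linarith
    obtain ⟨hi, he⟩ := integral_response hs hl (G := G θ)
      (fun y => (hGm θ).comp (measurable_const.prodMk measurable_id)) (hGC θ)
    rw [he]
    refine integral_pos_of_inner_eq_zero hc ha0 hi ?_ ?_
    · filter_upwards [ae_mem_support hs hl 0] with ω hω
      obtain ⟨T, hT⟩ := hω
      simp only [hG, inner_βVec]
      exact (hellinger_mean_pos hs hl hT).1
    · filter_upwards [ae_mem_support hs hl 0] with ω hω hz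
      obtain ⟨T, hT⟩ := hω
      simp only [hG, inner_βVec] at hz
      have := (hellinger_mean_pos hs hl hT).2 hz
      rw [inner_sub_left, this, inner_βVec, sub_self]
  obtain ⟨c₃, hc₃, h⟩ := exists_uniform_lower_bound hs.measurable_state hs.stationary_state
    hs.summable_mixing_state M.h hcomp
    (Ψ := fun a q => G a (response M.βVec q) (regVec q.1)) (fun a => (hGm a).comp hpair)
    (fun a q => hGC a _ (response_mem _ _) _)
    (b := fun s => L * ‖regVec s‖) measurable_norm_regVec
    (fun s => by positivity) ((integrable_norm_regVec hs hl hc).const_mul L)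
    (fun a a' q => hGL a a' _ (response_mem _ _) _) hpos
  refine ⟨c₃, hc₃, h.congr fun n => ?_⟩
  simp only [Set.mem_ofPred_eq, and_imp, yLead_eq, hG]

end FactorBinaryModel

/-! ### Stochastic bounds for the sample -/

/-- The quadratic form of a positive definite matrix is bounded below by a multiple of the squared
norm. -/
theorem exists_posDef_lower_bound {d : ℕ} {S : Matrix (Fin d) (Fin d) ℝ} (hS : S.PosDef) :
    ∃ k : ℝ, 0 < k ∧ ∀ a : EuclideanSpace ℝ (Fin d),
      k * ‖a‖ ^ 2 ≤ ∑ i, ∑ j, a i * a j * S i j := by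
  set q : EuclideanSpace ℝ (Fin d) → ℝ := fun a => ∑ i, ∑ j, a i * a j * S i j with hq
  have hcont : Continuous q := by fun_prop
  have hpos : ∀ a, a ≠ 0 → 0 < q a := fun a ha => by
    have := hS.dotProduct_mulVec_pos (x := WithLp.ofLp a)
      (fun h => ha ((WithLp.ofLp_eq_zero 2).1 h))
    simp only [dotProduct, Matrix.mulVec, Pi.star_apply, star_trivial, Finset.mul_sum] at this
    refine this.trans_le (le_of_eq ?_)
    exact Finset.sum_congr rfl fun i _ => Finset.sum_congr rfl fun j _ => by ring
  have hhom : ∀ (r : ℝ) a, q (r • a) = r ^ 2 * q a := fun r a => by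
    simp only [hq, Finset.mul_sum, PiLp.smul_apply, smul_eq_mul]
    exact Finset.sum_congr rfl fun i _ => Finset.sum_congr rfl fun j _ => by ring
  rcases (Metric.sphere (0 : EuclideanSpace ℝ (Fin d)) 1).eq_empty_or_nonempty with he | hne
  · refine ⟨1, one_pos, fun a => ?_⟩
    by_cases ha : a = 0
    · simp [ha]
    · have : ‖a‖⁻¹ • a ∈ Metric.sphere (0 : EuclideanSpace ℝ (Fin d)) 1 := by
        simp [norm_smul, ha]
      rw [he] at this
      exact absurd this (Set.notMem_empty _)
  · obtain ⟨a₀, ha₀, hmin⟩ := (isCompact_sphere (0 : EuclideanSpace ℝ (Fin d)) 1).exists_isMinOn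
      hne hcont.continuousOn
    refine ⟨q a₀, hpos a₀ (fun h => by simp [h] at ha₀), fun a => ?_⟩
    by_cases ha : a = 0
    · simp [ha]
    · have hn : ‖a‖ ≠ 0 := norm_ne_zero_iff.2 ha
      have hmem : ‖a‖⁻¹ • a ∈ Metric.sphere (0 : EuclideanSpace ℝ (Fin d)) 1 := by
        simp [norm_smul, ha]
      have h1 : q a₀ ≤ q (‖a‖⁻¹ • a) := hmin hmem
      rw [hhom] at h1
      calc q a₀ * ‖a‖ ^ 2 ≤ ‖a‖⁻¹ ^ 2 * q a * ‖a‖ ^ 2 := by gcongr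
        _ = q a := by field_simp

section Markov

variable {Ω : Type*} [mΩ : MeasurableSpace Ω] {P : Measure Ω} [IsProbabilityMeasure P]

/-- Markov's inequality with the level that makes the probability at most `η`. -/
theorem measure_mul_lt_le {X : Ω → ℝ} (hX : Integrable X P) (h0 : ∀ ω, 0 ≤ X ω) {C r η : ℝ}
    (hC0 : 0 ≤ C) (hr : 0 < r) (hη : 0 < η) (hC : ∫ ω, X ω ∂P ≤ C * r) :
    P {ω | (C + 1) / η * r < X ω} ≤ ENNReal.ofReal η := by
  refine (measure_lt_le_of_integral_le hX h0 hC (by positivity)).trans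
    (ENNReal.ofReal_le_ofReal ?_)
  rw [div_le_iff₀ (by positivity)]
  have : η * ((C + 1) / η * r) = (C + 1) * r := by field_simp
  rw [this]
  nlinarith

theorem measure_sum_mul_lt_le {Y : ℕ → Ω → ℝ} {C : ℝ} (hC0 : 0 ≤ C)
    (hY : ∀ t, Integrable (Y t) P) (h0 : ∀ t ω, 0 ≤ Y t ω) (hC : ∀ t, ∫ ω, Y t ω ∂P ≤ C) {η : ℝ}
    (hη : 0 < η) {T : ℕ} (hT : 0 < T) :
    P {ω | (C + 1) / η * T < ∑ t ∈ Finset.range T, Y t ω} ≤ ENNReal.ofReal η := by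
  refine measure_mul_lt_le (integrable_finsetSum _ fun t _ => hY t)
    (fun ω => Finset.sum_nonneg fun t _ => h0 t ω) hC0 (by exact_mod_cast hT) hη ?_
  rw [integral_finsetSum _ fun t _ => hY t]
  calc _ ≤ ∑ t ∈ Finset.range T, C := Finset.sum_le_sum fun t _ => hC t
    _ = C * T := by simp [mul_comm]

end Markov

theorem tailSq_nonneg {E : Type*} [NormedAddCommGroup E] (K : ℝ) (z : E) : 0 ≤ tailSq K z := by
  unfold tailSq; split_ifs <;> positivity

theorem tailSq_le {E : Type*} [NormedAddCommGroup E] (K : ℝ) (z : E) : tailSq K z ≤ ‖z‖ ^ 2 := by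
  unfold tailSq; split_ifs
  · exact le_rfl
  · positivity

theorem filter_range_add_lt (T h : ℕ) :
    (Finset.range T).filter (fun t => t + h < T) = Finset.range (T - h) := by
  ext t; simp only [Finset.mem_filter, Finset.mem_range]; omega

namespace FactorBinaryModel

variable {Ω : Type*} {p d : ℕ} [mΩ : MeasurableSpace Ω] {M : FactorBinaryModel Ω p d}
  {P : Measure Ω} [IsProbabilityMeasure P] {δ : ℝ} {Slam : Matrix (Fin d) (Fin d) ℝ}
  {Ξl Ξu : ℕ → ℝ} {c B bL bU : ℝ} {Ωβ : Matrix (Coef p d) (Coef p d) ℝ}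

/-- With probability tending to one, all indices of the sample lie in `Ξ_T`. -/
theorem tendsto_support_compl (hs : M.SamplingAssumptions P δ Slam)
    (hl : M.LikelihoodAssumptions P Ξl Ξu c B bL bU) :
    Tendsto (fun T : ℕ => P {ω | ¬ ∀ t < T, M.u t ω ∈ Set.Icc (Ξl T) (Ξu T)}) atTop (𝓝 0) := by
  have hm : ∀ T : ℕ, MeasurableSet {ω | ∀ t < T, M.u t ω ∈ Set.Icc (Ξl T) (Ξu T)} := fun T => by
    have : {ω | ∀ t < T, M.u t ω ∈ Set.Icc (Ξl T) (Ξu T)} =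
        ⋂ t, ⋂ _ : t < T, M.u t ⁻¹' Set.Icc (Ξl T) (Ξu T) := by ext ω; simp
    rw [this]
    exact MeasurableSet.iInter fun t => MeasurableSet.iInter fun _ =>
      hs.measurable_u t measurableSet_Icc
  have h1 := ENNReal.Tendsto.sub (tendsto_const_nhds (x := (1 : ℝ≥0∞)) (f := atTop)) hl.support
    (Or.inl ENNReal.one_ne_top)
  rw [tsub_self] at h1
  exact h1.congr fun T => (prob_compl_eq_one_sub (hm T)).symm

theorem measurable_tailSq_regVec (hs : M.SamplingAssumptions P δ Slam) (K : ℝ) (t : ℕ) :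
    Measurable fun ω => tailSq K (regVec (M.state t ω)) := by
  have := (measurable_regVec.comp (hs.measurable_state t)).norm
  exact Measurable.ite (measurableSet_lt measurable_const this) (this.pow_const 2) measurable_const

/-- The square of the regressors is uniformly integrable. -/
theorem exists_tail_level (hs : M.SamplingAssumptions P δ Slam)
    (hl : M.LikelihoodAssumptions P Ξl Ξu c B bL bU) (hc : M.CovarianceAssumptions P Ωβ) {s η : ℝ}
    (hs0 : 0 < s) (hη : 0 < η) :
    ∃ K : ℝ, 1 ≤ K ∧ ∀ n : ℕ, 0 < n → P {ω | s * n <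
      ∑ t ∈ Finset.range n, tailSq K (regVec (M.state t ω))} ≤ ENNReal.ofReal η := by
  have hint := integrable_sq_regVec hs hl hc
  have hlim : Tendsto (fun k : ℕ => ∫ ω, tailSq (k : ℝ) (regVec (M.state 0 ω)) ∂P) atTop (𝓝 0) := by
    have := tendsto_integral_of_dominated_convergence (μ := P) (f := fun _ => (0 : ℝ))
      (F := fun (k : ℕ) ω => tailSq (k : ℝ) (regVec (M.state 0 ω)))
      (fun ω => ‖regVec (M.state 0 ω)‖ ^ 2)
      (fun k => (measurable_tailSq_regVec hs k 0).aestronglyMeasurable) (hint 0)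
      (fun k => Eventually.of_forall fun ω => by
        rw [Real.norm_eq_abs, abs_of_nonneg (tailSq_nonneg _ _)]; exact tailSq_le _ _)
      (Eventually.of_forall fun ω => by
        refine tendsto_const_nhds.congr' ?_
        filter_upwards [eventually_ge_atTop ⌈‖regVec (M.state 0 ω)‖⌉₊] with k hk
        have : ‖regVec (M.state 0 ω)‖ ≤ k := (Nat.le_ceil _).trans (by exact_mod_cast hk)
        simp [tailSq, not_lt.2 this])
    simpa using this
  obtain ⟨k, hk, hk1⟩ := ((hlim.eventually (gt_mem_nhds (mul_pos hs0 hη))).and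
    (eventually_ge_atTop 1)).exists
  refine ⟨k, by exact_mod_cast hk1, fun n hn => ?_⟩
  have hi : ∀ t, Integrable (fun ω => tailSq (k : ℝ) (regVec (M.state t ω))) P := fun t =>
    (hint t).mono' (measurable_tailSq_regVec hs k t).aestronglyMeasurable
      (Eventually.of_forall fun ω => by
        rw [Real.norm_eq_abs, abs_of_nonneg (tailSq_nonneg _ _)]; exact tailSq_le _ _)
  have hm : Measurable fun q : State p d × State p d => tailSq (k : ℝ) (regVec q.1) := by
    have : Measurable fun q : State p d × State p d => ‖regVec q.1‖ :=
      measurable_regVec.norm.comp measurable_fst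
    exact Measurable.ite (measurableSet_lt measurable_const this) (this.pow_const 2)
      measurable_const
  have he : ∀ t, ∫ ω, tailSq (k : ℝ) (regVec (M.state t ω)) ∂P =
      ∫ ω, tailSq (k : ℝ) (regVec (M.state 0 ω)) ∂P := fun t =>
    hs.stationary_state.integral_pair_eq hs.measurable_state 0 t hm
  have hn' : (0 : ℝ) < n := by exact_mod_cast hn
  refine (measure_lt_le_of_integral_le (C := s * η * n)
    (integrable_finsetSum _ fun t _ => hi t)
    (fun ω => Finset.sum_nonneg fun t _ => tailSq_nonneg _ _) ?_ (by positivity)).trans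
    (le_of_eq ?_)
  · rw [integral_finsetSum _ fun t _ => hi t]
    calc _ ≤ ∑ t ∈ Finset.range n, s * η := Finset.sum_le_sum fun t _ => (he t).trans_le hk.le
      _ = s * η * n := by simp [mul_comm]
  · congr 1; field_simp

/-- The score is of the order `√T`. -/
theorem exists_score_bound
    (hc : M.CovarianceAssumptions P Ωβ) :
    ∃ C : ℝ, 0 ≤ C ∧ ∀ η : ℝ, 0 < η → ∀ᶠ T : ℕ in atTop, P {ω | (C + 1) / η * T <
      ∑ a, (∑ t ∈ Finset.range (T - M.h), M.score P t ω a) ^ 2} ≤ ENNReal.ofReal η := by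
  -- the mean square of the score divided by `T` converges to the trace of the long-run variance
  set C := ∑ a, (|Ωβ a a| + 1) with hC
  refine ⟨C, Finset.sum_nonneg fun a _ => by positivity, fun η hη => ?_⟩
  have hev : ∀ a, ∀ᶠ T : ℕ in atTop, (T : ℝ)⁻¹ * ∑ s ∈ Finset.range (T - M.h),
      ∑ t ∈ Finset.range (T - M.h), ∫ ω, M.score P t ω a * M.score P s ω a ∂P ≤
        |Ωβ a a| + 1 := fun a => by
    have := hc.tendsto_score a a
    simp only [filter_range_add_lt] at this
    filter_upwards [this.eventually (gt_mem_nhds (show Ωβ a a < |Ωβ a a| + 1 by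
      linarith [le_abs_self (Ωβ a a)]))] with T hT using hT.le
  filter_upwards [eventually_all.2 hev, eventually_gt_atTop 0] with T hT hT0
  have hT' : (0 : ℝ) < T := by exact_mod_cast hT0
  have hsq := fun a => integrable_sq_sum (P := P) (Finset.range (T - M.h))
    (X := fun t ω => M.score P t ω a)
    (b := fun s t => ∫ ω, M.score P s ω a * M.score P t ω a ∂P)
    (fun s _ t _ => hc.integrable_score t s a a) (fun s _ t _ => le_rfl)
  refine measure_mul_lt_le (integrable_finsetSum _ fun a _ => (hsq a).1)
    (fun ω => Finset.sum_nonneg fun a _ => sq_nonneg _) (Finset.sum_nonneg fun a _ => by positivity)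
    hT' hη ?_
  rw [integral_finsetSum _ fun a _ => (hsq a).1, Finset.sum_mul]
  refine Finset.sum_le_sum fun a _ => (hsq a).2.trans ?_
  have := hT a
  rw [inv_mul_le_iff₀ hT', mul_comm (T : ℝ)] at this
  rw [Finset.sum_comm]
  exact this

/-- The loadings span all directions. -/
theorem exists_loading_bound (hs : M.SamplingAssumptions P δ Slam) :
    ∃ k : ℝ, 0 < k ∧ Tendsto (fun N : ℕ => P {ω | ¬ ∀ a : EuclideanSpace ℝ (Fin d),
      k * N * ‖a‖ ^ 2 ≤ ∑ i ∈ Finset.range N, (inner ℝ (M.lam i ω) a) ^ 2}) atTop (𝓝 0) := by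
  obtain ⟨k, hk, hS⟩ := exists_posDef_lower_bound hs.posDef_Slam
  -- entrywise errors up to `ζ` change the quadratic form by at most `ζ * d * ‖a‖²`
  set ζ := k / (2 * ((d : ℝ) + 1)) with hζ
  have hζ0 : 0 < ζ := by positivity
  refine ⟨k / 2, by positivity, ?_⟩
  have hab : ∀ q : Fin d × Fin d, Tendsto (fun N : ℕ => P {ω | ζ < |(N : ℝ)⁻¹ *
      ∑ i ∈ Finset.range N, M.lam i ω q.1 * M.lam i ω q.2 - Slam q.1 q.2|}) atTop (𝓝 0) := by
    intro q
    refine tendsto_measure_zero_of_forall fun η hη => ?_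
    obtain ⟨K, hK, hev⟩ := hs.loadings q.1 q.2 η hη
    have h0 : Tendsto (fun N : ℕ => K * (1 / √(N : ℝ))) atTop (𝓝 0) := by
      have := (tendsto_inv_atTop_zero.comp (Real.tendsto_sqrt_atTop.comp
        (tendsto_natCast_atTop_atTop (R := ℝ)))).const_mul K
      simpa [Function.comp_def] using this
    filter_upwards [hev, h0.eventually (gt_mem_nhds hζ0)] with N hN hNζ
    exact (measure_mono fun ω hω => hNζ.trans hω).trans hN
  have hsum : Tendsto (fun N : ℕ => ∑ q : Fin d × Fin d, P {ω | ζ < |(N : ℝ)⁻¹ *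
      ∑ i ∈ Finset.range N, M.lam i ω q.1 * M.lam i ω q.2 - Slam q.1 q.2|}) atTop (𝓝 0) := by
    simpa using tendsto_finsetSum Finset.univ fun q _ => hab q
  refine tendsto_of_tendsto_of_tendsto_of_le_of_le' tendsto_const_nhds hsum
    (Eventually.of_forall fun N => zero_le) ?_
  filter_upwards [eventually_gt_atTop 0] with N hN
  have hN' : (0 : ℝ) < N := by exact_mod_cast hN
  refine le_trans (measure_mono fun ω hω => ?_) (measure_iUnion_fintype_le P _)
  rw [Set.mem_iUnion]
  by_contra hno
  refine hω fun a => ?_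
  have hclose : ∀ i j, |(N : ℝ)⁻¹ * ∑ l ∈ Finset.range N, M.lam l ω i * M.lam l ω j -
      Slam i j| ≤ ζ := fun i j => not_lt.1 fun h => hno ⟨(i, j), h⟩
  have hexp : ∑ l ∈ Finset.range N, (inner ℝ (M.lam l ω) a) ^ 2 =
      N * ∑ i, ∑ j, a i * a j * ((N : ℝ)⁻¹ * ∑ l ∈ Finset.range N,
        M.lam l ω i * M.lam l ω j) := by
    have e1 : ∀ l, (inner ℝ (M.lam l ω) a : ℝ) ^ 2 =
        ∑ i, ∑ j, a i * a j * (M.lam l ω i * M.lam l ω j) := fun l => by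
      rw [PiLp.inner_apply, sq, Finset.sum_mul_sum]
      refine Finset.sum_congr rfl fun i _ => Finset.sum_congr rfl fun j _ => ?_
      simp only [RCLike.inner_apply, conj_trivial]
      ring
    simp_rw [e1]
    rw [Finset.sum_comm, Finset.mul_sum]
    refine Finset.sum_congr rfl fun i _ => ?_
    rw [Finset.sum_comm, Finset.mul_sum]
    refine Finset.sum_congr rfl fun j _ => ?_
    rw [← Finset.mul_sum]
    field_simp
  have hdiff : ∑ i, ∑ j, a i * a j * Slam i j - ζ * (d * ‖a‖ ^ 2) ≤
      ∑ i, ∑ j, a i * a j * ((N : ℝ)⁻¹ * ∑ l ∈ Finset.range N, M.lam l ω i * M.lam l ω j) := by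
    have hle : ∀ i j, a i * a j * Slam i j - ζ * (|a i| * |a j|) ≤
        a i * a j * ((N : ℝ)⁻¹ * ∑ l ∈ Finset.range N, M.lam l ω i * M.lam l ω j) := fun i j => by
      have h1 := mul_le_mul_of_nonneg_left (hclose i j) (mul_nonneg (abs_nonneg (a i))
        (abs_nonneg (a j)))
      rw [← abs_mul, ← abs_mul] at h1
      have h2 := neg_abs_le (a i * a j * ((N : ℝ)⁻¹ * ∑ l ∈ Finset.range N,
        M.lam l ω i * M.lam l ω j - Slam i j))
      rw [mul_sub] at h2 h1
      rw [← abs_mul]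
      linarith
    have hsq : ∑ i, ∑ j, |a i| * |a j| ≤ d * ‖a‖ ^ 2 := by
      rw [← Finset.sum_mul_sum, ← sq, EuclideanSpace.norm_sq_eq]
      have := sq_sum_le_card_mul_sum_sq (s := (Finset.univ : Finset (Fin d)))
        (f := fun i => |a i|)
      simpa using this
    have h3 := Finset.sum_le_sum fun i (_ : i ∈ Finset.univ) =>
      Finset.sum_le_sum fun j (_ : j ∈ Finset.univ) => hle i j
    simp only [Finset.sum_sub_distrib, ← Finset.mul_sum] at h3
    have h4 := mul_le_mul_of_nonneg_left hsq hζ0.le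
    simp only [Finset.mul_sum] at h3 h4 ⊢
    linarith
  rw [hexp]
  have hζd : ζ * (d * ‖a‖ ^ 2) ≤ k / 2 * ‖a‖ ^ 2 := by
    have : ζ * d ≤ k / 2 := by
      rw [hζ, div_mul_eq_mul_div, div_le_iff₀ (by positivity)]
      nlinarith
    nlinarith [sq_nonneg ‖a‖]
  have h5 := mul_le_mul_of_nonneg_left ((sub_le_sub (hS a) hζd).trans hdiff) hN'.le
  refine le_trans (le_of_eq ?_) h5
  ring

end FactorBinaryModel

/-! ### The likelihood in rotated coefficients -/

/-- A vector of factor coordinates as a vector of coefficients that vanish elsewhere. -/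
def padVec {p d : ℕ} (r : EuclideanSpace ℝ (Fin d)) : CoefSpace p d :=
  WithLp.toLp 2 (Sum.elim (fun _ => 0) (Sum.elim (fun _ => 0) fun j => r j))

/-- The coefficients `b` with the block of the factors transformed by `A`. If the estimated
factors are close to a rotation of the true ones, a suitable `A` makes the coefficients of the
estimated factors comparable to those of the true factors. -/
def reparam {p d : ℕ} (A : EuclideanSpace ℝ (Fin d) ≃ₗ[ℝ] EuclideanSpace ℝ (Fin d))
    (b : Coef p d → ℝ) : CoefSpace p d :=
  WithLp.toLp 2 (Sum.elim (fun u => b (Sum.inl u)) (Sum.elim (fun j => b (Sum.inr (Sum.inl j)))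
    fun j => A (WithLp.toLp 2 fun j => b (Sum.inr (Sum.inr j))) j))

theorem norm_padVec_sq {p d : ℕ} (r : EuclideanSpace ℝ (Fin d)) :
    ‖padVec (p := p) r‖ ^ 2 = ‖r‖ ^ 2 := by
  rw [EuclideanSpace.norm_sq_eq, EuclideanSpace.norm_sq_eq]
  simp [padVec]

theorem norm_padVec {p d : ℕ} (r : EuclideanSpace ℝ (Fin d)) : ‖padVec (p := p) r‖ = ‖r‖ := by
  have := norm_padVec_sq (p := p) r
  rwa [sq_eq_sq₀ (norm_nonneg _) (norm_nonneg _)] at this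

theorem inner_padVec_regVec {p d : ℕ} (a : EuclideanSpace ℝ (Fin d)) (s : State p d) :
    inner ℝ (padVec a) (regVec s) = (inner ℝ s.2.1 a : ℝ) := by
  rw [PiLp.inner_apply, PiLp.inner_apply]
  simp [padVec, regVec, regressor, mul_comm]

theorem reparam_surjective {p d : ℕ}
    (A : EuclideanSpace ℝ (Fin d) ≃ₗ[ℝ] EuclideanSpace ℝ (Fin d)) :
    Function.Surjective (reparam (p := p) A) := by
  intro θ
  refine ⟨Sum.elim (fun u => θ (Sum.inl u)) (Sum.elim (fun j => θ (Sum.inr (Sum.inl j)))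
    fun j => A.symm (WithLp.toLp 2 fun j => θ (Sum.inr (Sum.inr j))) j), ?_⟩
  ext k
  rcases k with u | j | j
  · rfl
  · rfl
  · change A (A.symm (WithLp.toLp 2 fun j => θ (Sum.inr (Sum.inr j)))) j = _
    rw [A.apply_symm_apply]

/-- The index computed from estimated factors is an inner product with perturbed true regressors. -/
theorem dotProduct_regressor_eq {p d : ℕ}
    {A : EuclideanSpace ℝ (Fin d) ≃ₗ[ℝ] EuclideanSpace ℝ (Fin d)} {s : State p d}
    {g r : EuclideanSpace ℝ (Fin d)} (h : ∀ b, inner ℝ b g = (inner ℝ (A b) (s.2.1 + r) : ℝ))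
    (b : Coef p d → ℝ) :
    b ⬝ᵥ regressor s.1 g = inner ℝ (reparam A b) (regVec s + padVec r) := by
  have hb := h (WithLp.toLp 2 fun j => b (Sum.inr (Sum.inr j)))
  rw [PiLp.inner_apply, PiLp.inner_apply] at hb
  rw [PiLp.inner_apply]
  simp only [RCLike.inner_apply, conj_trivial, PiLp.add_apply] at hb
  simp only [dotProduct, Fintype.sum_sum_type, regressor, reparam, regVec, padVec,
    RCLike.inner_apply, conj_trivial, PiLp.add_apply, Sum.elim_inl, Sum.elim_inr, add_zero]
  rw [← hb]
  simp only [mul_comm]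

namespace FactorBinaryModel

variable {Ω : Type*} {p d : ℕ} [mΩ : MeasurableSpace Ω] {M : FactorBinaryModel Ω p d}
  {P : Measure Ω} [IsProbabilityMeasure P] {Ξl Ξu : ℕ → ℝ} {c B bL bU : ℝ}
  {T : ℕ} {ω : Ω} {g ρ : ℕ → EuclideanSpace ℝ (Fin d)}
  {A : EuclideanSpace ℝ (Fin d) ≃ₗ[ℝ] EuclideanSpace ℝ (Fin d)}

/-- The log-likelihood with estimated factors, as a function of the rotated coefficients, is one
with regressors that are observed with an error. -/
theorem logLik_eq
    (hA : ∀ t < T, ∀ b, inner ℝ b (g t) = (inner ℝ (A b) (M.f t ω + ρ t) : ℝ))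
    (b : Coef p d → ℝ) :
    M.logLik P T ω g b = ∑ t ∈ Finset.range (T - M.h), logLikTerm (M.Phi P) (M.yLead t ω)
      (inner ℝ (reparam A b) (regVec (M.state t ω) + padVec (ρ t))) := by
  rw [logLik, filter_range_add_lt]
  refine Finset.sum_congr rfl fun t ht => ?_
  rw [← dotProduct_regressor_eq (s := M.state t ω) (g := g t)
    (hA t (by have := Finset.mem_range.1 ht; omega)) b]
  rfl

/-- If the likelihood is smaller than at the truth outside a ball, a maximizer exists, and all
maximizers lie in the ball. -/
theorem exists_isMaxOn_logLik (hl : M.LikelihoodAssumptions P Ξl Ξu c B bL bU)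
    (hA : ∀ t < T, ∀ b, inner ℝ b (g t) = (inner ℝ (A b) (M.f t ω + ρ t) : ℝ)) {r : ℝ}
    (hr : 0 ≤ r)
    (hlt : ∀ θ : CoefSpace p d, r < ‖θ - M.βVec‖ →
      ∑ t ∈ Finset.range (T - M.h), logLikTerm (M.Phi P) (M.yLead t ω)
        (inner ℝ θ (regVec (M.state t ω) + padVec (ρ t))) <
      ∑ t ∈ Finset.range (T - M.h), logLikTerm (M.Phi P) (M.yLead t ω)
        (inner ℝ M.βVec (regVec (M.state t ω) + padVec (ρ t)))) :
    (∃ b, IsMaxOn (M.logLik P T ω g) Set.univ b) ∧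
      ∀ b, IsMaxOn (M.logLik P T ω g) Set.univ b → ‖reparam A b - M.βVec‖ ≤ r := by
  obtain ⟨Q, hQ⟩ : ∃ Q : CoefSpace p d → ℝ, ∀ θ, Q θ =
      ∑ t ∈ Finset.range (T - M.h), logLikTerm (M.Phi P) (M.yLead t ω)
        (inner ℝ θ (regVec (M.state t ω) + padVec (ρ t))) := ⟨_, fun _ => rfl⟩
  have hlog : ∀ b, M.logLik P T ω g b = Q (reparam A b) := fun b => by rw [logLik_eq hA, hQ]
  have hcont : Continuous Q := by
    rw [funext hQ]
    refine continuous_finsetSum _ fun t _ => ?_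
    exact (hl.l_smooth _ (M.yLead_mem t ω)).continuous.comp
      (Continuous.inner continuous_id continuous_const)
  simp only [← hQ] at hlt
  constructor
  · obtain ⟨θ, hθ, hmax⟩ := (isCompact_closedBall M.βVec r).exists_isMaxOn
      ⟨M.βVec, Metric.mem_closedBall_self hr⟩ hcont.continuousOn
    obtain ⟨b, rfl⟩ := reparam_surjective A θ
    refine ⟨b, fun b' _ => ?_⟩
    simp only [Set.mem_ofPred_eq, hlog]
    by_cases hb' : ‖reparam A b' - M.βVec‖ ≤ r
    · exact hmax (by rwa [Metric.mem_closedBall, dist_eq_norm])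
    · exact (hlt _ (not_le.1 hb')).le.trans (hmax (Metric.mem_closedBall_self hr))
  · intro b hb
    by_contra hne
    obtain ⟨b₀, hb₀⟩ := reparam_surjective A M.βVec
    have h1 : M.logLik P T ω g b₀ ≤ M.logLik P T ω g b := hb (Set.mem_univ b₀)
    rw [hlog, hlog, hb₀] at h1
    exact absurd (hlt _ (not_le.1 hne)) (not_lt.2 h1)

/-- The prediction error splits into the error of the coefficients and the error of the factors. -/
theorem abs_prediction_error_le (hl : M.LikelihoodAssumptions P Ξl Ξu c B bL bU) {t : ℕ}
    (hA : ∀ b, inner ℝ b (g t) = (inner ℝ (A b) (M.f t ω + ρ t) : ℝ)) (b : Coef p d → ℝ) :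
    |M.Phi P (b ⬝ᵥ regressor (M.w t ω) (g t)) - M.Phi P (M.β ⬝ᵥ M.z t ω)| ≤
      2 * √B * (‖reparam A b - M.βVec‖ * ‖regVec (M.state t ω)‖ +
        (‖M.βVec‖ + ‖reparam A b - M.βVec‖) * ‖ρ t‖) := by
  refine (hl.Phi_lipschitz _ _).trans (mul_le_mul_of_nonneg_left ?_ (by positivity))
  have h1 : b ⬝ᵥ regressor (M.w t ω) (g t) =
      inner ℝ (reparam A b) (regVec (M.state t ω) + padVec (ρ t)) :=
    dotProduct_regressor_eq (s := M.state t ω) hA b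
  have h2 : M.β ⬝ᵥ M.z t ω = inner ℝ M.βVec (regVec (M.state t ω)) := (M.inner_βVec t ω).symm
  rw [h1, h2, inner_add_right, add_sub_right_comm, ← inner_sub_left]
  have h3 : ‖reparam A b‖ ≤ ‖M.βVec‖ + ‖reparam A b - M.βVec‖ := by
    have := norm_add_le M.βVec (reparam A b - M.βVec)
    rwa [add_sub_cancel] at this
  refine (abs_add_le _ _).trans (add_le_add (abs_real_inner_le_norm _ _)
    ((abs_real_inner_le_norm _ _).trans ?_))
  rw [norm_padVec]
  exact mul_le_mul_of_nonneg_right h3 (norm_nonneg _)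

/-- The factors inherit the nondegeneracy of the regressors. -/
theorem factor_lower_bound {n : ℕ} {k : ℝ} (hk : 0 ≤ k) (hn : n ≤ T) (hTn : T ≤ 2 * n)
    (h : ∀ a : CoefSpace p d, ‖a‖ = 1 →
      k * n ≤ ∑ t ∈ Finset.range n, min ((inner ℝ a (regVec (M.state t ω))) ^ 2) 1)
    (a : EuclideanSpace ℝ (Fin d)) :
    k / 2 * T * ‖a‖ ^ 2 ≤ ∑ t ∈ Finset.range T, (inner ℝ (M.f t ω) a) ^ 2 := by
  by_cases ha : a = 0
  · simp [ha]
  have hn0 : 0 < ‖a‖ := norm_pos_iff.2 ha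
  -- the bound is applied in a direction that involves the factors only
  have h1 := h (padVec (‖a‖⁻¹ • a)) (by rw [norm_padVec, norm_smul, norm_inv, norm_norm,
    inv_mul_cancel₀ hn0.ne'])
  have h2 : ∑ t ∈ Finset.range n, min ((inner ℝ (padVec (p := p) (‖a‖⁻¹ • a))
      (regVec (M.state t ω))) ^ 2) 1 ≤ ‖a‖⁻¹ ^ 2 *
        ∑ t ∈ Finset.range T, (inner ℝ (M.f t ω) a) ^ 2 := by
    rw [Finset.mul_sum]
    refine (Finset.sum_le_sum fun t _ => ?_).trans (Finset.sum_le_sum_of_subset_of_nonneg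
      (Finset.range_subset_range.2 hn) fun t _ _ => by positivity)
    refine (min_le_left _ _).trans (le_of_eq ?_)
    rw [inner_padVec_regVec, inner_smul_right, mul_pow]
    rfl
  have h3 := mul_le_mul_of_nonneg_left (h1.trans h2) (sq_nonneg ‖a‖)
  rw [← mul_assoc (‖a‖ ^ 2) (‖a‖⁻¹ ^ 2), ← mul_pow, mul_inv_cancel₀ hn0.ne', one_pow, one_mul] at h3
  refine le_trans ?_ h3
  have hT' : (T : ℝ) ≤ 2 * n := by exact_mod_cast hTn
  have := mul_le_mul_of_nonneg_left hT' (mul_nonneg hk (sq_nonneg ‖a‖))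
  linarith

end FactorBinaryModel

/-! ### The prediction error of a typical sample -/

namespace FactorBinaryModel

variable {Ω : Type*} {p d : ℕ} [mΩ : MeasurableSpace Ω] {M : FactorBinaryModel Ω p d}
  {P : Measure Ω} [IsProbabilityMeasure P]
  {Ξl Ξu : ℕ → ℝ} {c B bL bU : ℝ}

/-- On `Ξ_T` the gradient of the log-likelihood at the truth is the sum of the score
contributions. -/
theorem norm_sum_score_le (hl : M.LikelihoodAssumptions P Ξl Ξu c B bL bU)
    (hε : Measurable (M.ε 0)) {n T : ℕ} {ω : Ω} {C : ℝ}
    (hu : ∀ t < n, M.u t ω ∈ Set.Icc (Ξl T) (Ξu T))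
    (h : ∑ a, (∑ t ∈ Finset.range n, M.score P t ω a) ^ 2 ≤ C) :
    ‖∑ t ∈ Finset.range n, deriv (logLikTerm (M.Phi P) (M.yLead t ω))
      (inner ℝ M.βVec (regVec (M.state t ω))) • regVec (M.state t ω)‖ ≤ √C := by
  refine Real.le_sqrt_of_sq_le (le_trans (le_of_eq ?_) h)
  rw [EuclideanSpace.norm_sq_eq]
  refine Finset.sum_congr rfl fun a _ => ?_
  rw [Real.norm_eq_abs, sq_abs, WithLp.ofLp_sum, Finset.sum_apply]
  congr 1
  refine Finset.sum_congr rfl fun t ht => ?_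
  rw [WithLp.ofLp_smul, Pi.smul_apply, score, Pi.smul_apply,
    hl.score_factor_eq hε T (hu t (Finset.mem_range.1 ht)) (M.yLead_mem t ω), inner_βVec]
  rfl

/-- The prediction error on the event that the sample averages behave as they do with high
probability: it is of the order `τ`, where `τ² = 1 / N + 1 / T`. -/
theorem exists_prediction_bound (hl : M.LikelihoodAssumptions P Ξl Ξu c B bL bU)
    (hε : Measurable (M.ε 0)) {c₁ c₂ kL K : ℝ} (hc₁ : 0 < c₁) (hc₂ : 0 < c₂) (hkL : 0 < kL)
    (hK : 1 ≤ K) :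
    ∃ ε R : ℝ, 0 < ε ∧ ∀ c₃ Cz CS CR CD : ℝ, 0 < c₃ → 0 < Cz → 0 < CS → 0 < CR → 0 < CD →
      ∃ (τ₀ D : ℝ) (T₀ : ℕ), 0 < τ₀ ∧ 0 < D ∧ ∀ (N T : ℕ) (τ : ℝ) (ω : Ω)
        (g : ℕ → EuclideanSpace ℝ (Fin d)) (b : Coef p d → ℝ) (t : ℕ),
      0 < N → T₀ ≤ T → 0 < τ → τ ≤ τ₀ → τ ^ 2 = (N : ℝ)⁻¹ + (T : ℝ)⁻¹ → t < T →
      M.IsPCA N T ω g →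
      ((∃ b, IsMaxOn (M.logLik P T ω g) Set.univ b) → IsMaxOn (M.logLik P T ω g) Set.univ b) →
      (∀ t < T, M.u t ω ∈ Set.Icc (Ξl T) (Ξu T)) →
      ∑ t ∈ Finset.range T, ‖regVec (M.state t ω)‖ ^ 2 ≤ Cz * T →
      ∑ t ∈ Finset.range (T - M.h), tailSq K (regVec (M.state t ω)) ≤
        bL * c₁ / (32 * (bL + B)) * (T - M.h : ℕ) →
      (∀ a : CoefSpace p d, ‖a‖ = 1 → c₁ * (T - M.h : ℕ) ≤
        ∑ t ∈ Finset.range (T - M.h), min ((inner ℝ a (regVec (M.state t ω))) ^ 2) 1) →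
      (∀ a : CoefSpace p d, ‖a‖ = 1 → c₂ * (T - M.h : ℕ) ≤ ∑ t ∈ Finset.range (T - M.h),
        ((1 - M.yLead t ω) * ramp (inner ℝ a (regVec (M.state t ω))) +
          M.yLead t ω * ramp (-inner ℝ a (regVec (M.state t ω))))) →
      (∀ θ : CoefSpace p d, ε ≤ ‖θ - M.βVec‖ → ‖θ‖ ≤ R → c₃ * (T - M.h : ℕ) ≤
        ∑ t ∈ Finset.range (T - M.h), hellinger (M.Phi P) (c ^ 2 / B) (M.yLead t ω)
          (inner ℝ M.βVec (regVec (M.state t ω))) (inner ℝ θ (regVec (M.state t ω)))) →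
      ∑ a, (∑ t ∈ Finset.range (T - M.h), M.score P t ω a) ^ 2 ≤ CS * T →
      (∀ a : EuclideanSpace ℝ (Fin d),
        kL * N * ‖a‖ ^ 2 ≤ ∑ i ∈ Finset.range N, (inner ℝ (M.lam i ω) a) ^ 2) →
      M.factorError N T ω ≤ CD * (N * T) →
      ∑ t ∈ Finset.range T, M.crossError N T t ω ≤ CR * (τ ^ 2 * T) →
      M.crossError N T t ω ≤ CR * τ ^ 2 →
      ‖regVec (M.state t ω)‖ ^ 2 ≤ Cz →
      |M.Phi P (b ⬝ᵥ regressor (M.w t ω) (g t)) - M.Phi P (M.β ⬝ᵥ M.z t ω)| ≤ D * τ := by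
  obtain ⟨ε, R, hε0, hM⟩ := hl.exists_loglik_lt hε M.βVec hc₁ hc₂ hK
  refine ⟨ε, R, hε0, fun c₃ Cz CS CR CD hc₃ hCz hCS hCR hCD => ?_⟩
  obtain ⟨σ₀, hσ₀, hM⟩ := hM c₃ hc₃
  obtain ⟨Kr, hKr, hM⟩ := hM (2 * Cz) (2 * √CS)
  obtain ⟨κ, hκ⟩ : ∃ κ, κ = kL * (c₁ / 2) ^ 2 / (4 * Cz) := ⟨_, rfl⟩
  have hκ0 : 0 < κ := by rw [hκ]; positivity
  obtain ⟨q, hq⟩ : ∃ q, q = (d : ℝ) / κ ^ 2 := ⟨_, rfl⟩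
  have hq0 : 0 ≤ q := by rw [hq]; positivity
  obtain ⟨Cρ, hCρ⟩ : ∃ Cρ, Cρ = 4 * Cz * q * CR := ⟨_, rfl⟩
  have hCρ0 : 0 ≤ Cρ := by rw [hCρ]; positivity
  obtain ⟨S, hS⟩ : ∃ S, S = √(2 * Cρ) + 1 := ⟨_, rfl⟩
  have hS1 : 1 ≤ S := by rw [hS]; linarith [Real.sqrt_nonneg (2 * Cρ)]
  have hS0 : 0 < S := by linarith
  have hS2 : 2 * Cρ ≤ S ^ 2 := by
    have h1 := Real.sq_sqrt (show 0 ≤ 2 * Cρ by positivity)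
    have h2 := Real.sqrt_nonneg (2 * Cρ)
    rw [hS]; nlinarith
  obtain ⟨T₁, hT₁⟩ := exists_nat_ge (CD / (kL * (c₁ / 2) ^ 2 / 4))
  refine ⟨min 1 (min (σ₀ / S) (1 / (4 * (q * CR + 1)))),
    2 * √B * (Kr * S * √Cz + (‖M.βVec‖ + Kr * σ₀) * √Cρ) + 1, max T₁ (2 * M.h + 1),
    lt_min one_pos (lt_min (by positivity) (by positivity)), by positivity, ?_⟩
  intro N T τ ω g b t hN hTT hτ hττ hτ2 ht hPCA hmax h1 h2 h3 h4 h5 h6 h7 h8 h9 h10 h11 h12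
  have hTh : 2 * M.h + 1 ≤ T := (le_max_right _ _).trans hTT
  have hT1 : T₁ ≤ T := (le_max_left _ _).trans hTT
  have hT0 : 0 < T := by omega
  have hT' : (0 : ℝ) < T := by exact_mod_cast hT0
  have hN' : (0 : ℝ) < N := by exact_mod_cast hN
  obtain ⟨n, hn⟩ : ∃ n, n = T - M.h := ⟨_, rfl⟩
  rw [← hn] at h3 h4 h5 h6 h7
  have hnT : n ≤ T := by omega
  have hTn : T ≤ 2 * n := by omega
  have hn0 : 0 < n := by omega
  have hTn' : (T : ℝ) ≤ 2 * n := by exact_mod_cast hTn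
  have hτ1 : τ ≤ 1 := hττ.trans (min_le_left _ _)
  have hτσ : τ ≤ σ₀ / S := hττ.trans ((min_le_right _ _).trans (min_le_left _ _))
  have hτq : τ ≤ 1 / (4 * (q * CR + 1)) := hττ.trans ((min_le_right _ _).trans (min_le_right _ _))
  have hττ2 : τ ^ 2 ≤ τ := by rw [sq]; exact mul_le_of_le_one_left hτ.le hτ1
  -- the estimated factors are a rotation of the factors plus a small error
  obtain ⟨A, ρ, hAρ⟩ := hPCA.exists_rotation hN hT0 (cF := c₁ / 2) (CF := Cz) (cL := kL)
    (half_pos hc₁) hCz hkL hκ (fun a => factor_lower_bound hc₁.le hnT hTn h4 a)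
    (le_trans (Finset.sum_le_sum fun t _ => by
      rw [norm_regVec_sq]
      change ‖M.f t ω‖ ^ 2 ≤ 1 + ‖M.w t ω‖ ^ 2 + ‖M.f t ω‖ ^ 2
      have := sq_nonneg ‖M.w t ω‖
      linarith) h2) h8
    (by
      refine h9.trans ?_
      rw [div_le_iff₀ (by positivity)] at hT₁
      have h13 : CD ≤ kL * (c₁ / 2) ^ 2 / 4 * T := by
        rw [mul_comm]
        refine hT₁.trans (mul_le_mul_of_nonneg_right (by exact_mod_cast hT1) (by positivity))
      have h14 := mul_le_mul_of_nonneg_right h13 (show 0 ≤ (N : ℝ) * T by positivity)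
      linarith [show kL * (c₁ / 2) ^ 2 / 4 * T * ((N : ℝ) * T) =
        kL * (c₁ / 2) ^ 2 / 4 * N * T ^ 2 by ring])
    (by
      rw [← hq]
      have h13 : q * CR * τ ≤ 1 / 4 := by
        rw [le_div_iff₀ (by positivity)] at hτq
        linarith
      have h14 : q * CR * τ ^ 2 ≤ q * CR * τ := mul_le_mul_of_nonneg_left hττ2 (by positivity)
      calc _ ≤ q * (CR * (τ ^ 2 * T)) := mul_le_mul_of_nonneg_left h10 hq0
        _ = q * CR * τ ^ 2 * T := by ring
        _ ≤ 1 / 4 * T := mul_le_mul_of_nonneg_right (h14.trans h13) hT'.le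
        _ = _ := by ring)
  rw [← hq] at hAρ
  -- `S * τ` bounds the root mean square error of the regressors over the `n` periods used
  have hσ0 : 0 < S * τ := by positivity
  have hσle : S * τ ≤ σ₀ := by rw [le_div_iff₀ hS0] at hτσ; linarith
  have hτT : √(T : ℝ) ≤ 2 * (n * (S * τ)) := by
    have e1 : 1 / √(T : ℝ) ≤ τ := by
      refine le_of_sq_le_sq ?_ hτ.le
      rw [div_pow, one_pow, Real.sq_sqrt hT'.le, hτ2, one_div]
      linarith [inv_pos.2 hN']
    have e2 : √(T : ℝ) = T * (1 / √(T : ℝ)) := by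
      rw [mul_one_div, Real.div_sqrt]
    rw [e2]
    calc (T : ℝ) * (1 / √(T : ℝ)) ≤ 2 * n * τ := mul_le_mul hTn' e1 (by positivity) (by positivity)
      _ ≤ 2 * n * (S * τ) := by
        refine mul_le_mul_of_nonneg_left ?_ (by positivity)
        exact le_mul_of_one_le_left hτ.le hS1
      _ = _ := by ring
  have hlt := hM n T (fun t => M.yLead t ω) (fun t => regVec (M.state t ω))
    (fun t => padVec (ρ t)) (S * τ) hn0 (fun t => M.yLead_mem t ω) hσ0 hσle
    (fun t ht => by rw [inner_βVec]; exact h1 t (by omega))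
    ((Finset.sum_le_sum_of_subset_of_nonneg (Finset.range_subset_range.2 hnT)
      fun t _ _ => by positivity).trans (h2.trans (by
        have := mul_le_mul_of_nonneg_left hTn' hCz.le
        linarith)))
    h3 h4 h5 h6
    ((norm_sum_score_le hl hε (fun t ht => h1 t (by omega)) h7).trans (by
      rw [Real.sqrt_mul hCS.le]
      have := mul_le_mul_of_nonneg_left hτT (Real.sqrt_nonneg CS)
      linarith))
    (by
      simp only [norm_padVec]
      calc ∑ t ∈ Finset.range n, ‖ρ t‖ ^ 2
          ≤ ∑ t ∈ Finset.range n, 4 * Cz * q * M.crossError N T t ω :=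
            Finset.sum_le_sum fun t ht => (hAρ t (by
              have := Finset.mem_range.1 ht; omega)).2
        _ ≤ ∑ t ∈ Finset.range T, 4 * Cz * q * M.crossError N T t ω :=
            Finset.sum_le_sum_of_subset_of_nonneg (Finset.range_subset_range.2 hnT)
              fun t _ _ => mul_nonneg (by positivity) (by unfold crossError; positivity)
        _ ≤ 4 * Cz * q * (CR * (τ ^ 2 * T)) := by
            rw [← Finset.mul_sum]
            exact mul_le_mul_of_nonneg_left h10 (by positivity)
        _ = Cρ * τ ^ 2 * T := by rw [hCρ]; ring
        _ ≤ Cρ * τ ^ 2 * (2 * n) := mul_le_mul_of_nonneg_left hTn' (by positivity)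
        _ = n * (2 * Cρ * τ ^ 2) := by ring
        _ ≤ n * (S * τ) ^ 2 := by
            rw [mul_pow]
            gcongr)
  obtain ⟨hex, hball⟩ := exists_isMaxOn_logLik hl (fun t ht => (hAρ t ht).1)
    (r := Kr * (S * τ)) (by positivity) (fun θ hθ => by rw [← hn]; exact hlt θ hθ)
  have hr := hball b (hmax hex)
  refine (abs_prediction_error_le hl (hAρ t ht).1 b).trans ?_
  have hz : ‖regVec (M.state t ω)‖ ≤ √Cz := Real.le_sqrt_of_sq_le h12
  have hρ : ‖ρ t‖ ≤ √Cρ * τ := by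
    have e1 : ‖ρ t‖ ^ 2 ≤ Cρ * τ ^ 2 := (hAρ t ht).2.trans (by
      have := mul_le_mul_of_nonneg_left h11 (show 0 ≤ 4 * Cz * q by positivity)
      rw [hCρ]; linarith)
    have e2 := Real.le_sqrt_of_sq_le e1
    rwa [Real.sqrt_mul hCρ0, Real.sqrt_sq hτ.le] at e2
  have hr0 : Kr * (S * τ) ≤ Kr * σ₀ := mul_le_mul_of_nonneg_left hσle hKr.le
  have p1 : ‖reparam A b - M.βVec‖ * ‖regVec (M.state t ω)‖ ≤ Kr * (S * τ) * √Cz :=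
    mul_le_mul hr hz (norm_nonneg _) (by positivity)
  have p2 : (‖M.βVec‖ + ‖reparam A b - M.βVec‖) * ‖ρ t‖ ≤
      (‖M.βVec‖ + Kr * σ₀) * (√Cρ * τ) :=
    mul_le_mul (by linarith) hρ (norm_nonneg _) (by positivity)
  have p3 := mul_le_mul_of_nonneg_left (add_le_add p1 p2) (show 0 ≤ 2 * √B by positivity)
  refine p3.trans (le_trans (le_of_eq ?_) (mul_le_mul_of_nonneg_right
    (le_add_of_nonneg_right zero_le_one) hτ.le))
  ring

end FactorBinaryModel

/-! ### The rate of convergence -/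

theorem measure_not_and_le {Ω : Type*} [MeasurableSpace Ω] {P : Measure Ω} {A B : Ω → Prop}
    {a b : ℝ} (ha : 0 ≤ a) (hb : 0 ≤ b) (hA : P {ω | ¬ A ω} ≤ ENNReal.ofReal a)
    (hB : P {ω | ¬ B ω} ≤ ENNReal.ofReal b) :
    P {ω | ¬ (A ω ∧ B ω)} ≤ ENNReal.ofReal (a + b) := by
  rw [ENNReal.ofReal_add ha hb]
  refine le_trans (measure_mono fun ω hω => ?_) ((measure_union_le {ω | ¬ A ω} {ω | ¬ B ω}).trans
    (add_le_add hA hB))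
  exact not_and_or.1 hω

theorem tendsto_sqrt_inv_add_inv :
    Tendsto (fun n : ℕ × ℕ => √((n.1 : ℝ)⁻¹ + (n.2 : ℝ)⁻¹)) (atTop ×ˢ atTop) (𝓝 0) := by
  have h := tendsto_inv_atTop_zero.comp (tendsto_natCast_atTop_atTop (R := ℝ))
  have h1 := (h.comp (tendsto_fst (f := (atTop : Filter ℕ)) (g := (atTop : Filter ℕ)))).add
    (h.comp (tendsto_snd (f := (atTop : Filter ℕ)) (g := (atTop : Filter ℕ))))
  rw [add_zero] at h1
  simpa [Function.comp_def] using h1.sqrt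

theorem sqrt_inv_add_inv_le {N T : ℕ} (hN : 0 < N) (hT : 0 < T) :
    √((N : ℝ)⁻¹ + (T : ℝ)⁻¹) ≤ √2 * (1 / min (√(N : ℝ)) (√(T : ℝ))) := by
  have hN' : (0 : ℝ) < N := by exact_mod_cast hN
  have hT' : (0 : ℝ) < T := by exact_mod_cast hT
  rw [← (show Monotone Real.sqrt from fun _ _ h => Real.sqrt_le_sqrt h).map_min, mul_one_div,
    ← Real.sqrt_div zero_le_two]
  refine Real.sqrt_le_sqrt ?_
  have hm : 0 < min (N : ℝ) T := lt_min hN' hT'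
  have h1 := inv_anti₀ hm (min_le_left (N : ℝ) T)
  have h2 := inv_anti₀ hm (min_le_right (N : ℝ) T)
  rw [div_eq_mul_inv]
  linarith

theorem theorem3 {Ω : Type*} [MeasurableSpace Ω] (P : Measure Ω) [IsProbabilityMeasure P]
    {p d : ℕ} (M : FactorBinaryModel Ω p d)
    -- the assumptions
    (δ : ℝ) (Slam : Matrix (Fin d) (Fin d) ℝ) (hsampling : M.SamplingAssumptions P δ Slam)
    (Ξl Ξu : ℕ → ℝ) (c B bL bU : ℝ) (hlik : M.LikelihoodAssumptions P Ξl Ξu c B bL bU)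
    (Ωβ : Matrix (Coef p d) (Coef p d) ℝ) (hcov : M.CovarianceAssumptions P Ωβ)
    -- principal component estimates of the factors from the sample of size `(N, T)`
    (fTilde : ℕ → ℕ → Ω → ℕ → EuclideanSpace ℝ (Fin d))
    (hPCA : ∀ N T ω, d ≤ T → M.IsPCA N T ω (fTilde N T ω))
    -- a maximizer of the log-likelihood, whenever there is one
    (βHat : ℕ → ℕ → Ω → Coef p d → ℝ)
    (hMLE : ∀ N T ω, (∃ b, IsMaxOn (M.logLik P T ω (fTilde N T ω)) Set.univ b) →
      IsMaxOn (M.logLik P T ω (fTilde N T ω)) Set.univ (βHat N T ω))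
    -- the period at which the probability is predicted, fixed or moving with the sample size
    (t : ℕ → ℕ → ℕ) (ht : ∀ᶠ n : ℕ × ℕ in atTop ×ˢ atTop, t n.1 n.2 < n.2) :
    IsBigOP P (atTop ×ˢ atTop : Filter (ℕ × ℕ))
      (fun n ω =>
        M.Phi P (βHat n.1 n.2 ω ⬝ᵥ
            regressor (M.w (t n.1 n.2) ω) (fTilde n.1 n.2 ω (t n.1 n.2))) -
          M.Phi P (M.β ⬝ᵥ M.z (t n.1 n.2) ω))
      (fun n => 1 / min (√(n.1 : ℝ)) (√(n.2 : ℝ))) := by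
  intro η hη
  -- twelve exceptional events share the probability `η`
  obtain ⟨e, he⟩ : ∃ e, e = η / 12 := ⟨_, rfl⟩
  have he0 : 0 < e := by rw [he]; positivity
  have hε := hsampling.measurable_ε 0
  obtain ⟨c₁, hc₁, ev₁⟩ := M.exists_lower_bound_min_sq hsampling hlik hcov
  obtain ⟨c₂, hc₂, ev₂⟩ := M.exists_lower_bound_ramp hsampling hlik hcov
  obtain ⟨kL, hkL, evL⟩ := M.exists_loading_bound hsampling
  have hbL := hlik.bL_pos
  have hB := hlik.B_pos
  obtain ⟨K, hK, evK⟩ := M.exists_tail_level hsampling hlik hcov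
    (s := bL * c₁ / (32 * (bL + B))) (by positivity) he0
  obtain ⟨ε, R, hε0, hpred⟩ := M.exists_prediction_bound hlik hε hc₁ hc₂ hkL hK
  obtain ⟨c₃, hc₃, ev₃⟩ := M.exists_lower_bound_hellinger hsampling hlik hcov hε0 R
  obtain ⟨CS, hCS, evS⟩ := M.exists_score_bound hcov
  obtain ⟨CR, hCR, hR⟩ := hsampling.integral_crossError_le
  obtain ⟨CD, hCD, hD⟩ := hsampling.integral_factorError_le
  obtain ⟨Z, hZ⟩ : ∃ Z, Z = ∫ ω, ‖regVec (M.state 0 ω)‖ ^ 2 ∂P := ⟨_, rfl⟩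
  have hZ0 : 0 ≤ Z := by rw [hZ]; exact integral_nonneg fun ω => by positivity
  have hZi := M.integrable_sq_regVec hsampling hlik hcov
  have hZt : ∀ t, ∫ ω, ‖regVec (M.state t ω)‖ ^ 2 ∂P ≤ Z := fun t => by
    rw [hZ]; exact (M.integral_sq_regVec_eq hsampling t).le
  obtain ⟨τ₀, D, T₀, hτ₀, hD0, hbound⟩ := hpred c₃ ((Z + 1) / e) ((CS + 1) / e) ((CR + 1) / e)
    ((CD + 1) / e) hc₃ (by positivity) (by positivity) (by positivity) (by positivity)
  refine ⟨D * √2, by positivity, ?_⟩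
  have zero_le_e : ∀ {F : ℕ → ℝ≥0∞}, Tendsto F atTop (𝓝 0) →
      ∀ᶠ n in atTop, F n ≤ ENNReal.ofReal e := fun h =>
    ENNReal.tendsto_nhds_zero.1 h _ (ENNReal.ofReal_pos.2 he0)
  have hsub : Tendsto (fun T : ℕ => T - M.h) atTop atTop := tendsto_sub_atTop_nat M.h
  have evT := (((((zero_le_e (M.tendsto_support_compl hsampling hlik)).and
    (zero_le_e (ev₁.comp hsub))).and (zero_le_e (ev₂.comp hsub))).and
    (zero_le_e (ev₃.comp hsub))).and (evS e he0)).and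
    (eventually_ge_atTop (T₀ + d + M.h + 1))
  filter_upwards [tendsto_snd.eventually evT, tendsto_fst.eventually
    ((zero_le_e evL).and (eventually_gt_atTop 0)), ht,
    tendsto_sqrt_inv_add_inv.eventually (ge_mem_nhds hτ₀)] with n hT hN htn hτ
  obtain ⟨N, T⟩ := n
  simp only at hT hN htn hτ ⊢
  obtain ⟨⟨⟨⟨⟨g1, g4⟩, g5⟩, g6⟩, g7⟩, hTT⟩ := hT
  obtain ⟨g8, hN0⟩ := hN
  have hT0 : 0 < T := by omega
  have hN' : (0 : ℝ) < N := by exact_mod_cast hN0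
  have hT' : (0 : ℝ) < T := by exact_mod_cast hT0
  obtain ⟨τ, hτdef⟩ : ∃ τ, τ = √((N : ℝ)⁻¹ + (T : ℝ)⁻¹) := ⟨_, rfl⟩
  rw [← hτdef] at hτ
  have hτ0 : 0 < τ := by rw [hτdef]; positivity
  have hτ2 : τ ^ 2 = (N : ℝ)⁻¹ + (T : ℝ)⁻¹ := by rw [hτdef]; exact Real.sq_sqrt (by positivity)
  have g3 := evK (T - M.h) (by omega)
  have g2 := measure_sum_mul_lt_le (P := P) (Y := fun t ω => ‖regVec (M.state t ω)‖ ^ 2) hZ0 hZi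
    (fun t ω => by positivity) hZt he0 hT0
  have g12 := measure_mul_lt_le (P := P) (r := 1) (hZi (t N T)) (fun ω => by positivity) hZ0 one_pos
    he0 ((hZt _).trans (mul_one Z).ge)
  have hc0 : ∀ s ω, 0 ≤ M.crossError N T s ω := fun s ω => by
    unfold FactorBinaryModel.crossError; positivity
  have g11 := measure_mul_lt_le (P := P) (hR N T (t N T) hN0 hT0).1 (hc0 _) hCR (pow_pos hτ0 2) he0
    (by rw [hτ2]; exact (hR N T (t N T) hN0 hT0).2)
  have g10 := measure_mul_lt_le (P := P) (r := τ ^ 2 * T)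
    (integrable_finsetSum (Finset.range T) fun s _ => (hR N T s hN0 hT0).1)
    (fun ω => Finset.sum_nonneg fun s _ => hc0 s ω) hCR (by positivity) he0 (by
      rw [integral_finsetSum _ fun s _ => (hR N T s hN0 hT0).1]
      refine (Finset.sum_le_sum fun s _ => (hR N T s hN0 hT0).2).trans (le_of_eq ?_)
      rw [Finset.sum_const, Finset.card_range, nsmul_eq_mul, hτ2]
      ring)
  have g9 := measure_mul_lt_le (P := P) (hD N T).1 (fun ω => by
    unfold FactorBinaryModel.factorError; positivity) hCD (by positivity) he0 (hD N T).2
  simp only [← not_le] at g2 g3 g7 g9 g10 g11 g12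
  have hall := measure_not_and_le he0.le (by positivity) g1 <|
    measure_not_and_le he0.le (by positivity) g2 <|
    measure_not_and_le he0.le (by positivity) g3 <|
    measure_not_and_le he0.le (by positivity) g4 <|
    measure_not_and_le he0.le (by positivity) g5 <|
    measure_not_and_le he0.le (by positivity) g6 <|
    measure_not_and_le he0.le (by positivity) g7 <|
    measure_not_and_le he0.le (by positivity) g8 <|
    measure_not_and_le he0.le (by positivity) g9 <|
    measure_not_and_le he0.le (by positivity) g10 <|
    measure_not_and_le he0.le he0.le g11 g12
  refine le_trans (measure_mono fun ω hω => ?_) (hall.trans (ENNReal.ofReal_le_ofReal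
    (le_of_eq (by rw [he]; ring))))
  rintro ⟨a1, a2, a3, a4, a5, a6, a7, a8, a9, a10, a11, a12⟩
  have key := hbound N T τ ω (fTilde N T ω) (βHat N T ω) (t N T) hN0 (by omega) hτ0 hτ hτ2 htn
    (hPCA N T ω (by omega)) (hMLE N T ω) a1 a2 a3 a4 a5 a6 a7 a8 a9 a10 a11 (by simpa using a12)
  have hrate := mul_le_mul_of_nonneg_left (sqrt_inv_add_inv_le hN0 hT0) hD0.le
  rw [← hτdef, ← mul_assoc] at hrate
  exact absurd (key.trans hrate) (not_le.2 hω)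

end
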